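/- Conventions. An exact category is an additive category with a class of kernel–cokernel pairs ("short exact sequences") satisfying Quillen's axioms; an exact functor is an additive functor preserving short exact sequences. An exact category supports long exact sequences if every split epimorphism in it is an admissible epimorphism (equivalently, has a kernel); this is the condition under which exactness of bounded chain complexes can be tested in an ambient abelian category. A chain complex is acyclic if it is spliced from short exact sequences, and a chain map is a quasi-isomorphism if its mapping cone is acyclic. Let $F:\mathcal M\to\mathcal N$ be an exact functor between exact categories. An object of $B[F]$ is a triple $(M,N,u)$, where $M=(M^\top,M^\bot)$ is a pair of bounded ($\mathbb Z$-graded) chain complexes of $\mathcal M$, where $N=(N,d,d')$ is a bounded binary chain complex of $\mathcal N$ (a graded object with two differentials of degree $-1$), and where $u=(u^\top,u^\bot)$ consists of quasi-isomorphisms of chain complexes $u^\top:FM^\top\to (N,d)$ and $u^\bot:FM^\bot\to(N,d')$. A map $(M,N,u)\to(\tilde M,\tilde N,\tilde u)$ is a pair $(f,g)$, with $f=(f^\top,f^\bot)$ a pair of chain maps $M^\top\to\tilde M^\top$, $M^\bot\to\tilde M^\bot$ and $g:N\to\tilde N$ a map of graded objects commuting with both differentials, such that $\tilde u\circ Ff=g\circ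 u$. A sequence in $B[F]$ is short exact if it is short exact in each component and each degree. An object of $B[F]$ is diagonal if it has the form $((M,M),(N,d,d),(u,u))$ with $M$ and $(N,d)$ bounded chain complexes and $u:FM\to (N,d)$ a quasi-isomorphism. Let $p$ be the class of maps $(f,g)$ with $f^\top,f^\bot$ quasi-isomorphisms and $g$ an isomorphism. Define $K_0\Omega[F]$ to be the quotient of the Grothendieck group $K_0B[F]$ by the subgroup generated by the classes of diagonal objects and the differences $[X]-[Y]$ for all maps $X\to Y$ in $p$. A map of pairs $(G,H):[F:\mathcal M\to\mathcal N]\to[F':\mathcal M'\to\mathcal N']$, i.e. exact functors $G:\mathcal M\to\mathcal M'$ and $H:\mathcal N\to\mathcal N'$ with a natural isomorphism $HF\cong F'G$, induces a homomorphism $K_0\Omega[F]\to K_0\Omega[F']$, $[(M,N,u)]\mapsto[(GM,HN,Hu)]$, where $Hu$ is precomposed with $F'GM\cong HFM$. Theorem. Let $F:\mathcal M\to\mathcal N$ be an exact functor between exact categories that support long exact sequences, and let $0$ denote the zero exact category. Then the sequence of abelian groups $$K_0\Omega[0\to\mathcal M]\to K_0\Omega[0\to\mathcal N]\to K_0\Omega[\mathcal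 M\xrightarrow{F}\mathcal N]\to K_0\Omega[\mathcal M\to0]\to K_0\Omega[\mathcal N\to0]$$ induced by the maps of pairs $$[0\to\mathcal M]\xrightarrow{(1,F)}[0\to\mathcal N]\xrightarrow{(0,1)}[\mathcal M\xrightarrow{F}\mathcal N]\xrightarrow{(1,0)}[\mathcal M\to0]\xrightarrow{(F,1)}[\mathcal N\to0]$$ is exact (at each of the three middle groups). -/

import Mathlib

open CategoryTheory CategoryTheory.Limits

set_option linter.unusedSectionVars false

universe v u v₁ u₁ v₂ u₂ v₁' u₁' v₂' u₂'

namespace RelK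

/-! ### Exact categories in the sense of Quillen -/

section ExactCategories

variable {C : Type u} [Category.{v} C] [Preadditive C]

/-- `i` is an inflation (admissible monomorphism) for the class `E` of short exact sequences. -/
def IsInflation (E : ObjectProperty (ShortComplex C)) {X Y : C} (i : X ⟶ Y) : Prop :=
  ∃ (Z : C) (p : Y ⟶ Z) (w : i ≫ p = 0), E (ShortComplex.mk i p w)

/-- `p` is a deflation (admissible epimorphism) for the class `E` of short exact sequences. -/
def IsDeflation (E : ObjectProperty (ShortComplex C)) {Y Z : C} (p : Y ⟶ Z) : Prop :=
  ∃ (X : C) (i : X ⟶ Y) (w : i ≫ p = 0), E (ShortComplex.mk i p w)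

end ExactCategories

/-- An exact category: an additive category with a class of kernel-cokernel pairs, called
short exact sequences, that satisfies Quillen's axioms. -/
class ExactCategory (C : Type u) [Category.{v} C] [Preadditive C] [HasZeroObject C]
    [HasBinaryBiproducts C] where
  /-- The class of short exact sequences. -/
  shortExact : ObjectProperty (ShortComplex C)
  isKernel : ∀ S : ShortComplex C, shortExact S → Nonempty (IsLimit (KernelFork.ofι S.f S.zero))
  isCokernel : ∀ S : ShortComplex C, shortExact S →
    Nonempty (IsColimit (CokernelCofork.ofπ S.g S.zero))
  of_iso : ∀ S T : ShortComplex C, Nonempty (S ≅ T) → shortExact S → shortExact T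
  id_zero : ∀ X Z : C, IsZero Z →
    shortExact (ShortComplex.mk (𝟙 X) (0 : X ⟶ Z) comp_zero)
  zero_id : ∀ X Z : C, IsZero Z →
    shortExact (ShortComplex.mk (0 : Z ⟶ X) (𝟙 X) zero_comp)
  inflation_comp : ∀ {X Y Z : C} (i : X ⟶ Y) (j : Y ⟶ Z),
    IsInflation shortExact i → IsInflation shortExact j → IsInflation shortExact (i ≫ j)
  deflation_comp : ∀ {X Y Z : C} (p : X ⟶ Y) (q : Y ⟶ Z),
    IsDeflation shortExact p → IsDeflation shortExact q → IsDeflation shortExact (p ≫ q)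
  inflation_pushout : ∀ {X Y A : C} (i : X ⟶ Y) (f : X ⟶ A), IsInflation shortExact i →
    ∃ (B : C) (g : Y ⟶ B) (j : A ⟶ B), IsPushout i f g j ∧ IsInflation shortExact j
  deflation_pullback : ∀ {Y Z A : C} (p : Y ⟶ Z) (f : A ⟶ Z), IsDeflation shortExact p →
    ∃ (B : C) (g : B ⟶ Y) (q : B ⟶ A), IsPullback g q p f ∧ IsDeflation shortExact q

section

variable {C : Type u} [Category.{v} C] [Preadditive C] [HasZeroObject C] [HasBinaryBiproducts C]
  [ExactCategory C]

/-- `0 ⟶ X ⟶ Y ⟶ Z ⟶ 0`, with maps `f` and `g`, is a short exact sequence. -/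
def IsSES {X Y Z : C} (f : X ⟶ Y) (g : Y ⟶ Z) : Prop :=
  ∃ w : f ≫ g = 0, ExactCategory.shortExact (ShortComplex.mk f g w)

lemma IsSES.of_iso {X Y Z X' Y' Z' : C} {f : X ⟶ Y} {g : Y ⟶ Z} {f' : X' ⟶ Y'} {g' : Y' ⟶ Z'}
    (h : IsSES f g) (a : X ≅ X') (b : Y ≅ Y') (c : Z ≅ Z')
    (w₁ : a.hom ≫ f' = f ≫ b.hom) (w₂ : b.hom ≫ g' = g ≫ c.hom) : IsSES f' g' := by
  obtain ⟨w, h⟩ := h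
  have w' : f' ≫ g' = 0 := by
    rw [← cancel_epi a.hom, ← Category.assoc, w₁, Category.assoc, w₂, ← Category.assoc, w]
    simp
  exact ⟨w', ExactCategory.of_iso _ _
    ⟨ShortComplex.isoMk (S₁ := ShortComplex.mk f g w) (S₂ := ShortComplex.mk f' g' w')
      a b c w₁ w₂⟩ h⟩

variable (C) in
/-- The exact category `C` supports long exact sequences: every split epimorphism is an admissible
epimorphism (equivalently, every split epimorphism has a kernel). This is the condition under which
exactness of bounded complexes of `C` can be tested in an ambient abelian category. -/
def SupportsLongExactSequences : Prop :=
  ∀ ⦃X Y : C⦄ (r : X ⟶ Y), IsSplitEpi r → ∃ (K : C) (i : K ⟶ X), IsSES i r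

/-- A family of objects indexed by `ℤ` is bounded if almost all objects vanish. -/
def IsBounded (X : ℤ → C) : Prop :=
  ∃ a b : ℤ, ∀ i : ℤ, i < a ∨ b < i → IsZero (X i)

/-- A chain complex is acyclic (a long exact sequence) if it is obtained by splicing short exact
sequences `0 ⟶ Z i ⟶ K i ⟶ Z (i - 1) ⟶ 0`. -/
def IsAcyclic (K : ChainComplex C ℤ) : Prop :=
  ∃ (Z : ℤ → C) (ι : ∀ i, Z i ⟶ K.X i) (π : ∀ i, K.X i ⟶ Z (i - 1)),
    (∀ i, IsSES (ι i) (π i)) ∧ ∀ i, K.d i (i - 1) = π i ≫ ι (i - 1)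

/-- A chain map is a quasi-isomorphism if its mapping cone is acyclic. -/
def IsQuasiIso {K L : ChainComplex C ℤ} (f : K ⟶ L) : Prop :=
  IsAcyclic (HomologicalComplex.homotopyCofiber f)

lemma IsAcyclic.of_iso {K L : ChainComplex C ℤ} (hK : IsAcyclic K) (e : K ≅ L) :
    IsAcyclic L := by
  obtain ⟨Z, ι, π, h, hd⟩ := hK
  refine ⟨Z, fun i => ι i ≫ e.hom.f i, fun i => e.inv.f i ≫ π i, fun i => ?_, fun i => ?_⟩
  · exact (h i).of_iso (Iso.refl _) (HomologicalComplex.Hom.isoApp e i) (Iso.refl _)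
      (by simp) (by simp)
  · have h1 := e.inv.comm i (i - 1)
    rw [Category.assoc, ← Category.assoc (π i), ← hd, ← e.hom.comm, ← Category.assoc,
      ← HomologicalComplex.comp_f, e.inv_hom_id, HomologicalComplex.id_f, Category.id_comp]

lemma IsQuasiIso.of_arrow_iso {K L K' L' : ChainComplex C ℤ} {f : K ⟶ L} {f' : K' ⟶ L'}
    (hf : IsQuasiIso f) (a : K ≅ K') (b : L ≅ L') (w : a.hom ≫ f' = f ≫ b.hom) :
    IsQuasiIso f' :=
  IsAcyclic.of_iso hf (HomologicalComplex.homotopyCofiber.mapArrowIso f f'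
    (fun j => ⟨j + 1, rfl⟩) (Arrow.isoMk a b w))

end

/-! ### Exact functors -/

section

variable {C : Type u₁} [Category.{v₁} C] [Preadditive C] [HasZeroObject C]
  [HasBinaryBiproducts C] [ExactCategory C]
  {D : Type u₂} [Category.{v₂} D] [Preadditive D] [HasZeroObject D]
  [HasBinaryBiproducts D] [ExactCategory D]

/-- An exact functor: an additive functor that preserves short exact sequences. -/
class IsExactFunctor (F : C ⥤ D) : Prop extends F.Additive where
  map_ses : ∀ {X Y Z : C} (f : X ⟶ Y) (g : Y ⟶ Z), IsSES f g → IsSES (F.map f) (F.map g)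

/-- The functor on chain complexes induced by an additive functor. -/
noncomputable abbrev mapC (F : C ⥤ D) [F.Additive] : ChainComplex C ℤ ⥤ ChainComplex D ℤ :=
  F.mapHomologicalComplex (ComplexShape.down ℤ)

lemma IsBounded.map {X : ℤ → C} (hX : IsBounded X) (F : C ⥤ D) [F.Additive] :
    IsBounded (fun i => F.obj (X i)) := by
  obtain ⟨a, b, h⟩ := hX
  exact ⟨a, b, fun i hi => F.map_isZero (h i hi)⟩

lemma IsAcyclic.map {K : ChainComplex C ℤ} (hK : IsAcyclic K) (F : C ⥤ D) [IsExactFunctor F] :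
    IsAcyclic ((mapC F).obj K) := by
  obtain ⟨Z, ι, π, h, hd⟩ := hK
  refine ⟨fun i => F.obj (Z i), fun i => F.map (ι i), fun i => F.map (π i),
    fun i => IsExactFunctor.map_ses _ _ (h i), fun i => ?_⟩
  exact (congrArg F.map (hd i)).trans (F.map_comp _ _)

lemma IsQuasiIso.map {K L : ChainComplex C ℤ} {f : K ⟶ L} (hf : IsQuasiIso f) (F : C ⥤ D)
    [IsExactFunctor F] : IsQuasiIso ((mapC F).map f) :=
  (IsAcyclic.map hf F).of_iso
    (HomologicalComplex.homotopyCofiber.mapHomologicalComplexObjIso f F)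

instance : IsExactFunctor (𝟭 C) where
  map_ses _ _ h := h

end

/-! ### Binary chain complexes -/

/-- A binary chain complex: a graded object with two differentials of degree `-1`. -/
structure BinaryComplex (C : Type u) [Category.{v} C] [Preadditive C] where
  /-- The underlying graded object. -/
  X : ℤ → C
  /-- The top differential. -/
  dTop : ∀ i j, X i ⟶ X j
  /-- The bottom differential. -/
  dBot : ∀ i j, X i ⟶ X j
  shapeTop : ∀ i j, ¬ (ComplexShape.down ℤ).Rel i j → dTop i j = 0
  shapeBot : ∀ i j, ¬ (ComplexShape.down ℤ).Rel i j → dBot i j = 0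
  dTop_comp_dTop : ∀ i j k, (ComplexShape.down ℤ).Rel i j → (ComplexShape.down ℤ).Rel j k →
    dTop i j ≫ dTop j k = 0
  dBot_comp_dBot : ∀ i j k, (ComplexShape.down ℤ).Rel i j → (ComplexShape.down ℤ).Rel j k →
    dBot i j ≫ dBot j k = 0

namespace BinaryComplex

variable {C : Type u} [Category.{v} C] [Preadditive C]

/-- The chain complex given by the top differential. -/
def top (K : BinaryComplex C) : ChainComplex C ℤ where
  X := K.X
  d := K.dTop
  shape := K.shapeTop
  d_comp_d' := K.dTop_comp_dTop

/-- The chain complex given by the bottom differential. -/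
def bot (K : BinaryComplex C) : ChainComplex C ℤ where
  X := K.X
  d := K.dBot
  shape := K.shapeBot
  d_comp_d' := K.dBot_comp_dBot

/-- A map of binary complexes: one map of graded objects that commutes with both differentials. -/
@[ext]
structure Hom (K L : BinaryComplex C) where
  f : ∀ i, K.X i ⟶ L.X i
  commTop : ∀ i j, f i ≫ L.dTop i j = K.dTop i j ≫ f j
  commBot : ∀ i j, f i ≫ L.dBot i j = K.dBot i j ≫ f j

instance : Category (BinaryComplex C) where
  Hom := Hom
  id K := ⟨fun i => 𝟙 _, fun _ _ => by simp, fun _ _ => by simp⟩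
  comp f g := ⟨fun i => f.f i ≫ g.f i,
    fun i j => by rw [Category.assoc, g.commTop, ← Category.assoc, f.commTop, Category.assoc],
    fun i j => by rw [Category.assoc, g.commBot, ← Category.assoc, f.commBot, Category.assoc]⟩
  id_comp f := Hom.ext (funext fun _ => Category.id_comp _)
  comp_id f := Hom.ext (funext fun _ => Category.comp_id _)
  assoc f g h := Hom.ext (funext fun _ => Category.assoc _ _ _)

/-- The map between the top chain complexes induced by a map of binary complexes. -/
def mapTop {K L : BinaryComplex C} (f : K ⟶ L) : K.top ⟶ L.top where
  f := Hom.f f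
  comm' i j _ := Hom.commTop f i j

/-- The map between the bottom chain complexes induced by a map of binary complexes. -/
def mapBot {K L : BinaryComplex C} (f : K ⟶ L) : K.bot ⟶ L.bot where
  f := Hom.f f
  comm' i j _ := Hom.commBot f i j

lemma mapTop_id (K : BinaryComplex C) : mapTop (𝟙 K) = 𝟙 K.top := rfl

lemma mapBot_id (K : BinaryComplex C) : mapBot (𝟙 K) = 𝟙 K.bot := rfl

lemma mapTop_comp {K L P : BinaryComplex C} (f : K ⟶ L) (g : L ⟶ P) :
    mapTop (f ≫ g) = mapTop f ≫ mapTop g := rfl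

lemma mapBot_comp {K L P : BinaryComplex C} (f : K ⟶ L) (g : L ⟶ P) :
    mapBot (f ≫ g) = mapBot f ≫ mapBot g := rfl

/-- The diagonal binary complex `(K, d, d)`. -/
def diag (K : ChainComplex C ℤ) : BinaryComplex C where
  X := K.X
  dTop := K.d
  dBot := K.d
  shapeTop := K.shape
  shapeBot := K.shape
  dTop_comp_dTop := K.d_comp_d'
  dBot_comp_dBot := K.d_comp_d'

/-- The functor on binary complexes induced by an additive functor. -/
@[simps]
def mapB {D : Type u₁} [Category.{v₁} D] [Preadditive D] (F : C ⥤ D) [F.Additive] :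
    BinaryComplex C ⥤ BinaryComplex D where
  obj K :=
    { X := fun i => F.obj (K.X i)
      dTop := fun i j => F.map (K.dTop i j)
      dBot := fun i j => F.map (K.dBot i j)
      shapeTop := fun i j h => by rw [K.shapeTop i j h, F.map_zero]
      shapeBot := fun i j h => by rw [K.shapeBot i j h, F.map_zero]
      dTop_comp_dTop := fun i j k h h' => by
        rw [← F.map_comp, K.dTop_comp_dTop i j k h h', F.map_zero]
      dBot_comp_dBot := fun i j k h h' => by
        rw [← F.map_comp, K.dBot_comp_dBot i j k h h', F.map_zero] }
  map f :=
    { f := fun i => F.map (f.f i)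
      commTop := fun i j => by rw [← F.map_comp, f.commTop, F.map_comp]
      commBot := fun i j => by rw [← F.map_comp, f.commBot, F.map_comp] }
  map_id _ := Hom.ext (funext fun _ => F.map_id _)
  map_comp _ _ := Hom.ext (funext fun _ => F.map_comp _ _)

end BinaryComplex

/-! ### The categories `C[F]` and `B[F]`, and the group `K₀Ω[F]` -/

section

variable {M : Type u₁} [Category.{v₁} M] [Preadditive M] [HasZeroObject M]
  [HasBinaryBiproducts M] [ExactCategory M]
  {N : Type u₂} [Category.{v₂} N] [Preadditive N] [HasZeroObject N]
  [HasBinaryBiproducts N] [ExactCategory N]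

/-- The objects of `C[F]`: triples of a bounded chain complex of `M`, a bounded chain complex
of `N`, and a quasi-isomorphism from the image of the first to the second. -/
structure CObj (F : M ⥤ N) [F.Additive] where
  src : ChainComplex M ℤ
  tar : ChainComplex N ℤ
  src_bounded : IsBounded src.X
  tar_bounded : IsBounded tar.X
  comp : (mapC F).obj src ⟶ tar
  comp_quasiIso : IsQuasiIso comp

/-- The objects of `B[F]`: triples of a pair of bounded chain complexes of `M`, a bounded binary
chain complex of `N`, and a pair of quasi-isomorphisms from the image of the former to the pair of
chain complexes given by the latter. -/
structure BObj (F : M ⥤ N) [F.Additive] where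
  srcTop : ChainComplex M ℤ
  srcBot : ChainComplex M ℤ
  tar : BinaryComplex N
  srcTop_bounded : IsBounded srcTop.X
  srcBot_bounded : IsBounded srcBot.X
  tar_bounded : IsBounded tar.X
  compTop : (mapC F).obj srcTop ⟶ tar.top
  compBot : (mapC F).obj srcBot ⟶ tar.bot
  compTop_quasiIso : IsQuasiIso compTop
  compBot_quasiIso : IsQuasiIso compBot

namespace BObj

variable {F : M ⥤ N} [F.Additive]

/-- The maps of `B[F]`. -/
@[ext]
structure Hom (X Y : BObj F) where
  srcTop : X.srcTop ⟶ Y.srcTop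
  srcBot : X.srcBot ⟶ Y.srcBot
  tar : X.tar ⟶ Y.tar
  commTop : (mapC F).map srcTop ≫ Y.compTop =
    X.compTop ≫ BinaryComplex.mapTop tar
  commBot : (mapC F).map srcBot ≫ Y.compBot =
    X.compBot ≫ BinaryComplex.mapBot tar

instance : Category (BObj F) where
  Hom := Hom
  id X := ⟨𝟙 _, 𝟙 _, 𝟙 _,
    by rw [CategoryTheory.Functor.map_id, BinaryComplex.mapTop_id, Category.id_comp, Category.comp_id],
    by rw [CategoryTheory.Functor.map_id, BinaryComplex.mapBot_id, Category.id_comp, Category.comp_id]⟩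
  comp f g := ⟨f.srcTop ≫ g.srcTop, f.srcBot ≫ g.srcBot, f.tar ≫ g.tar,
    by rw [Functor.map_comp, BinaryComplex.mapTop_comp, Category.assoc, g.commTop,
        ← Category.assoc, f.commTop, Category.assoc],
    by rw [Functor.map_comp, BinaryComplex.mapBot_comp, Category.assoc, g.commBot,
        ← Category.assoc, f.commBot, Category.assoc]⟩
  id_comp f := Hom.ext (Category.id_comp _) (Category.id_comp _) (Category.id_comp _)
  comp_id f := Hom.ext (Category.comp_id _) (Category.comp_id _) (Category.comp_id _)
  assoc f g h := Hom.ext (Category.assoc _ _ _) (Category.assoc _ _ _) (Category.assoc _ _ _)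

/-- The diagonal functor `Δ : C[F] ⟶ B[F]` on objects. -/
def diag (W : CObj F) : BObj F where
  srcTop := W.src
  srcBot := W.src
  tar := BinaryComplex.diag W.tar
  srcTop_bounded := W.src_bounded
  srcBot_bounded := W.src_bounded
  tar_bounded := W.tar_bounded
  compTop := W.comp
  compBot := W.comp
  compTop_quasiIso := W.comp_quasiIso
  compBot_quasiIso := W.comp_quasiIso

/-- `0 ⟶ X ⟶ Y ⟶ Z ⟶ 0` is a short exact sequence of `B[F]`: it is short exact in each
component and each degree. -/
structure IsExact {X Y Z : BObj F} (f : X ⟶ Y) (g : Y ⟶ Z) : Prop where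
  srcTop : ∀ i, IsSES (f.srcTop.f i) (g.srcTop.f i)
  srcBot : ∀ i, IsSES (f.srcBot.f i) (g.srcBot.f i)
  tar : ∀ i, IsSES (f.tar.f i) (g.tar.f i)

/-- The subcategory `p = (q, i)` of `B[F]`: the source component is a (pair of)
quasi-isomorphism(s) and the target component is an isomorphism of binary complexes. -/
structure IsP {X Y : BObj F} (f : X ⟶ Y) : Prop where
  srcTop : IsQuasiIso f.srcTop
  srcBot : IsQuasiIso f.srcBot
  tar : IsIso f.tar

end BObj

/-- The relations that define `K₀Ω[F]`: additivity on short exact sequences of `B[F]`, vanishing of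
diagonal objects, and equality of the source and the target of each map in `p`. -/
inductive OmegaRel (F : M ⥤ N) [F.Additive] : FreeAbelianGroup (BObj F) → Prop
  | exact {X Y Z : BObj F} (f : X ⟶ Y) (g : Y ⟶ Z) (h : BObj.IsExact f g) :
      OmegaRel F (FreeAbelianGroup.of Y - FreeAbelianGroup.of X - FreeAbelianGroup.of Z)
  | diag (W : CObj F) : OmegaRel F (FreeAbelianGroup.of (BObj.diag W))
  | weq {X Y : BObj F} (f : X ⟶ Y) (h : BObj.IsP f) :
      OmegaRel F (FreeAbelianGroup.of X - FreeAbelianGroup.of Y)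

/-- The subgroup generated by the relations. -/
def omegaRelations (F : M ⥤ N) [F.Additive] : AddSubgroup (FreeAbelianGroup (BObj F)) :=
  AddSubgroup.closure {x | OmegaRel F x}

/-- The group `K₀Ω[F]`, that is, `K₀ B[F]` modulo the classes of diagonal objects and the
differences of source and target of the maps in `p`. -/
abbrev K0Omega (F : M ⥤ N) [F.Additive] : Type (max u₁ v₁ u₂ v₂) :=
  FreeAbelianGroup (BObj F) ⧸ omegaRelations F

end

/-! ### Maps of pairs and functoriality -/

section

variable {M : Type u₁} [Category.{v₁} M] [Preadditive M] [HasZeroObject M]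
  [HasBinaryBiproducts M] [ExactCategory M]
  {N : Type u₂} [Category.{v₂} N] [Preadditive N] [HasZeroObject N]
  [HasBinaryBiproducts N] [ExactCategory N]
  {M' : Type u₁'} [Category.{v₁'} M'] [Preadditive M'] [HasZeroObject M']
  [HasBinaryBiproducts M'] [ExactCategory M']
  {N' : Type u₂'} [Category.{v₂'} N'] [Preadditive N'] [HasZeroObject N']
  [HasBinaryBiproducts N'] [ExactCategory N']

/-- A map of pairs `(G, H) : [F : M ⟶ N] ⟶ [F' : M' ⟶ N']`: exact functors `G : M ⟶ M'` and
`H : N ⟶ N'`, and a natural isomorphism that makes the square commute. -/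
structure PairMap (F : M ⥤ N) (F' : M' ⥤ N') where
  G : M ⥤ M'
  H : N ⥤ N'
  [exactG : IsExactFunctor G]
  [exactH : IsExactFunctor H]
  iso : F ⋙ H ≅ G ⋙ F'

namespace PairMap

attribute [instance] PairMap.exactG PairMap.exactH

variable {F : M ⥤ N} [F.Additive] {F' : M' ⥤ N'} [F'.Additive] (P : PairMap F F')

/-- The comparison isomorphism `F' G K ≅ H F K` of chain complexes. -/
noncomputable def isoC (K : ChainComplex M ℤ) :
    (mapC F').obj ((mapC P.G).obj K) ≅ (mapC P.H).obj ((mapC F).obj K) :=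
  HomologicalComplex.Hom.isoOfComponents (fun i => (P.iso.app (K.X i)).symm)
    (fun i j _ => (P.iso.inv.naturality (K.d i j)).symm)

lemma isoC_naturality {K L : ChainComplex M ℤ} (f : K ⟶ L) :
    (mapC F').map ((mapC P.G).map f) ≫ (P.isoC L).hom =
      (P.isoC K).hom ≫ (mapC P.H).map ((mapC F).map f) := by
  ext i
  exact P.iso.inv.naturality (f.f i)

lemma quasiIso_comp {K : ChainComplex M ℤ} {L : ChainComplex N ℤ} {u : (mapC F).obj K ⟶ L}
    (hu : IsQuasiIso u) : IsQuasiIso ((P.isoC K).hom ≫ (mapC P.H).map u) :=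
  (hu.map P.H).of_arrow_iso (P.isoC K).symm (Iso.refl _) (by simp)

lemma comm_aux {K K' : ChainComplex M ℤ} {L L' : ChainComplex N ℤ} {f : K ⟶ K'} {g : L ⟶ L'}
    {u : (mapC F).obj K ⟶ L} {u' : (mapC F).obj K' ⟶ L'} (h : (mapC F).map f ≫ u' = u ≫ g) :
    (mapC F').map ((mapC P.G).map f) ≫ ((P.isoC K').hom ≫ (mapC P.H).map u') =
      ((P.isoC K).hom ≫ (mapC P.H).map u) ≫ (mapC P.H).map g := by
  rw [← Category.assoc, isoC_naturality, Category.assoc, ← Functor.map_comp, h,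
    Functor.map_comp, Category.assoc]

/-- The map `C[F] ⟶ C[F']` on objects: `(M, N, u)` goes to `(GM, HN, Hu)`. -/
noncomputable def mapCObj (W : CObj F) : CObj F' where
  src := (mapC P.G).obj W.src
  tar := (mapC P.H).obj W.tar
  src_bounded := W.src_bounded.map P.G
  tar_bounded := W.tar_bounded.map P.H
  comp := (P.isoC W.src).hom ≫ (mapC P.H).map W.comp
  comp_quasiIso := P.quasiIso_comp W.comp_quasiIso

/-- The map `B[F] ⟶ B[F']` on objects: `(M, N, u)` goes to `(GM, HN, Hu)`. -/
noncomputable def mapBObj (X : BObj F) : BObj F' where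
  srcTop := (mapC P.G).obj X.srcTop
  srcBot := (mapC P.G).obj X.srcBot
  tar := (BinaryComplex.mapB P.H).obj X.tar
  srcTop_bounded := X.srcTop_bounded.map P.G
  srcBot_bounded := X.srcBot_bounded.map P.G
  tar_bounded := X.tar_bounded.map P.H
  compTop := (P.isoC X.srcTop).hom ≫ (mapC P.H).map X.compTop
  compBot := (P.isoC X.srcBot).hom ≫ (mapC P.H).map X.compBot
  compTop_quasiIso := P.quasiIso_comp X.compTop_quasiIso
  compBot_quasiIso := P.quasiIso_comp X.compBot_quasiIso

lemma mapBObj_diag (W : CObj F) : P.mapBObj (BObj.diag W) = BObj.diag (P.mapCObj W) := rfl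

/-- The map `B[F] ⟶ B[F']` on maps. -/
noncomputable def mapBHom {X Y : BObj F} (f : X ⟶ Y) : P.mapBObj X ⟶ P.mapBObj Y :=
  BObj.Hom.mk ((mapC P.G).map f.srcTop) ((mapC P.G).map f.srcBot)
    ((BinaryComplex.mapB P.H).map f.tar)
    (P.comm_aux f.commTop) (P.comm_aux f.commBot)

lemma omegaRelations_le : omegaRelations F ≤
    (omegaRelations F').comap (FreeAbelianGroup.map P.mapBObj) := by
  refine (AddSubgroup.closure_le _).2 ?_
  rintro _ (⟨f, g, h⟩ | W | ⟨f, h⟩)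
  · refine AddSubgroup.subset_closure ?_
    simp only [map_sub, FreeAbelianGroup.map_of_apply]
    exact OmegaRel.exact (P.mapBHom f) (P.mapBHom g)
      ⟨fun i => IsExactFunctor.map_ses _ _ (h.srcTop i),
        fun i => IsExactFunctor.map_ses _ _ (h.srcBot i),
        fun i => IsExactFunctor.map_ses _ _ (h.tar i)⟩
  · refine AddSubgroup.subset_closure ?_
    simp only [FreeAbelianGroup.map_of_apply, mapBObj_diag]
    exact OmegaRel.diag _
  · refine AddSubgroup.subset_closure ?_
    simp only [map_sub, FreeAbelianGroup.map_of_apply]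
    have := h.tar
    exact OmegaRel.weq (P.mapBHom f) ⟨h.srcTop.map P.G, h.srcBot.map P.G,
      inferInstanceAs (IsIso ((BinaryComplex.mapB P.H).map f.tar))⟩

/-- The map `K₀Ω[F] ⟶ K₀Ω[F']` induced by a map of pairs. -/
noncomputable def mapK0Omega : K0Omega F →+ K0Omega F' :=
  QuotientAddGroup.map _ _ (FreeAbelianGroup.map P.mapBObj) P.omegaRelations_le

end PairMap

end

/-! ### The zero exact category and the four maps of pairs -/

/-- The zero category, with one object and one map. -/
inductive ZeroCat : Type
  | pt

namespace ZeroCat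

instance : Category.{0} ZeroCat where
  Hom _ _ := PUnit
  id _ := PUnit.unit
  comp _ _ := PUnit.unit

instance (X Y : ZeroCat) : Subsingleton (X ⟶ Y) := inferInstanceAs (Subsingleton PUnit)

instance : Preadditive ZeroCat where
  homGroup _ _ := inferInstanceAs (AddCommGroup PUnit)

lemma isZero (X : ZeroCat) : IsZero X :=
  (IsZero.iff_id_eq_zero X).2 (Subsingleton.elim _ _)

instance : HasZeroObject ZeroCat := ⟨⟨pt, isZero pt⟩⟩

instance : HasBinaryBiproducts ZeroCat where
  has_binary_biproduct X Y := HasBinaryBiproduct.mk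
    { bicone :=
        { pt := pt, fst := 0, snd := 0, inl := 0, inr := 0
          inl_fst := Subsingleton.elim _ _
          inr_snd := Subsingleton.elim _ _ }
      isBilimit := isBinaryBilimitOfTotal _ (Subsingleton.elim _ _) }

instance : ExactCategory ZeroCat where
  shortExact := fun _ => True
  isKernel _ _ := ⟨KernelFork.IsLimit.ofι _ _ (fun _ _ => 0) (fun _ _ => Subsingleton.elim _ _)
    (fun _ _ _ _ => Subsingleton.elim _ _)⟩
  isCokernel _ _ := ⟨CokernelCofork.IsColimit.ofπ _ _ (fun _ _ => 0)
    (fun _ _ => Subsingleton.elim _ _) (fun _ _ _ _ => Subsingleton.elim _ _)⟩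
  of_iso _ _ _ _ := trivial
  id_zero _ _ _ := trivial
  zero_id _ _ _ := trivial
  inflation_comp _ _ _ _ := ⟨pt, 0, Subsingleton.elim _ _, trivial⟩
  deflation_comp _ _ _ _ := ⟨pt, 0, Subsingleton.elim _ _, trivial⟩
  inflation_pushout _ _ _ := ⟨pt, 0, 0,
    ⟨⟨Subsingleton.elim _ _⟩, ⟨PushoutCocone.IsColimit.mk _ (fun _ => 0)
      (fun _ => Subsingleton.elim _ _) (fun _ => Subsingleton.elim _ _)
      (fun _ _ _ _ => Subsingleton.elim _ _)⟩⟩, ⟨pt, 0, Subsingleton.elim _ _, trivial⟩⟩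
  deflation_pullback _ _ _ := ⟨pt, 0, 0,
    ⟨⟨Subsingleton.elim _ _⟩, ⟨PullbackCone.IsLimit.mk _ (fun _ => 0)
      (fun _ => Subsingleton.elim _ _) (fun _ => Subsingleton.elim _ _)
      (fun _ _ _ _ => Subsingleton.elim _ _)⟩⟩, ⟨pt, 0, Subsingleton.elim _ _, trivial⟩⟩

variable (C : Type u) [Category.{v} C] [Preadditive C] [HasZeroObject C]
  [HasBinaryBiproducts C] [ExactCategory C]

open scoped ZeroObject in
/-- The functor `0 ⟶ C`. -/
noncomputable def fromZero : ZeroCat ⥤ C where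
  obj _ := 0
  map _ := 𝟙 _

lemma isZero_fromZero (X : ZeroCat) : IsZero ((fromZero C).obj X) := isZero_zero C

/-- The functor `C ⟶ 0`. -/
def toZero : C ⥤ ZeroCat where
  obj _ := pt
  map _ := 𝟙 _

instance : IsExactFunctor (fromZero C) where
  map_add := (isZero_zero C).eq_of_src _ _
  map_ses {X Y Z} _ _ _ := by
    refine ⟨(isZero_zero C).eq_of_src _ _, ?_⟩
    refine ExactCategory.of_iso _ _ ⟨?_⟩ (ExactCategory.id_zero ((fromZero C).obj X) ((fromZero C).obj Z) (isZero_zero C))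
    exact ShortComplex.isoMk (Iso.refl _) (Iso.refl _) (Iso.refl _)
      ((isZero_zero C).eq_of_src _ _) ((isZero_zero C).eq_of_src _ _)

instance : IsExactFunctor (toZero C) where
  map_add := Subsingleton.elim _ _
  map_ses _ _ _ := ⟨Subsingleton.elim _ _, trivial⟩

end ZeroCat

open ZeroCat

/-- Functors all of whose values are zero objects are (uniquely) isomorphic. -/
noncomputable def isoOfIsZero {C : Type u₁} [Category.{v₁} C] {D : Type u₂} [Category.{v₂} D]
    {F G : C ⥤ D} (hF : ∀ X, IsZero (F.obj X)) (hG : ∀ X, IsZero (G.obj X)) : F ≅ G :=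
  NatIso.ofComponents (fun X => (hF X).iso (hG X)) (fun _ => (hF _).eq_of_src _ _)

section

variable {M : Type u₁} [Category.{v₁} M] [Preadditive M] [HasZeroObject M]
  [HasBinaryBiproducts M] [ExactCategory M]
  {N : Type u₂} [Category.{v₂} N] [Preadditive N] [HasZeroObject N]
  [HasBinaryBiproducts N] [ExactCategory N]
  (F : M ⥤ N) [IsExactFunctor F]

/-- The map of pairs `(1, F) : [0 ⟶ M] ⟶ [0 ⟶ N]`. -/
noncomputable def pairMap₁ : PairMap (fromZero M) (fromZero N) where
  G := 𝟭 ZeroCat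
  H := F
  iso := isoOfIsZero (fun X => F.map_isZero (isZero_fromZero M X)) (isZero_fromZero N)

/-- The map of pairs `(0, 1) : [0 ⟶ N] ⟶ [F : M ⟶ N]`. -/
noncomputable def pairMap₂ : PairMap (fromZero N) F where
  G := fromZero M
  H := 𝟭 N
  iso := isoOfIsZero (isZero_fromZero N) (fun X => F.map_isZero (isZero_fromZero M X))

/-- The map of pairs `(1, 0) : [F : M ⟶ N] ⟶ [M ⟶ 0]`. -/
noncomputable def pairMap₃ : PairMap F (toZero M) where
  G := 𝟭 M
  H := toZero N
  iso := isoOfIsZero (fun _ => ZeroCat.isZero _) (fun _ => ZeroCat.isZero _)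

/-- The map of pairs `(F, 1) : [M ⟶ 0] ⟶ [N ⟶ 0]`. -/
noncomputable def pairMap₄ : PairMap (toZero M) (toZero N) where
  G := F
  H := 𝟭 ZeroCat
  iso := isoOfIsZero (fun _ => ZeroCat.isZero _) (fun _ => ZeroCat.isZero _)

end

end RelK

/-! The group `K₀Ω[0 ⟶ C]` is made of acyclic bounded binary complexes modulo diagonal ones, so it
plays the role of `K₁ C`. In `K₀Ω[M ⟶ 0]` only a pair of complexes up to quasi-isomorphism survives,
so it plays the role of `K₀ M`.

The link between `K₀Ω[F]` and `K₁ N` is a binary resolution. Suppose the top and bottom of one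
binary complex `P` of `M` map quasi-isomorphically to the two sources of `X`. Composing with the
comparison maps of `X` gives quasi-isomorphisms from `FP` to the target of `X`, and their cone is an
acyclic binary complex of `N` whose class maps to the class of `X` (`Res.cls_eq`, from
`cls_binObj`). Behind this lies `eq_zero_of_additive`: an additive function on all bounded binary
complexes, acyclic or not, that kills the diagonal ones is zero, because such complexes are iterated
extensions of complexes concentrated in one degree. It also yields the calculus of cones in `K₁`:
shifts are negatives, and the cone of a composite is the sum of the cones.

A resolution exists once the sources are isomorphic as graded objects after adding bounded acyclic
complexes: one differential is transported along the isomorphism. In particular `X ⊕ swap X` has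
one, so modulo `K₁ N` each element of `K₀Ω[F]` is the class of a single object.

It remains to extract information about objects from the vanishing of a class. Isomorphism classes
form a commutative monoid under direct sum, and a submonoid `S` in which every element has a
complement defines a group where exactly the elements stably in `S` vanish
(`exists_quotient_group`). If the relations of `K₀Ω` hold in this group, then an object of class
zero is stably in `S`. There are two choices of `S`. Objects with stably graded isomorphic sources
give exactness at `K₀Ω[F]` and at `K₀Ω[M ⟶ 0]` (`stablyGradedIso_of_cls_eq_zero`). Objects with a
resolution whose class comes from `K₁ M` give exactness at `K₁ N`; here one needs that the class of
a resolution is unique modulo `K₁ M` (`Res.cls_sub_cls_mem`), and that short exact sequences can be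
made degreewise split on sources by mapping cylinders (`map_isoCls_exact`).

The homological algebra is done with generalized elements, up to covers by admissible epimorphisms.
Support of long exact sequences enters through `IsDefl.of_comp`, which turns local exactness of a
bounded complex into acyclicity. -/

namespace RelK

open scoped ZeroObject

/-! ### Short exact sequences and deflations -/

section

variable {C : Type u} [Category.{v} C] [Preadditive C] [HasZeroObject C] [HasBinaryBiproducts C]
  [ExactCategory C]

namespace IsSES

variable {X Y Z : C} {f : X ⟶ Y} {g : Y ⟶ Z}

lemma lift (h : IsSES f g) {T : C} (x : T ⟶ Y) (hx : x ≫ g = 0) : ∃ y, y ≫ f = x := by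
  obtain ⟨w, h⟩ := h
  obtain ⟨l⟩ := ExactCategory.isKernel _ h
  obtain ⟨y, hy⟩ := KernelFork.IsLimit.lift' l x hx
  exact ⟨y, hy⟩

lemma desc (h : IsSES f g) {T : C} (x : Y ⟶ T) (hx : f ≫ x = 0) : ∃ y, g ≫ y = x := by
  obtain ⟨w, h⟩ := h
  obtain ⟨l⟩ := ExactCategory.isCokernel _ h
  obtain ⟨y, hy⟩ := CokernelCofork.IsColimit.desc' l x hx
  exact ⟨y, hy⟩

lemma mono (h : IsSES f g) : Mono f := by
  obtain ⟨w, h⟩ := h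
  obtain ⟨l⟩ := ExactCategory.isKernel _ h
  exact mono_of_isLimit_fork l

lemma epi (h : IsSES f g) : Epi g := by
  obtain ⟨w, h⟩ := h
  obtain ⟨l⟩ := ExactCategory.isCokernel _ h
  exact epi_of_isColimit_cofork l

lemma zero (h : IsSES f g) : f ≫ g = 0 := h.1

end IsSES

/-- `p` is an admissible epimorphism. -/
def IsDefl {Y Z : C} (p : Y ⟶ Z) : Prop := ∃ (X : C) (i : X ⟶ Y), IsSES i p

lemma isDefl_iff {Y Z : C} (p : Y ⟶ Z) :
    IsDefl p ↔ IsDeflation ExactCategory.shortExact p :=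
  ⟨fun ⟨X, i, w, h⟩ => ⟨X, i, w, h⟩, fun ⟨X, i, w, h⟩ => ⟨X, i, w, h⟩⟩

lemma IsSES.isDefl {X Y Z : C} {f : X ⟶ Y} {g : Y ⟶ Z} (h : IsSES f g) : IsDefl g := ⟨X, f, h⟩

lemma isSES_id_zero (X : C) {Z : C} (hZ : IsZero Z) : IsSES (𝟙 X) (0 : X ⟶ Z) :=
  ⟨comp_zero, ExactCategory.id_zero X Z hZ⟩

lemma isSES_zero_id (X : C) {Z : C} (hZ : IsZero Z) : IsSES (0 : Z ⟶ X) (𝟙 X) :=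
  ⟨zero_comp, ExactCategory.zero_id X Z hZ⟩

lemma isSES_of_isIso_left {X Y Z : C} (f : X ⟶ Y) [IsIso f] (g : Y ⟶ Z) (hZ : IsZero Z) :
    IsSES f g :=
  (isSES_id_zero X hZ).of_iso (Iso.refl _) (asIso f) (Iso.refl _) (by simp)
    (hZ.eq_of_tgt _ _)

lemma isSES_of_isIso_right {X Y Z : C} (f : X ⟶ Y) (g : Y ⟶ Z) [IsIso g] (hX : IsZero X) :
    IsSES f g :=
  (isSES_zero_id Z hX).of_iso (Iso.refl _) (asIso g).symm (Iso.refl _)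
    (hX.eq_of_src _ _) (by simp)

lemma isDefl_of_isIso {X Y : C} (f : X ⟶ Y) [IsIso f] : IsDefl f :=
  (isSES_of_isIso_right (0 : (0 : C) ⟶ X) f (isZero_zero C)).isDefl

lemma IsDefl.comp {X Y Z : C} {p : X ⟶ Y} {q : Y ⟶ Z} (hp : IsDefl p) (hq : IsDefl q) :
    IsDefl (p ≫ q) := by
  rw [isDefl_iff] at *
  exact ExactCategory.deflation_comp p q hp hq

/-- Kernels are unique up to isomorphism, so any kernel may replace the one that comes with the
admissible epimorphism. -/
lemma IsDefl.isSES {X Y Z : C} {p : Y ⟶ Z} (hp : IsDefl p) (i : X ⟶ Y) [Mono i]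
    (w : i ≫ p = 0) (hi : ∀ {T : C} (x : T ⟶ Y), x ≫ p = 0 → ∃ y, y ≫ i = x) : IsSES i p := by
  obtain ⟨X', i', h⟩ := hp
  have := h.mono
  obtain ⟨a, ha⟩ := hi i' h.zero
  obtain ⟨b, hb⟩ := h.lift i w
  refine h.of_iso ⟨a, b, ?_, ?_⟩ (Iso.refl _) (Iso.refl _) (by simpa using ha) (by simp)
  · rw [← cancel_mono i', Category.assoc, hb, ha, Category.id_comp]
  · rw [← cancel_mono i, Category.assoc, ha, hb, Category.id_comp]

lemma IsDefl.exists_isPullback {Y Z A : C} {p : Y ⟶ Z} (hp : IsDefl p) (f : A ⟶ Z) :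
    ∃ (B : C) (g : B ⟶ Y) (q : B ⟶ A), IsPullback g q p f ∧ IsDefl q := by
  obtain ⟨B, g, q, h, hq⟩ := ExactCategory.deflation_pullback p f ((isDefl_iff p).1 hp)
  exact ⟨B, g, q, h, (isDefl_iff q).2 hq⟩

lemma IsDefl.of_iso_comp {X Y Z : C} (e : X ≅ Y) {p : Y ⟶ Z} (hp : IsDefl p) :
    IsDefl (e.hom ≫ p) := by
  have := isDefl_of_isIso e.hom
  exact this.comp hp

lemma IsDefl.of_isPullback {P X Y Z : C} {g : P ⟶ X} {q : P ⟶ Y} {p : X ⟶ Z} {f : Y ⟶ Z}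
    (h : IsPullback g q p f) (hp : IsDefl p) : IsDefl q := by
  obtain ⟨B, g', q', h', hq'⟩ := hp.exists_isPullback f
  have := hq'.of_iso_comp (h.isoIsPullback _ _ h')
  simpa using this

/-- This is the base change of `g` along the first projection `Z ⊞ W ⟶ Z`. -/
lemma isDefl_map_id {Y Z : C} {g : Y ⟶ Z} (hg : IsDefl g) (W : C) :
    IsDefl (biprod.map g (𝟙 W)) := by
  refine IsDefl.of_isPullback (g := biprod.fst) (p := g) (f := biprod.fst) ?_ hg
  refine ⟨⟨by simp⟩, ⟨PullbackCone.IsLimit.mk _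
    (fun s => biprod.lift s.fst (s.snd ≫ biprod.snd)) (fun s => by simp) (fun s => ?_)
    (fun s m h₁ h₂ => ?_)⟩⟩
  · apply biprod.hom_ext
    · simpa using s.condition
    · simp
  · apply biprod.hom_ext
    · simpa using h₁
    · simpa using congrArg (· ≫ biprod.snd) h₂

lemma isDefl_id_map {Y Z : C} {g : Y ⟶ Z} (hg : IsDefl g) (W : C) :
    IsDefl (biprod.map (𝟙 W) g) := by
  have := ((isDefl_map_id hg W).of_iso_comp (biprod.braiding W Y)).comp
    (isDefl_of_isIso (biprod.braiding Z W).hom)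
  convert this using 1
  ext <;> simp

/-- The map `g ⊞ g'` is `g ⊞ 1` followed by `1 ⊞ g'`, and its kernel is computed componentwise. -/
lemma IsSES.biprod_map {X Y Z X' Y' Z' : C} {f : X ⟶ Y} {g : Y ⟶ Z} {f' : X' ⟶ Y'}
    {g' : Y' ⟶ Z'} (h : IsSES f g) (h' : IsSES f' g') :
    IsSES (biprod.map f f') (biprod.map g g') := by
  have hd : IsDefl (biprod.map g g') := by
    have := (isDefl_map_id h.isDefl Y').comp (isDefl_id_map h'.isDefl Z)
    convert this using 1
    ext <;> simp
  have := h.mono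
  have := h'.mono
  have : Mono (biprod.map f f') := by
    constructor
    intro T a b hab
    apply biprod.hom_ext
    · rw [← cancel_mono f]
      simpa using congrArg (· ≫ biprod.fst) hab
    · rw [← cancel_mono f']
      simpa using congrArg (· ≫ biprod.snd) hab
  refine hd.isSES _ (by ext <;> simp [h.zero, h'.zero]) fun x hx => ?_
  obtain ⟨a, ha⟩ := h.lift (x ≫ biprod.fst) (by simpa using congrArg (· ≫ biprod.fst) hx)
  obtain ⟨b, hb⟩ := h'.lift (x ≫ biprod.snd) (by simpa using congrArg (· ≫ biprod.snd) hx)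
  exact ⟨biprod.lift a b, by apply biprod.hom_ext <;> simp [ha, hb]⟩

lemma isSES_inl_snd (X Y : C) : IsSES (biprod.inl : X ⟶ X ⊞ Y) biprod.snd := by
  have h := (isSES_of_isIso_left (𝟙 X) (0 : X ⟶ 0) (isZero_zero C)).biprod_map
    (isSES_of_isIso_right (0 : 0 ⟶ Y) (𝟙 Y) (isZero_zero C))
  refine h.of_iso ⟨biprod.fst, biprod.inl, ?_, by simp⟩ (Iso.refl _)
    ⟨biprod.snd, biprod.inr, ?_, by simp⟩ ?_ ?_
  · ext; simp
  · ext; simp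
  · ext <;> simp
  · ext <;> simp

lemma isSES_inr_fst (X Y : C) : IsSES (biprod.inr : Y ⟶ X ⊞ Y) biprod.fst :=
  (isSES_inl_snd Y X).of_iso (Iso.refl _) (biprod.braiding _ _) (Iso.refl _)
    (by simp only [Iso.refl_hom, Category.id_comp]; apply biprod.hom_ext <;> simp) (by simp)

/-- In an exact category that supports long exact sequences, the last factor of an admissible
epimorphism is an admissible epimorphism. -/
lemma IsDefl.of_comp (hC : SupportsLongExactSequences C) {X Y Z : C} (f : X ⟶ Y) (g : Y ⟶ Z)
    (h : IsDefl (f ≫ g)) : IsDefl g := by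
  -- `Y ⊞ X ⟶ Y ⟶ Z` is a deflation
  have h₁ : IsDefl ((biprod.fst : Y ⊞ X ⟶ Y) ≫ g) := by
    have e₁ : IsIso (biprod.lift (biprod.fst - biprod.snd ≫ f) biprod.snd : Y ⊞ X ⟶ Y ⊞ X) :=
      ⟨biprod.lift (biprod.fst + biprod.snd ≫ f) biprod.snd, by
        constructor <;> apply biprod.hom_ext <;> simp⟩
    have e₂ : IsIso (biprod.lift biprod.fst (biprod.fst ≫ g + biprod.snd) : Y ⊞ Z ⟶ Y ⊞ Z) :=
      ⟨biprod.lift biprod.fst (biprod.snd - biprod.fst ≫ g), by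
        constructor <;> apply biprod.hom_ext <;> simp⟩
    -- On elements: `(y, x) ↦ (y - fx, x) ↦ (y - fx, gfx) ↦ (y - fx, gy) ↦ gy`. The second map uses
    -- the hypothesis, the first and third are isomorphisms, the last is a projection.
    have := (isDefl_of_isIso _).comp (p := (biprod.lift (biprod.fst - biprod.snd ≫ f)
      biprod.snd : Y ⊞ X ⟶ Y ⊞ X)) ((isDefl_id_map h Y).comp ((isDefl_of_isIso
      (biprod.lift biprod.fst (biprod.fst ≫ g + biprod.snd) : Y ⊞ Z ⟶ Y ⊞ Z)).comp
      (isSES_inl_snd Y Z).isDefl))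
    convert this using 1
    simp
  obtain ⟨K₀, i, hi⟩ := h₁
  have := hi.mono
  -- The kernel `K₀` contains the summand `X`, so its projection to `X` is split. Support of long
  -- exact sequences gives the kernel `K` of this projection, which is also the candidate for the
  -- kernel of `g`.
  obtain ⟨s, hs⟩ := hi.lift (biprod.inr : X ⟶ Y ⊞ X) (by simp)
  obtain ⟨K, k, hk⟩ := hC (i ≫ biprod.snd) ⟨⟨⟨s, by rw [← Category.assoc, hs]; simp⟩⟩⟩
  have := hk.mono
  obtain ⟨r', hr'⟩ := hi.lift (i ≫ biprod.fst ≫ biprod.inl) (by simpa using hi.zero)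
  obtain ⟨r, hr⟩ := hk.lift r' (by rw [← Category.assoc, hr']; simp)
  have hki : k ≫ i ≫ biprod.snd = 0 := hk.zero
  have hri : r ≫ k ≫ i = i ≫ biprod.fst ≫ biprod.inl := by
    rw [← Category.assoc, hr, hr']
  have hkr : k ≫ r = 𝟙 K := by
    rw [← cancel_mono k, ← cancel_mono i]
    simp only [Category.assoc, hri, Category.id_comp]
    apply biprod.hom_ext <;> simp [hki]
  have sq : i ≫ biprod.fst = r ≫ (k ≫ i ≫ biprod.fst) := by
    have := congrArg (· ≫ biprod.fst) hri
    simpa using this.symm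
  have w : (k ≫ i ≫ biprod.fst) ≫ g = 0 := by
    simpa using congrArg (k ≫ ·) hi.zero
  -- The inclusion of `K` in `Y` is the pushout of the inflation `i` along the retraction `r`, hence
  -- an inflation. Its cokernel is compared with `g` at the end.
  have po : IsPushout i r (biprod.fst : Y ⊞ X ⟶ Y) (k ≫ i ≫ biprod.fst) := by
    refine ⟨⟨sq⟩, ⟨PushoutCocone.IsColimit.mk _ (fun c => biprod.inl ≫ c.inl) (fun c => ?_)
      (fun c => ?_) (fun c m h₁ h₂ => ?_)⟩⟩
    · have h₀ : r ≫ c.inr = i ≫ c.inl := c.condition.symm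
      apply biprod.hom_ext'
      · simp
      · have hsr : s ≫ r = 0 := by
          rw [← cancel_mono k, ← cancel_mono i]
          simp only [Category.assoc, hri, zero_comp]
          rw [← Category.assoc s i, hs]; simp
        have := congrArg (s ≫ ·) h₀
        simp only [← Category.assoc, hs, hsr, zero_comp] at this
        simpa using this
    · have h₀ : i ≫ c.inl = r ≫ c.inr := c.condition
      have h₁ : k ≫ i ≫ biprod.fst ≫ biprod.inl = k ≫ i := by
        apply biprod.hom_ext <;> simp [hki]
      calc (k ≫ i ≫ biprod.fst) ≫ biprod.inl ≫ c.inl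
          = (k ≫ i ≫ biprod.fst ≫ biprod.inl) ≫ c.inl := by simp
        _ = c.inr := by rw [h₁, Category.assoc, h₀, ← Category.assoc, hkr, Category.id_comp]
    · have : (biprod.inl : Y ⟶ Y ⊞ X) ≫ biprod.fst ≫ m = biprod.inl ≫ c.inl := by rw [h₁]
      simpa using this
  obtain ⟨B, g', j, po', Z', c, wc, hc⟩ := ExactCategory.inflation_pushout i r
    ⟨Z, biprod.fst ≫ g, hi.1, hi.2⟩
  let e := po.isoIsPushout _ _ po'
  have hj : IsSES (k ≫ i ≫ biprod.fst) (e.hom ≫ c) :=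
    IsSES.of_iso ⟨wc, hc⟩ (Iso.refl _) e.symm (Iso.refl _) (by
      simp only [Iso.refl_hom, Category.id_comp]
      rw [Iso.symm_hom, Iso.eq_comp_inv]
      exact po.inr_isoIsPushout_hom _ _ po') (by simp)
  have hepi := hi.epi
  have : Epi g := epi_of_epi (biprod.fst : Y ⊞ X ⟶ Y) g
  have := hj.epi
  obtain ⟨a, ha⟩ := hj.desc g w
  have hz : i ≫ biprod.fst ≫ e.hom ≫ c = 0 := by
    rw [← Category.assoc, sq, Category.assoc, hj.zero, comp_zero]
  obtain ⟨b, hb⟩ := hi.desc _ hz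
  have hb' : g ≫ b = e.hom ≫ c := by
    rw [← cancel_epi (biprod.fst : Y ⊞ X ⟶ Y), ← Category.assoc, hb]
  refine ⟨_, _, hj.of_iso (f' := k ≫ i ≫ biprod.fst) (g' := g) (Iso.refl _) (Iso.refl _)
    ⟨a, b, ?_, ?_⟩ (by simp) (by simpa using ha.symm)⟩
  · rw [← cancel_epi (e.hom ≫ c), ← Category.assoc, ha, hb', Category.comp_id]
  · rw [← cancel_epi g, ← Category.assoc, hb', ha, Category.comp_id]

end

/-! ### Constructions with chain complexes -/

section

variable {C : Type u} [Category.{v} C] [Preadditive C]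

/-- The differential of degree `-1` with the given components. -/
def dOf (X : ℤ → C) (δ : ∀ i, X i ⟶ X (i - 1)) (i j : ℤ) : X i ⟶ X j :=
  if h : i - 1 = j then δ i ≫ eqToHom (by rw [h]) else 0

@[simp]
lemma dOf_self (X : ℤ → C) (δ : ∀ i, X i ⟶ X (i - 1)) (i : ℤ) : dOf X δ i (i - 1) = δ i := by
  simp [dOf]

/-- The chain complex with the given components of the differential. -/
@[simps]
def cx (X : ℤ → C) (δ : ∀ i, X i ⟶ X (i - 1)) (h : ∀ i, δ i ≫ δ (i - 1) = 0) :
    ChainComplex C ℤ where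
  X := X
  d := dOf X δ
  shape i j hij := dif_neg fun h => hij (by simp [← h])
  d_comp_d' i j k hij hjk := by
    obtain rfl : i - 1 = j := by have : j + 1 = i := hij; omega
    obtain rfl : i - 1 - 1 = k := by have : k + 1 = i - 1 := hjk; omega
    simp [h]

lemma d_comp_eq_zero (K : ChainComplex C ℤ) (i : ℤ) : K.d i (i - 1) ≫ K.d (i - 1) (i - 1 - 1) = 0 :=
  K.d_comp_d _ _ _

/-- A chain map, from its components. -/
@[simps]
def homMk {K L : ChainComplex C ℤ} (f : ∀ i, K.X i ⟶ L.X i)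
    (h : ∀ i, f i ≫ L.d i (i - 1) = K.d i (i - 1) ≫ f (i - 1)) : K ⟶ L where
  f := f
  comm' i j hij := by
    obtain rfl : i - 1 = j := by have : j + 1 = i := hij; omega
    exact h i

/-- The shift of a chain complex. -/
@[simps]
def shift (K : ChainComplex C ℤ) : ChainComplex C ℤ where
  X i := K.X (i - 1)
  d i j := -K.d (i - 1) (j - 1)
  shape i j hij := by
    rw [K.shape, neg_zero]
    intro h
    have : j - 1 + 1 = i - 1 := h
    exact hij (show j + 1 = i by omega)
  d_comp_d' i j k _ _ := by simp

variable [HasBinaryBiproducts C]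

/-- The extension of `L` by `K`, split as graded objects, with the given component of the
differential. -/
noncomputable def twist (K L : ChainComplex C ℤ) (h : ∀ n, L.X n ⟶ K.X (n - 1))
    (w : ∀ n, h n ≫ K.d (n - 1) (n - 1 - 1) + L.d n (n - 1) ≫ h (n - 1) = 0) :
    ChainComplex C ℤ :=
  cx (fun n => K.X n ⊞ L.X n)
    (fun n => biprod.lift (biprod.fst ≫ K.d n (n - 1) + biprod.snd ≫ h n)
      (biprod.snd ≫ L.d n (n - 1)))
    (fun n => by
      have := congrArg (biprod.snd (X := K.X n) ≫ ·) (w n)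
      apply biprod.hom_ext
      · simpa using this
      · simp)

section

variable {K L : ChainComplex C ℤ} {h : ∀ n, L.X n ⟶ K.X (n - 1)}
  {w : ∀ n, h n ≫ K.d (n - 1) (n - 1 - 1) + L.d n (n - 1) ≫ h (n - 1) = 0}

variable (w) in
/-- The first projection, a map of graded objects. -/
noncomputable def twistFst (n : ℤ) : (twist K L h w).X n ⟶ K.X n :=
  (biprod.fst : (K.X n ⊞ L.X n : C) ⟶ _)

variable (w) in
/-- The second projection. -/
noncomputable def twistSnd (n : ℤ) : (twist K L h w).X n ⟶ L.X n :=
  (biprod.snd : (K.X n ⊞ L.X n : C) ⟶ _)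

variable (w) in
/-- The map with the given components. -/
noncomputable def twistLift {n : ℤ} {T : C} (a : T ⟶ K.X n) (b : T ⟶ L.X n) :
    T ⟶ (twist K L h w).X n :=
  (biprod.lift a b : T ⟶ (K.X n ⊞ L.X n : C))

variable {n : ℤ} {T : C}

@[simp]
lemma twistLift_fst (a : T ⟶ K.X n) (b : T ⟶ L.X n) :
    twistLift w a b ≫ twistFst w n = a := biprod.lift_fst _ _

@[simp]
lemma twistLift_fst_assoc (a : T ⟶ K.X n) (b : T ⟶ L.X n) {Z : C} (g : K.X n ⟶ Z) :
    twistLift w a b ≫ twistFst w n ≫ g = a ≫ g := by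
  rw [← Category.assoc, twistLift_fst]

@[simp]
lemma twistLift_snd (a : T ⟶ K.X n) (b : T ⟶ L.X n) :
    twistLift w a b ≫ twistSnd w n = b := biprod.lift_snd _ _

@[simp]
lemma twistLift_snd_assoc (a : T ⟶ K.X n) (b : T ⟶ L.X n) {Z : C} (g : L.X n ⟶ Z) :
    twistLift w a b ≫ twistSnd w n ≫ g = b ≫ g := by
  rw [← Category.assoc, twistLift_snd]

lemma twist_hom_ext {x y : T ⟶ (twist K L h w).X n} (h₁ : x ≫ twistFst w n = y ≫ twistFst w n)
    (h₂ : x ≫ twistSnd w n = y ≫ twistSnd w n) : x = y :=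
  biprod.hom_ext (X := K.X n) (Y := L.X n) _ _ h₁ h₂

lemma twist_d (n : ℤ) : (twist K L h w).d n (n - 1) =
    (biprod.lift (biprod.fst ≫ K.d n (n - 1) + biprod.snd ≫ h n) (biprod.snd ≫ L.d n (n - 1)) :
      (K.X n ⊞ L.X n : C) ⟶ (K.X (n - 1) ⊞ L.X (n - 1) : C)) :=
  dOf_self (fun n => K.X n ⊞ L.X n) (fun n => biprod.lift
    (biprod.fst ≫ K.d n (n - 1) + biprod.snd ≫ h n) (biprod.snd ≫ L.d n (n - 1))) n

@[simp]
lemma twist_d_fst (n : ℤ) : (twist K L h w).d n (n - 1) ≫ twistFst w (n - 1) =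
    twistFst w n ≫ K.d n (n - 1) + twistSnd w n ≫ h n := by
  rw [twist_d]
  exact biprod.lift_fst _ _

@[simp]
lemma twist_d_fst_assoc (n : ℤ) {Z : C} (g : K.X (n - 1) ⟶ Z) :
    (twist K L h w).d n (n - 1) ≫ twistFst w (n - 1) ≫ g =
      (twistFst w n ≫ K.d n (n - 1) + twistSnd w n ≫ h n) ≫ g := by
  rw [← Category.assoc, twist_d_fst]

@[simp]
lemma twist_d_snd (n : ℤ) : (twist K L h w).d n (n - 1) ≫ twistSnd w (n - 1) =
    twistSnd w n ≫ L.d n (n - 1) := by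
  rw [twist_d]
  exact biprod.lift_snd _ _

@[simp]
lemma twist_d_snd_assoc (n : ℤ) {Z : C} (g : L.X (n - 1) ⟶ Z) :
    (twist K L h w).d n (n - 1) ≫ twistSnd w (n - 1) ≫ g =
    twistSnd w n ≫ L.d n (n - 1) ≫ g := by
  rw [← Category.assoc, twist_d_snd, Category.assoc]

variable (w) in
/-- The inclusion of the subcomplex. -/
noncomputable def twistInl : K ⟶ twist K L h w :=
  homMk (fun _ => twistLift w (𝟙 _) 0) (fun n => by apply twist_hom_ext <;> simp)

variable (w) in
/-- The projection to the quotient complex. -/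
noncomputable def twistProj : twist K L h w ⟶ L :=
  homMk (fun n => twistSnd w n) (fun n => by simp)

@[simp]
lemma twistProj_f (n : ℤ) : (twistProj w).f n = twistSnd w n := rfl

@[simp]
lemma twistInl_f_fst (n : ℤ) : (twistInl w).f n ≫ twistFst w n = 𝟙 _ := by simp [twistInl]

@[simp]
lemma twistInl_f_fst_assoc (n : ℤ) {Z : C} (g : K.X n ⟶ Z) :
    (twistInl w).f n ≫ twistFst w n ≫ g = g := by simp [twistInl]

@[simp]
lemma twistInl_f_snd (n : ℤ) : (twistInl w).f n ≫ twistSnd w n = 0 := by simp [twistInl]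

@[simp]
lemma twistInl_f_snd_assoc (n : ℤ) {Z : C} (g : L.X n ⟶ Z) :
    (twistInl w).f n ≫ twistSnd w n ≫ g = 0 := by simp [twistInl]

lemma twistInl_f (n : ℤ) : (twistInl w).f n = (biprod.inl : K.X n ⟶ (K.X n ⊞ L.X n : C)) :=
  twist_hom_ext ((twistInl_f_fst n).trans biprod.inl_fst.symm)
    ((twistInl_f_snd n).trans biprod.inl_snd.symm)

end

/-- The direct sum of chain complexes. -/
noncomputable abbrev csum (K L : ChainComplex C ℤ) : ChainComplex C ℤ :=
  twist K L (fun _ => 0) (by simp)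

section

variable (K L : ChainComplex C ℤ)

/-- The first projection of the direct sum. -/
noncomputable def csumFst : csum K L ⟶ K :=
  homMk (fun n => twistFst _ n) (fun n => by simp)

/-- The first inclusion in the direct sum. -/
noncomputable abbrev csumInl : K ⟶ csum K L := twistInl _

/-- The second projection of the direct sum. -/
noncomputable abbrev csumSnd : csum K L ⟶ L := twistProj _

@[simp]
lemma csumFst_f (n : ℤ) : (csumFst K L).f n = twistFst _ n := rfl

variable {K L} in
/-- The map to a direct sum with the given components. -/
noncomputable def csumLift {P : ChainComplex C ℤ} (f : P ⟶ K) (g : P ⟶ L) : P ⟶ csum K L :=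
  homMk (fun n => twistLift _ (f.f n) (g.f n)) (fun n => by apply twist_hom_ext <;> simp)

variable {K L} in
@[simp]
lemma csumLift_f {P : ChainComplex C ℤ} (f : P ⟶ K) (g : P ⟶ L) (n : ℤ) :
    (csumLift f g).f n = twistLift _ (f.f n) (g.f n) := rfl

end

/-- The differential of the mapping cone. -/
noncomputable def coneD {K L : ChainComplex C ℤ} (f : K ⟶ L) (i : ℤ) :
    (K.X (i - 1) ⊞ L.X i : C) ⟶ (K.X (i - 1 - 1) ⊞ L.X (i - 1) : C) :=
  biprod.lift (-(biprod.fst ≫ K.d (i - 1) (i - 1 - 1)))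
    (biprod.fst ≫ f.f (i - 1) + biprod.snd ≫ L.d i (i - 1))

/-- The mapping cone of a chain map. -/
noncomputable def cone {K L : ChainComplex C ℤ} (f : K ⟶ L) : ChainComplex C ℤ :=
  cx (fun i => K.X (i - 1) ⊞ L.X i) (coneD f)
    (fun i => by dsimp only [coneD]; apply biprod.hom_ext <;> simp)

lemma cone_X {K L : ChainComplex C ℤ} (f : K ⟶ L) (i : ℤ) :
    (cone f).X i = (K.X (i - 1) ⊞ L.X i : C) := rfl

lemma cone_d {K L : ChainComplex C ℤ} (f : K ⟶ L) (i : ℤ) :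
    (cone f).d i (i - 1) = (biprod.lift (-(biprod.fst ≫ K.d (i - 1) (i - 1 - 1)))
      (biprod.fst ≫ f.f (i - 1) + biprod.snd ≫ L.d i (i - 1)) :
      (K.X (i - 1) ⊞ L.X i : C) ⟶ (K.X (i - 1 - 1) ⊞ L.X (i - 1) : C)) :=
  dOf_self (fun i => K.X (i - 1) ⊞ L.X i) (coneD f) i

/-- The first projection of the mapping cone. -/
noncomputable def coneFst {K L : ChainComplex C ℤ} (f : K ⟶ L) (n : ℤ) :
    (cone f).X n ⟶ K.X (n - 1) := (biprod.fst : (K.X (n - 1) ⊞ L.X n : C) ⟶ _)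

/-- The second projection of the mapping cone. -/
noncomputable def coneSnd {K L : ChainComplex C ℤ} (f : K ⟶ L) (n : ℤ) :
    (cone f).X n ⟶ L.X n := (biprod.snd : (K.X (n - 1) ⊞ L.X n : C) ⟶ _)

/-- The map to the mapping cone with the given components. -/
noncomputable def coneLift {K L : ChainComplex C ℤ} (f : K ⟶ L) {n : ℤ} {T : C}
    (a : T ⟶ K.X (n - 1)) (b : T ⟶ L.X n) : T ⟶ (cone f).X n :=
  (biprod.lift a b : _ ⟶ (K.X (n - 1) ⊞ L.X n : C))

section

variable {K L : ChainComplex C ℤ} (f : K ⟶ L) {n : ℤ} {T : C}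

@[simp]
lemma coneLift_fst (a : T ⟶ K.X (n - 1)) (b : T ⟶ L.X n) :
    coneLift f a b ≫ coneFst f n = a := biprod.lift_fst _ _

@[simp]
lemma coneLift_fst_assoc (a : T ⟶ K.X (n - 1)) (b : T ⟶ L.X n) {Z : C} (h : K.X (n - 1) ⟶ Z) :
    coneLift f a b ≫ coneFst f n ≫ h = a ≫ h := by
  rw [← Category.assoc, coneLift_fst]

@[simp]
lemma coneLift_snd (a : T ⟶ K.X (n - 1)) (b : T ⟶ L.X n) :
    coneLift f a b ≫ coneSnd f n = b := biprod.lift_snd _ _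

@[simp]
lemma coneLift_snd_assoc (a : T ⟶ K.X (n - 1)) (b : T ⟶ L.X n) {Z : C} (h : L.X n ⟶ Z) :
    coneLift f a b ≫ coneSnd f n ≫ h = b ≫ h := by
  rw [← Category.assoc, coneLift_snd]

variable {f} in
lemma cone_hom_ext {x y : T ⟶ (cone f).X n} (h₁ : x ≫ coneFst f n = y ≫ coneFst f n)
    (h₂ : x ≫ coneSnd f n = y ≫ coneSnd f n) : x = y :=
  biprod.hom_ext (Y := L.X n) (X := K.X (n - 1)) _ _ h₁ h₂

@[simp]
lemma cone_d_fst (n : ℤ) : (cone f).d n (n - 1) ≫ coneFst f (n - 1) =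
    -(coneFst f n ≫ K.d (n - 1) (n - 1 - 1)) := by
  rw [cone_d]
  exact biprod.lift_fst _ _

@[simp]
lemma cone_d_snd (n : ℤ) : (cone f).d n (n - 1) ≫ coneSnd f (n - 1) =
    coneFst f n ≫ f.f (n - 1) + coneSnd f n ≫ L.d n (n - 1) := by
  rw [cone_d]
  exact biprod.lift_snd _ _

@[simp]
lemma cone_d_snd_assoc (n : ℤ) {Z : C} (h : L.X (n - 1) ⟶ Z) :
    (cone f).d n (n - 1) ≫ coneSnd f (n - 1) ≫ h =
      (coneFst f n ≫ f.f (n - 1) + coneSnd f n ≫ L.d n (n - 1)) ≫ h := by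
  rw [← Category.assoc, cone_d_snd]

end

/-- The inclusion of the target in the mapping cone. -/
noncomputable def coneInr {K L : ChainComplex C ℤ} (f : K ⟶ L) : L ⟶ cone f :=
  homMk (fun n => (biprod.inr : L.X n ⟶ (K.X (n - 1) ⊞ L.X n : C))) (fun n => by
    rw [cone_d]
    dsimp only [cone_X]
    apply biprod.hom_ext <;> simp)

@[simp]
lemma coneInr_fst {K L : ChainComplex C ℤ} (f : K ⟶ L) (n : ℤ) :
    (coneInr f).f n ≫ coneFst f n = 0 := biprod.inr_fst

@[simp]
lemma coneInr_snd {K L : ChainComplex C ℤ} (f : K ⟶ L) (n : ℤ) :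
    (coneInr f).f n ≫ coneSnd f n = 𝟙 _ := biprod.inr_snd

@[simp]
lemma coneInr_snd_assoc {K L : ChainComplex C ℤ} (f : K ⟶ L) (n : ℤ) {Z : C}
    (g : L.X n ⟶ Z) : (coneInr f).f n ≫ coneSnd f n ≫ g = g := by
  rw [← Category.assoc, coneInr_snd, Category.id_comp]

/-- The projection of the mapping cone to the shift of the source. -/
noncomputable def coneProj {K L : ChainComplex C ℤ} (f : K ⟶ L) : cone f ⟶ shift K :=
  homMk (fun n => coneFst f n) (fun n => by simp [shift])

@[simp]
lemma coneProj_f {K L : ChainComplex C ℤ} (f : K ⟶ L) (n : ℤ) :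
    (coneProj f).f n = coneFst f n := rfl

/-- The map of mapping cones induced by a commutative square of chain maps. -/
noncomputable def coneMap {K L K' L' : ChainComplex C ℤ} {f : K ⟶ L} {f' : K' ⟶ L'} (a : K ⟶ K')
    (b : L ⟶ L') (w : a ≫ f' = f ≫ b) : cone f ⟶ cone f' :=
  homMk (fun i => (biprod.map (a.f (i - 1)) (b.f i) :
      (K.X (i - 1) ⊞ L.X i : C) ⟶ (K'.X (i - 1) ⊞ L'.X i : C))) (fun i => by
    have h := HomologicalComplex.congr_hom w (i - 1)
    simp only [HomologicalComplex.comp_f] at h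
    rw [cone_d, cone_d]
    dsimp only [cone_X]
    apply biprod.hom_ext <;> apply biprod.hom_ext' <;> simp [h])

lemma coneMap_f {K L K' L' : ChainComplex C ℤ} {f : K ⟶ L} {f' : K' ⟶ L'} (a : K ⟶ K')
    (b : L ⟶ L') (w : a ≫ f' = f ≫ b) (i : ℤ) :
    (coneMap a b w).f i = (biprod.map (a.f (i - 1)) (b.f i) :
      (K.X (i - 1) ⊞ L.X i : C) ⟶ (K'.X (i - 1) ⊞ L'.X i : C)) := rfl

@[simp]
lemma coneMap_fst {K L K' L' : ChainComplex C ℤ} {f : K ⟶ L} {f' : K' ⟶ L'} (a : K ⟶ K')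
    (b : L ⟶ L') (w : a ≫ f' = f ≫ b) (i : ℤ) :
    (coneMap a b w).f i ≫ coneFst f' i = coneFst f i ≫ a.f (i - 1) := biprod.map_fst _ _

@[simp]
lemma coneMap_snd {K L K' L' : ChainComplex C ℤ} {f : K ⟶ L} {f' : K' ⟶ L'} (a : K ⟶ K')
    (b : L ⟶ L') (w : a ≫ f' = f ≫ b) (i : ℤ) :
    (coneMap a b w).f i ≫ coneSnd f' i = coneSnd f i ≫ b.f i := biprod.map_snd _ _

/-- The homotopy cofiber is the mapping cone. -/
noncomputable def cofiberIso {K L : ChainComplex C ℤ} (f : K ⟶ L) :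
    HomologicalComplex.homotopyCofiber f ≅ cone f :=
  HomologicalComplex.Hom.isoOfComponents (fun i =>
    (HomologicalComplex.homotopyCofiber.XIsoBiprod f i (i - 1) (by simp) :
      (HomologicalComplex.homotopyCofiber f).X i ≅ (K.X (i - 1) ⊞ L.X i : C))) (fun i j hij => by
    obtain rfl : i - 1 = j := by have : j + 1 = i := hij; omega
    rw [cone_d]
    apply HomologicalComplex.homotopyCofiber.ext_from_X f (i - 1) i hij
    · dsimp only [cone_X, HomologicalComplex.homotopyCofiber_d]
      rw [HomologicalComplex.homotopyCofiber.inlX_d_assoc f i (i - 1) (i - 1 - 1) hij (by simp)]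
      rw [HomologicalComplex.homotopyCofiber.inlX_XIsoBiprod_hom_assoc]
      apply biprod.hom_ext <;> simp
    · dsimp only [cone_X, HomologicalComplex.homotopyCofiber_d]
      simp only [HomologicalComplex.homotopyCofiber.inrX_d_assoc,
        HomologicalComplex.homotopyCofiber.inrX_XIsoBiprod_hom_assoc,
        HomologicalComplex.homotopyCofiber.inrX_XIsoBiprod_hom]
      apply biprod.hom_ext <;> simp)

end

/-! ### Acyclic complexes and quasi-isomorphisms -/

section

variable {C : Type u} [Category.{v} C] [Preadditive C] [HasZeroObject C] [HasBinaryBiproducts C]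
  [ExactCategory C]

/-- Each cycle is a boundary, locally for admissible epimorphisms. -/
def LocExact (K : ChainComplex C ℤ) : Prop :=
  ∀ (n : ℤ) (T : C) (x : T ⟶ K.X (n - 1)), x ≫ K.d (n - 1) (n - 1 - 1) = 0 →
    ∃ (T' : C) (p : T' ⟶ T) (y : T' ⟶ K.X n), IsDefl p ∧ y ≫ K.d n (n - 1) = p ≫ x

lemma IsDefl.exists_lift {X Y Z : C} {g : Y ⟶ Z} (h : IsDefl g) (x : X ⟶ Z) :
    ∃ (T : C) (p : T ⟶ X) (y : T ⟶ Y), IsDefl p ∧ y ≫ g = p ≫ x := by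
  obtain ⟨B, a, q, h, hq⟩ := h.exists_isPullback x
  exact ⟨B, q, a, hq, h.w⟩

lemma IsAcyclic.locExact {K : ChainComplex C ℤ} (hK : IsAcyclic K) : LocExact K := by
  obtain ⟨Z, ι, π, h, hd⟩ := hK
  intro n T x hx
  have := (h (n - 1 - 1)).mono
  rw [hd, ← Category.assoc, ← zero_comp (f := ι (n - 1 - 1)), cancel_mono] at hx
  obtain ⟨x', rfl⟩ := (h (n - 1)).lift x hx
  obtain ⟨T', p, y, hp, hy⟩ := (h n).isDefl.exists_lift x'
  exact ⟨T', p, y, hp, by rw [hd, ← Category.assoc, hy, Category.assoc]⟩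

/-- Together with `IsAcyclic.locExact` this reduces acyclicity of bounded complexes to chases with
generalized elements. The cycle objects are built upwards, starting below the lower bound, where the
complex itself serves as its cycles. -/
lemma LocExact.isAcyclic (hC : SupportsLongExactSequences C) {K : ChainComplex C ℤ}
    (hb : IsBounded K.X) (hK : LocExact K) : IsAcyclic K := by
  let Q : ℤ → Prop := fun n => ∃ (Z : C) (i : Z ⟶ K.X n), Mono i ∧ i ≫ K.d n (n - 1) = 0 ∧
    ∀ (T : C) (x : T ⟶ K.X n), x ≫ K.d n (n - 1) = 0 → ∃ y, y ≫ i = x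
  have key : ∀ n (Z : C) (i : Z ⟶ K.X (n - 1)), Mono i → i ≫ K.d (n - 1) (n - 1 - 1) = 0 →
      (∀ (T : C) (x : T ⟶ K.X (n - 1)), x ≫ K.d (n - 1) (n - 1 - 1) = 0 → ∃ y, y ≫ i = x) →
      ∃ π : K.X n ⟶ Z, IsDefl π ∧ π ≫ i = K.d n (n - 1) := by
    intro n Z i hi w hl
    obtain ⟨π, hπ⟩ := hl _ (K.d n (n - 1)) (d_comp_eq_zero K n)
    -- Local exactness is applied to the universal cycle `i`. Then `y ≫ π` is the admissible
    -- epimorphism `p`, so `IsDefl.of_comp` applies to `π`.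
    obtain ⟨T, p, y, hp, hy⟩ := hK n Z i w
    refine ⟨π, IsDefl.of_comp hC y π ?_, hπ⟩
    convert hp
    rw [← cancel_mono i, Category.assoc, hπ, hy]
  have step : ∀ n, Q (n - 1) → Q n := by
    rintro n ⟨Z, i, hi, w, hl⟩
    obtain ⟨π, ⟨Z', i', h'⟩, hπ⟩ := key n Z i hi w hl
    refine ⟨Z', i', h'.mono, by rw [← hπ, ← Category.assoc, h'.zero, zero_comp],
      fun T x hx => h'.lift x ?_⟩
    rw [← cancel_mono i, Category.assoc, hπ, hx, zero_comp]
  have hQ : ∀ n, Q n := by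
    obtain ⟨a, b, h⟩ := hb
    have hlow : ∀ n, n < a → Q n := fun n hn =>
      ⟨K.X n, 𝟙 _, inferInstance, (h n (Or.inl hn)).eq_of_src _ _, fun T x _ => ⟨x, by simp⟩⟩
    intro n
    rcases lt_or_ge n a with hn | hn
    · exact hlow n hn
    · induction n, hn using Int.leInduction with
      | base => exact step a (hlow _ (by omega))
      | succ n _ ih => exact step (n + 1) (by simpa using ih)
  choose Z i hi w hl using hQ
  choose π hπ hπi using fun n => key n (Z (n - 1)) (i (n - 1)) (hi _) (w _) (hl _)
  refine ⟨Z, i, π, fun n => ?_, fun n => (hπi n).symm⟩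
  have := hi n
  have := hi (n - 1)
  refine (hπ n).isSES (i n) ?_ fun x hx => hl n _ x ?_
  · rw [← cancel_mono (i (n - 1)), Category.assoc, hπi, w, zero_comp]
  · rw [← hπi, ← Category.assoc, hx, zero_comp]

/-- The components of a complex vanish. -/
lemma isBounded_of_isZero {X : ℤ → C} (h : ∀ i, IsZero (X i)) : IsBounded X :=
  ⟨0, 0, fun i _ => h i⟩

lemma IsBounded.shift {X : ℤ → C} (h : IsBounded X) : IsBounded (fun i => X (i - 1)) := by
  obtain ⟨a, b, h⟩ := h
  exact ⟨a + 1, b + 1, fun i hi => h _ (by omega)⟩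

lemma isZero_biprod {X Y : C} (hX : IsZero X) (hY : IsZero Y) : IsZero (X ⊞ Y) :=
  (biprod_isZero_iff X Y).2 ⟨hX, hY⟩

lemma IsBounded.biprod {X Y : ℤ → C} (h : IsBounded X) (h' : IsBounded Y) :
    IsBounded (fun i => X i ⊞ Y i) := by
  obtain ⟨a, b, h⟩ := h
  obtain ⟨a', b', h'⟩ := h'
  exact ⟨min a a', max b b', fun i hi => isZero_biprod (h _ (by omega)) (h' _ (by omega))⟩

lemma IsBounded.cone {K L : ChainComplex C ℤ} (hK : IsBounded K.X) (hL : IsBounded L.X)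
    (f : K ⟶ L) : IsBounded (cone f).X :=
  hK.shift.biprod hL

lemma isQuasiIso_iff {K L : ChainComplex C ℤ} (f : K ⟶ L) : IsQuasiIso f ↔ IsAcyclic (cone f) :=
  ⟨fun h => h.of_iso (cofiberIso f), fun h => h.of_iso (cofiberIso f).symm⟩

/-- A chain map is a quasi-isomorphism, in terms of generalized elements. -/
def LocQuasiIso {K L : ChainComplex C ℤ} (f : K ⟶ L) : Prop :=
  ∀ (n : ℤ) (T : C) (a : T ⟶ K.X (n - 1 - 1)) (b : T ⟶ L.X (n - 1)),
    a ≫ K.d (n - 1 - 1) (n - 1 - 1 - 1) = 0 →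
    a ≫ f.f (n - 1 - 1) + b ≫ L.d (n - 1) (n - 1 - 1) = 0 →
    ∃ (T' : C) (p : T' ⟶ T) (a' : T' ⟶ K.X (n - 1)) (b' : T' ⟶ L.X n), IsDefl p ∧
      -(a' ≫ K.d (n - 1) (n - 1 - 1)) = p ≫ a ∧
      a' ≫ f.f (n - 1) + b' ≫ L.d n (n - 1) = p ≫ b

lemma locExact_cone_iff {K L : ChainComplex C ℤ} (f : K ⟶ L) :
    LocExact (cone f) ↔ LocQuasiIso f := by
  constructor
  · intro h n T a b ha hb
    obtain ⟨T', p, y, hp, hy⟩ := h n T (coneLift f a b) (by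
      apply cone_hom_ext <;> simp [ha, hb])
    exact ⟨T', p, y ≫ coneFst f n, y ≫ coneSnd f n, hp,
      by simpa using congrArg (· ≫ coneFst f (n - 1)) hy,
      by simpa using congrArg (· ≫ coneSnd f (n - 1)) hy⟩
  · intro h n T x hx
    obtain ⟨T', p, a', b', hp, h₁, h₂⟩ := h n T (x ≫ coneFst f _) (x ≫ coneSnd f _)
      (by simpa using congrArg (· ≫ coneFst f _) hx)
      (by simpa using congrArg (· ≫ coneSnd f _) hx)
    refine ⟨T', p, coneLift f a' b', hp, ?_⟩
    apply cone_hom_ext <;> simp [h₁, h₂]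

lemma IsQuasiIso.locQuasiIso {K L : ChainComplex C ℤ} {f : K ⟶ L} (h : IsQuasiIso f) :
    LocQuasiIso f :=
  (locExact_cone_iff f).1 ((isQuasiIso_iff f).1 h).locExact

lemma LocQuasiIso.isQuasiIso (hC : SupportsLongExactSequences C) {K L : ChainComplex C ℤ}
    (hK : IsBounded K.X) (hL : IsBounded L.X) {f : K ⟶ L} (h : LocQuasiIso f) : IsQuasiIso f :=
  (isQuasiIso_iff f).2 (((locExact_cone_iff f).2 h).isAcyclic hC (hK.cone hL f))

/-- The equations for `g` are solved first; the component `b` of the solution then enters the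
element to be lifted along `f`. -/
lemma LocQuasiIso.comp {K L P : ChainComplex C ℤ} {f : K ⟶ L} {g : L ⟶ P} (hf : LocQuasiIso f)
    (hg : LocQuasiIso g) : LocQuasiIso (f ≫ g) := by
  intro n T a c ha hc
  obtain ⟨T₁, p₁, b, c', hp₁, h₁, h₂⟩ := hg n T (a ≫ f.f _) c
    (by rw [Category.assoc, f.comm, ← Category.assoc, ha, zero_comp])
    (by simpa using hc)
  obtain ⟨T₂, p₂, a', b', hp₂, h₃, h₄⟩ := hf n T₁ (p₁ ≫ a) b
    (by rw [Category.assoc, ha, comp_zero])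
    (by rw [Category.assoc, ← h₁]; simp)
  refine ⟨T₂, p₂ ≫ p₁, a', p₂ ≫ c' + b' ≫ g.f n, hp₂.comp hp₁, by simpa using h₃, ?_⟩
  have h₅ := congrArg (· ≫ g.f (n - 1)) h₄
  have h₆ := congrArg (p₂ ≫ ·) h₂
  simp only [Preadditive.add_comp, Preadditive.comp_add, Category.assoc,
    HomologicalComplex.comp_f, HomologicalComplex.Hom.comm] at h₅ h₆ ⊢
  rw [← h₆, ← h₅]
  abel

lemma locQuasiIso_of_locExact {K L : ChainComplex C ℤ} (f : K ⟶ L) (hK : LocExact K)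
    (hL : LocExact L) : LocQuasiIso f := by
  intro n T a b ha hb
  obtain ⟨T₁, p₁, a', hp₁, h₁⟩ := hK (n - 1) T a ha
  obtain ⟨T₂, p₂, b', hp₂, h₂⟩ := hL n T₁ (p₁ ≫ b + a' ≫ f.f (n - 1)) (by
    rw [Preadditive.add_comp, Category.assoc, Category.assoc, f.comm, ← Category.assoc a', h₁,
      Category.assoc, ← Preadditive.comp_add, add_comm, hb, comp_zero])
  refine ⟨T₂, p₂ ≫ p₁, -(p₂ ≫ a'), b', hp₂.comp hp₁, by simp [h₁], ?_⟩
  rw [h₂]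
  simp

lemma locQuasiIso_iff_of_isZero {K L : ChainComplex C ℤ} (f : K ⟶ L) (hK : ∀ i, IsZero (K.X i)) :
    LocQuasiIso f ↔ LocExact L := by
  refine ⟨fun h n T x hx => ?_, fun h => locQuasiIso_of_locExact f
    (fun n T x _ => ⟨T, 𝟙 T, 0, isDefl_of_isIso _, (hK _).eq_of_tgt _ _⟩) h⟩
  obtain ⟨T', p, a', b', hp, -, h'⟩ := h n T 0 x (by simp) (by simpa using hx)
  exact ⟨T', p, b', hp, by rw [← h', (hK _).eq_of_tgt a' 0]; simp⟩

/-- An element bounding the image of the cycle in `P` is lifted to `L`. The remaining error lies in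
`K`, where it is a cycle and hence locally a boundary. -/
lemma LocExact.of_extension {K L P : ChainComplex C ℤ} (f : K ⟶ L) (g : L ⟶ P)
    (h : ∀ i, IsSES (f.f i) (g.f i)) (hK : LocExact K) (hP : LocExact P) : LocExact L := by
  intro n T x hx
  obtain ⟨T₁, p₁, z, hp₁, h₁⟩ := hP n T (x ≫ g.f _)
    (by rw [Category.assoc, g.comm, ← Category.assoc, hx, zero_comp])
  obtain ⟨T₂, p₂, y, hp₂, h₂⟩ := (h n).isDefl.exists_lift z
  obtain ⟨w, hw⟩ := (h (n - 1)).lift (p₂ ≫ p₁ ≫ x - y ≫ L.d n (n - 1)) (by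
    rw [Preadditive.sub_comp, Category.assoc y, ← g.comm, ← Category.assoc y, h₂]
    simp [h₁])
  have := (h (n - 1 - 1)).mono
  obtain ⟨T₃, p₃, k, hp₃, h₃⟩ := hK n T₂ w (by
    rw [← cancel_mono (f.f (n - 1 - 1)), Category.assoc, ← f.comm, ← Category.assoc, hw]
    simp [hx])
  refine ⟨T₃, p₃ ≫ p₂ ≫ p₁, p₃ ≫ y + k ≫ f.f n, hp₃.comp (hp₂.comp hp₁), ?_⟩
  rw [Preadditive.add_comp, Category.assoc k, f.comm, ← Category.assoc k, h₃]
  simp [hw]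

lemma LocExact.shift {K : ChainComplex C ℤ} (hK : LocExact K) : LocExact (shift K) := by
  intro n T (x : T ⟶ K.X (n - 1 - 1)) hx
  have hx' : x ≫ K.d (n - 1 - 1) (n - 1 - 1 - 1) = 0 := by
    have : x ≫ (-K.d (n - 1 - 1) (n - 1 - 1 - 1)) = 0 := hx
    rwa [Preadditive.comp_neg, neg_eq_zero] at this
  obtain ⟨T', p, y, hp, hy⟩ := hK (n - 1) T x hx'
  refine ⟨T', p, (-y : T' ⟶ K.X (n - 1)), hp, ?_⟩
  change (-y : T' ⟶ K.X (n - 1)) ≫ (-K.d (n - 1) (n - 1 - 1)) = p ≫ x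
  rw [← hy, Preadditive.neg_comp_neg]

lemma isSES_twist {K L : ChainComplex C ℤ} {h : ∀ n, L.X n ⟶ K.X (n - 1)}
    (w : ∀ n, h n ≫ K.d (n - 1) (n - 1 - 1) + L.d n (n - 1) ≫ h (n - 1) = 0) (n : ℤ) :
    IsSES ((twistInl w).f n) ((twistProj w).f n) := by
  rw [twistInl_f]
  exact isSES_inl_snd _ _

lemma isSES_csum (K L : ChainComplex C ℤ) (n : ℤ) :
    IsSES ((csumInl K L).f n) ((csumSnd K L).f n) := isSES_twist _ n

lemma LocExact.twist {K L : ChainComplex C ℤ} (hK : LocExact K) (hL : LocExact L)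
    {h : ∀ n, L.X n ⟶ K.X (n - 1)}
    (w : ∀ n, h n ≫ K.d (n - 1) (n - 1 - 1) + L.d n (n - 1) ≫ h (n - 1) = 0) :
    LocExact (twist K L h w) :=
  LocExact.of_extension (twistInl w) (twistProj w) (isSES_twist w) hK hL

lemma LocExact.csum {K L : ChainComplex C ℤ} (hK : LocExact K) (hL : LocExact L) :
    LocExact (csum K L) :=
  hK.twist hL _

lemma locQuasiIso_of_isIso {K L : ChainComplex C ℤ} (f : K ⟶ L) (h : ∀ i, IsIso (f.f i)) :
    LocQuasiIso f := by
  intro n T a b ha hb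
  refine ⟨T, 𝟙 T, b ≫ inv (f.f (n - 1)), 0, isDefl_of_isIso _, ?_, by simp⟩
  rw [← cancel_mono (f.f (n - 1 - 1)), Preadditive.neg_comp, Category.assoc, ← f.comm]
  simp only [Category.assoc, IsIso.inv_hom_id_assoc, Category.id_comp]
  exact (eq_neg_of_add_eq_zero_left hb).symm

/-- The mapping cones form a short exact sequence, so `LocExact.of_extension` applies to them. -/
lemma LocQuasiIso.of_extension {K K' K'' L L' L'' : ChainComplex C ℤ} {f : K ⟶ L} {f' : K' ⟶ L'}
    {f'' : K'' ⟶ L''} (i : K ⟶ K') (p : K' ⟶ K'') (j : L ⟶ L') (q : L' ⟶ L'')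
    (h₁ : ∀ n, IsSES (i.f n) (p.f n)) (h₂ : ∀ n, IsSES (j.f n) (q.f n))
    (w₁ : i ≫ f' = f ≫ j) (w₂ : p ≫ f'' = f' ≫ q) (hf : LocQuasiIso f) (hf'' : LocQuasiIso f'') :
    LocQuasiIso f' :=
  (locExact_cone_iff f').1 (LocExact.of_extension (coneMap i j w₁) (coneMap p q w₂)
    (fun n => (h₁ (n - 1)).biprod_map (h₂ n)) ((locExact_cone_iff f).2 hf)
    ((locExact_cone_iff f'').2 hf''))

/-- The map from the mapping cone to a complex induced by a null composite. -/
noncomputable def coneDesc {K L P : ChainComplex C ℤ} (f : K ⟶ L) (g : L ⟶ P) (w : f ≫ g = 0) :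
    cone f ⟶ P :=
  homMk (fun n => coneSnd f n ≫ g.f n) (fun n => by
    have := HomologicalComplex.congr_hom w (n - 1)
    simp only [HomologicalComplex.comp_f, HomologicalComplex.zero_f] at this
    simp [this])

@[simp]
lemma coneDesc_f {K L P : ChainComplex C ℤ} (f : K ⟶ L) (g : L ⟶ P) (w : f ≫ g = 0) (n : ℤ) :
    (coneDesc f g w).f n = coneSnd f n ≫ g.f n := rfl

/-- With `locQuasiIso_cylDesc` this allows a short exact sequence to be replaced by the degreewise
split sequence `K ⟶ cyl f ⟶ cone f`. -/
lemma locQuasiIso_coneDesc {K L P : ChainComplex C ℤ} (f : K ⟶ L) (g : L ⟶ P) (w : f ≫ g = 0)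
    (h : ∀ n, IsSES (f.f n) (g.f n)) : LocQuasiIso (coneDesc f g w) := by
  intro n T a b ha hb
  have ha₁ := congrArg (· ≫ coneFst f _) ha
  have ha₂ := congrArg (· ≫ coneSnd f _) ha
  simp only [Category.assoc, cone_d_fst, cone_d_snd, Preadditive.comp_neg, neg_eq_zero,
    Preadditive.comp_add, zero_comp, coneDesc_f] at ha₁ ha₂ hb
  obtain ⟨T', p, y, hp, hy⟩ := (h (n - 1)).isDefl.exists_lift b
  -- The boundary of the lift `y` and the `L`-component of `-(p ≫ a)` agree in `P`, so they differ
  -- by an element of `K`. This becomes the `K`-component of the bounding element.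
  obtain ⟨x, hx⟩ := (h (n - 1 - 1)).lift (-(p ≫ a ≫ coneSnd f _) - y ≫ L.d _ _) (by
    rw [Preadditive.sub_comp, Category.assoc y, ← g.comm, ← Category.assoc y, hy]
    have := congrArg (fun z => p ≫ z) hb
    simp only [Preadditive.comp_add, comp_zero] at this
    simp [eq_neg_of_add_eq_zero_left this])
  have := (h (n - 1 - 1 - 1)).mono
  refine ⟨T', p, coneLift f x y, 0, hp, ?_, by simp [hy]⟩
  apply cone_hom_ext
  · rw [← cancel_mono (f.f (n - 1 - 1 - 1))]
    have h₃ : x ≫ K.d (n - 1 - 1) (n - 1 - 1 - 1) ≫ f.f (n - 1 - 1 - 1) =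
        -(p ≫ a ≫ coneSnd f _ ≫ L.d _ _) := by
      rw [← f.comm, ← Category.assoc, hx]
      simp
    have h₄ := congrArg (p ≫ ·) ha₂
    simp only [Preadditive.comp_add, comp_zero] at h₄
    simp [h₃, eq_neg_of_add_eq_zero_left h₄]
  · simp [hx]

/-- The mapping cylinder. -/
noncomputable abbrev cyl {K L : ChainComplex C ℤ} (f : K ⟶ L) : ChainComplex C ℤ :=
  twist K (cone f) (fun n => -coneFst f n) (by simp)

/-- The projection of the mapping cylinder. -/
noncomputable def cylDesc {K L : ChainComplex C ℤ} (f : K ⟶ L) : cyl f ⟶ L :=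
  homMk (fun n => twistFst _ n ≫ f.f n + twistSnd _ n ≫ coneSnd f n) (fun n => by simp)

@[simp]
lemma cylDesc_f {K L : ChainComplex C ℤ} (f : K ⟶ L) (n : ℤ) :
    (cylDesc f).f n = twistFst _ n ≫ f.f n + twistSnd _ n ≫ coneSnd f n := rfl

/-- No cover is needed: up to sign, the shifted copy of `K` in the cone bounds the copy of `K`
itself, so the `K`-component of `a` is reused inside the cone. -/
lemma locQuasiIso_cylDesc {K L : ChainComplex C ℤ} (f : K ⟶ L) : LocQuasiIso (cylDesc f) := by
  intro n T a b ha hb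
  have h₁ := congrArg (· ≫ twistFst _ _) ha
  simp at h₁ hb
  refine ⟨T, 𝟙 T, twistLift _ 0 (coneLift f (a ≫ twistFst _ _) b), 0, isDefl_of_isIso _, ?_,
    by simp⟩
  rw [Category.id_comp]
  apply twist_hom_ext
  · simp
  · apply cone_hom_ext
    · simpa using (add_neg_eq_zero.1 h₁)
    · simp only [Preadditive.neg_comp, Category.assoc, twist_d_snd_assoc, cone_d_snd,
        Preadditive.comp_add, twistLift_snd_assoc, coneLift_fst_assoc, coneLift_snd_assoc]
      rw [eq_neg_of_add_eq_zero_right hb]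
      abel

end

/-! ### Constructions with binary complexes -/

namespace BinaryComplex

variable {C : Type u} [Category.{v} C] [Preadditive C]

/-- A map of binary complexes, from a pair of chain maps with the same components. -/
def homOf {P Q : BinaryComplex C} (φ : P.top ⟶ Q.top) (ψ : P.bot ⟶ Q.bot)
    (h : ∀ i, (φ.f i : P.X i ⟶ Q.X i) = ψ.f i) : P ⟶ Q :=
  BinaryComplex.Hom.mk (fun i => φ.f i) (fun i j => φ.comm i j)
    (fun i j => by rw [h i, h j]; exact ψ.comm i j)

lemma isIso_of_components {P Q : BinaryComplex C} (f : P ⟶ Q) (h : ∀ i, IsIso (f.f i)) :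
    IsIso f := by
  let g : Q ⟶ P := BinaryComplex.Hom.mk (fun i => inv (f.f i))
    (fun i j => by rw [IsIso.inv_comp_eq, ← Category.assoc, f.commTop, Category.assoc,
      IsIso.hom_inv_id, Category.comp_id])
    (fun i j => by rw [IsIso.inv_comp_eq, ← Category.assoc, f.commBot, Category.assoc,
      IsIso.hom_inv_id, Category.comp_id])
  exact ⟨g, Hom.ext (funext fun i => IsIso.hom_inv_id (f.f i)),
    Hom.ext (funext fun i => IsIso.inv_hom_id (f.f i))⟩

instance isIso_component {P Q : BinaryComplex C} (f : P ⟶ Q) [IsIso f] (i : ℤ) : IsIso (f.f i) :=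
  ⟨(inv f).f i, congrArg (fun g : P ⟶ P => g.f i) (IsIso.hom_inv_id f),
    congrArg (fun g : Q ⟶ Q => g.f i) (IsIso.inv_hom_id f)⟩

lemma eq_diag {P : BinaryComplex C} (h : ∀ i j, P.dTop i j = P.dBot i j) : P = diag P.top := by
  obtain ⟨X, d, d', _, _, _, _⟩ := P
  obtain rfl : d = d' := funext fun i => funext fun j => h i j
  rfl

/-- The shift of a binary complex. -/
def bshift (P : BinaryComplex C) : BinaryComplex C where
  X := (shift P.top).X
  dTop := (shift P.top).d
  dBot := (shift P.bot).d
  shapeTop := (shift P.top).shape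
  shapeBot := (shift P.bot).shape
  dTop_comp_dTop := (shift P.top).d_comp_d'
  dBot_comp_dBot := (shift P.bot).d_comp_d'

/-- The binary complex given by two chain complexes that are isomorphic as graded objects. -/
@[simps]
def zip (K L : ChainComplex C ℤ) (θ : ∀ i, K.X i ≅ L.X i) : BinaryComplex C where
  X := K.X
  dTop := K.d
  dBot i j := (θ i).hom ≫ L.d i j ≫ (θ j).inv
  shapeTop := K.shape
  shapeBot i j h := by simp [L.shape i j h]
  dTop_comp_dTop := K.d_comp_d'
  dBot_comp_dBot i j k _ _ := by simp

/-- The bottom complex of `zip K L θ` is isomorphic to `L`. -/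
def zipBot {K L : ChainComplex C ℤ} (θ : ∀ i, K.X i ≅ L.X i) : (zip K L θ).bot ⟶ L where
  f i := (θ i).hom
  comm' i j _ := by
    change (θ i).hom ≫ L.d i j = ((θ i).hom ≫ L.d i j ≫ (θ j).inv) ≫ (θ j).hom
    simp

/-- The inverse of `zipBot`. -/
def zipBotInv {K L : ChainComplex C ℤ} (θ : ∀ i, K.X i ≅ L.X i) : L ⟶ (zip K L θ).bot where
  f i := (θ i).inv
  comm' i j _ := by
    change (θ i).inv ≫ ((θ i).hom ≫ L.d i j ≫ (θ j).inv) = L.d i j ≫ (θ j).inv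
    simp

/-- The map of binary complexes `zip K L θ ⟶ zip K' L' θ'` induced by a pair of chain maps. -/
def zipMap {K L K' L' : ChainComplex C ℤ} {θ : ∀ i, K.X i ≅ L.X i} {θ' : ∀ i, K'.X i ≅ L'.X i}
    (a : K ⟶ K') (b : L ⟶ L') (h : ∀ i, a.f i ≫ (θ' i).hom = (θ i).hom ≫ b.f i) :
    zip K L θ ⟶ zip K' L' θ' :=
  BinaryComplex.Hom.mk a.f (fun i j => a.comm i j) (fun i j => by
    have h' : (θ j).inv ≫ a.f j = b.f j ≫ (θ' j).inv := by
      rw [Iso.inv_comp_eq, ← Category.assoc, Iso.eq_comp_inv, h]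
    change a.f i ≫ ((θ' i).hom ≫ L'.d i j ≫ (θ' j).inv) =
      ((θ i).hom ≫ L.d i j ≫ (θ j).inv) ≫ a.f j
    rw [← Category.assoc (a.f i), h]
    simp [h'])

variable [HasBinaryBiproducts C]

/-- The mapping cone of a pair of chain maps between the top and the bottom complexes. -/
noncomputable def bcone {P Q : BinaryComplex C} (φ : P.top ⟶ Q.top) (ψ : P.bot ⟶ Q.bot) :
    BinaryComplex C where
  X := (cone φ).X
  dTop := (cone φ).d
  dBot := (cone ψ).d
  shapeTop := (cone φ).shape
  shapeBot := (cone ψ).shape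
  dTop_comp_dTop := (cone φ).d_comp_d'
  dBot_comp_dBot := (cone ψ).d_comp_d'

/-- The map of mapping cones induced by a commutative square. -/
noncomputable def bconeMap {P Q P' Q' : BinaryComplex C} {φ : P.top ⟶ Q.top} {ψ : P.bot ⟶ Q.bot}
    {φ' : P'.top ⟶ Q'.top} {ψ' : P'.bot ⟶ Q'.bot} (a : P ⟶ P') (b : Q ⟶ Q')
    (h : mapTop a ≫ φ' = φ ≫ mapTop b) (h' : mapBot a ≫ ψ' = ψ ≫ mapBot b) :
    bcone φ ψ ⟶ bcone φ' ψ' :=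
  homOf (P := bcone φ ψ) (Q := bcone φ' ψ') (coneMap _ _ h) (coneMap _ _ h') (fun _ => rfl)

/-- The inclusion of the target in the mapping cone. -/
noncomputable def bconeInr {P Q : BinaryComplex C} (φ : P.top ⟶ Q.top) (ψ : P.bot ⟶ Q.bot) :
    Q ⟶ bcone φ ψ :=
  homOf (P := Q) (Q := bcone φ ψ) (coneInr φ) (coneInr ψ) (fun _ => rfl)

/-- The projection of the mapping cone to the shift of the source. -/
noncomputable def bconeProj {P Q : BinaryComplex C} (φ : P.top ⟶ Q.top) (ψ : P.bot ⟶ Q.bot) :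
    bcone φ ψ ⟶ bshift P :=
  homOf (P := bcone φ ψ) (Q := bshift P) (coneProj φ) (coneProj ψ) (fun _ => rfl)

/-- The direct sum of binary complexes. -/
noncomputable def bsum (P Q : BinaryComplex C) : BinaryComplex C where
  X := (csum P.top Q.top).X
  dTop := (csum P.top Q.top).d
  dBot := (csum P.bot Q.bot).d
  shapeTop := (csum P.top Q.top).shape
  shapeBot := (csum P.bot Q.bot).shape
  dTop_comp_dTop := (csum P.top Q.top).d_comp_d'
  dBot_comp_dBot := (csum P.bot Q.bot).d_comp_d'

/-- The first inclusion. -/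
noncomputable def bsumInl (P Q : BinaryComplex C) : P ⟶ bsum P Q :=
  homOf (P := P) (Q := bsum P Q) (csumInl P.top Q.top) (csumInl P.bot Q.bot)
    (fun _ => rfl)

/-- The first projection. -/
noncomputable def bsumFst (P Q : BinaryComplex C) : bsum P Q ⟶ P :=
  homOf (P := bsum P Q) (Q := P) (csumFst P.top Q.top) (csumFst P.bot Q.bot)
    (fun _ => rfl)

/-- The second projection. -/
noncomputable def bsumSnd (P Q : BinaryComplex C) : bsum P Q ⟶ Q :=
  homOf (P := bsum P Q) (Q := Q) (csumSnd P.top Q.top) (csumSnd P.bot Q.bot)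
    (fun _ => rfl)

end BinaryComplex

open BinaryComplex

section

variable {C : Type u} [Category.{v} C] [Preadditive C] [HasZeroObject C] [HasBinaryBiproducts C]
  [ExactCategory C]

lemma isSES_cone {K L : ChainComplex C ℤ} (f : K ⟶ L) (n : ℤ) :
    IsSES ((coneInr f).f n) ((coneProj f).f n) :=
  isSES_inr_fst _ _

/-- A function that is additive on short exact sequences of bounded binary complexes and vanishes
on diagonal complexes is zero. -/
lemma eq_zero_of_additive {G : Type*} [AddCommGroup G]
    (Θ : ∀ P : BinaryComplex C, IsBounded P.X → G)
    (hd : ∀ (K : ChainComplex C ℤ) (h : IsBounded K.X), Θ (BinaryComplex.diag K) h = 0)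
    (ha : ∀ (P Q R : BinaryComplex C) (hP : IsBounded P.X) (hQ : IsBounded Q.X)
      (hR : IsBounded R.X) (i : P ⟶ Q) (p : Q ⟶ R), (∀ n, IsSES (i.f n) (p.f n)) →
      Θ Q hQ = Θ P hP + Θ R hR) (P : BinaryComplex C) (hP : IsBounded P.X) : Θ P hP = 0 := by
  -- Induction on the length of an interval `[a, a + n)` outside which `P` vanishes; each step
  -- splits off the lowest degree.
  have key : ∀ (n : ℕ) (a : ℤ) (P : BinaryComplex C) (hP : IsBounded P.X),
      (∀ i, i < a ∨ a + n ≤ i → IsZero (P.X i)) → Θ P hP = 0 := by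
    intro n
    induction n with
    | zero =>
      intro a P hP h
      have h0 : ∀ i, IsZero (P.X i) := fun i => h i (by omega)
      have aux : ∀ Q, P = Q → (∀ hQ, Θ Q hQ = 0) → Θ P hP = 0 := by
        rintro Q rfl hQ
        exact hQ _
      exact aux _ (eq_diag (fun i j => (h0 i).eq_of_src _ _)) fun _ => hd _ _
    | succ n ih =>
      intro a P hP h
      -- The graded object `A` is `P` in degree `a` and zero elsewhere. As `P` vanishes below `a`,
      -- it is a subcomplex with zero differentials, hence a diagonal one.
      have hA : ∃ (A : ℤ → C) (ι : ∀ i, A i ⟶ P.X i), (∀ i, i ≠ a → IsZero (A i)) ∧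
          IsIso (ι a) := by
        refine ⟨fun i => if i = a then P.X i else 0, fun i =>
          if hi : i = a then eqToHom (by simp [hi]) else 0, fun i hi => ?_, ?_⟩
        · simpa [hi] using isZero_zero C
        · simp only [dif_pos]
          infer_instance
      obtain ⟨A, ι, hA, hι⟩ := hA
      -- The quotient `Y` drops degree `a`. The section `s` is one of graded objects only and serves
      -- to transport the two differentials.
      have hY : ∃ (Y : ℤ → C) (p : ∀ i, P.X i ⟶ Y i) (s : ∀ i, Y i ⟶ P.X i),
          IsZero (Y a) ∧ (∀ i, s i ≫ p i = 𝟙 _) ∧ ∀ i, i ≠ a → p i ≫ s i = 𝟙 _ := by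
        refine ⟨fun i => if i = a then 0 else P.X i, fun i =>
          if hi : i = a then 0 else eqToHom (by simp [hi]),
          fun i => if hi : i = a then 0 else eqToHom (by simp [hi]), ?_, fun i => ?_,
          fun i hi => by simp [hi]⟩
        · simpa using isZero_zero C
        · by_cases hi : i = a
          · apply IsZero.eq_of_src
            simpa [hi] using isZero_zero C
          · simp [hi]
      obtain ⟨Y, p, s, hY, hsp, hps⟩ := hY
      have hlow : ∀ i j : ℤ, j + 1 = i → i = a → IsZero (P.X j) := fun i j hij hi =>
        h j (by omega)
      -- Where `p ≫ s` is not the identity, the differential already has zero target.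
      have hpd : ∀ i j, (ComplexShape.down ℤ).Rel i j → ∀ d : P.X i ⟶ P.X j,
          p i ≫ s i ≫ d ≫ p j = d ≫ p j := by
        intro i j hij d
        by_cases hi : i = a
        · rw [(hlow i j hij hi).eq_of_tgt d 0]
          simp
        · rw [← Category.assoc, hps i hi, Category.id_comp]
      let A' : ChainComplex C ℤ :=
        { X := A, d := fun _ _ => 0, shape := fun _ _ _ => rfl, d_comp_d' := by simp }
      let R : BinaryComplex C :=
        { X := Y
          dTop := fun i j => s i ≫ P.dTop i j ≫ p j
          dBot := fun i j => s i ≫ P.dBot i j ≫ p j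
          shapeTop := fun i j hij => by rw [P.shapeTop i j hij]; simp
          shapeBot := fun i j hij => by rw [P.shapeBot i j hij]; simp
          dTop_comp_dTop := fun i j k hij hjk => by
            simp only [Category.assoc, hpd j k hjk]
            rw [← Category.assoc (P.dTop i j), P.dTop_comp_dTop i j k hij hjk]
            simp
          dBot_comp_dBot := fun i j k hij hjk => by
            simp only [Category.assoc, hpd j k hjk]
            rw [← Category.assoc (P.dBot i j), P.dBot_comp_dBot i j k hij hjk]
            simp }
      have hAd : ∀ (i j : ℤ) (d : P.X i ⟶ P.X j), (¬ (ComplexShape.down ℤ).Rel i j → d = 0) →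
          ι i ≫ d = (0 : A i ⟶ A j) ≫ ι j := by
        intro i j d hd
        rw [zero_comp]
        by_cases hij : (ComplexShape.down ℤ).Rel i j
        · by_cases hi : i = a
          · exact (hlow i j hij hi).eq_of_tgt _ _
          · exact (hA i hi).eq_of_src _ _
        · rw [hd hij, comp_zero]
      let i : BinaryComplex.diag A' ⟶ P := BinaryComplex.Hom.mk (K := BinaryComplex.diag A') ι
        (fun i j => hAd i j _ (P.shapeTop i j)) (fun i j => hAd i j _ (P.shapeBot i j))
      let q : P ⟶ R := BinaryComplex.Hom.mk p
        (fun i j => by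
          by_cases hij : (ComplexShape.down ℤ).Rel i j
          · exact hpd i j hij _
          · rw [R.shapeTop i j hij, P.shapeTop i j hij, comp_zero, zero_comp])
        (fun i j => by
          by_cases hij : (ComplexShape.down ℤ).Rel i j
          · exact hpd i j hij _
          · rw [R.shapeBot i j hij, P.shapeBot i j hij, comp_zero, zero_comp])
      have hAb : IsBounded A := ⟨a, a, fun i hi => hA i (by omega)⟩
      have hRz : ∀ i, i < a + 1 ∨ a + 1 + n ≤ i → IsZero (Y i) := by
        intro i hi
        by_cases hia : i = a
        · exact hia ▸ hY
        · exact (h i (by push_cast; omega)).of_iso ⟨s i, p i, hsp i, hps i hia⟩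
      have hRb : IsBounded Y := ⟨a + 1, a + 1 + n, fun i hi => hRz i (by omega)⟩
      have := ha (BinaryComplex.diag A') P R hAb hP hRb i q (fun j => by
        by_cases hj : j = a
        · subst hj
          exact isSES_of_isIso_left (ι j) (p j) hY
        · have : IsIso (p j) := ⟨s j, hps j hj, hsp j⟩
          exact isSES_of_isIso_right (ι j) (p j) (hA j hj))
      rw [this, hd A' hAb, ih (a + 1) R hRb hRz, add_zero]
  obtain ⟨a, b, h⟩ := hP
  -- If `b + 1 < a`, the length is truncated to `0`; this is harmless, as every degree then lies
  -- outside the bounds.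
  exact key (b + 1 - a).toNat a P _ (fun i hi => h i (by omega))

end

/-! ### Classes of objects -/

section

variable {M : Type u₁} [Category.{v₁} M] [Preadditive M] [HasZeroObject M]
  [HasBinaryBiproducts M] [ExactCategory M]
  {N : Type u₂} [Category.{v₂} N] [Preadditive N] [HasZeroObject N]
  [HasBinaryBiproducts N] [ExactCategory N] {F : M ⥤ N} [F.Additive]

namespace BObj

/-- The class of an object of `B[F]` in `K₀Ω[F]`. -/
def cls (X : BObj F) : K0Omega F := QuotientAddGroup.mk (FreeAbelianGroup.of X)

lemma mk_eq_zero_of_rel {x : FreeAbelianGroup (BObj F)} (h : OmegaRel F x) :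
    (QuotientAddGroup.mk x : K0Omega F) = 0 :=
  (QuotientAddGroup.eq_zero_iff x).2 (AddSubgroup.subset_closure h)

lemma cls_exact {X Y Z : BObj F} {f : X ⟶ Y} {g : Y ⟶ Z} (h : IsExact f g) :
    cls Y = cls X + cls Z := by
  have := mk_eq_zero_of_rel (OmegaRel.exact f g h)
  rw [QuotientAddGroup.mk_sub, QuotientAddGroup.mk_sub, sub_sub, sub_eq_zero] at this
  exact this

lemma cls_diag (W : CObj F) : cls (diag W) = 0 := mk_eq_zero_of_rel (OmegaRel.diag W)

lemma cls_eq_of_isP {X Y : BObj F} {f : X ⟶ Y} (h : IsP f) : cls X = cls Y := by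
  have := mk_eq_zero_of_rel (OmegaRel.weq f h)
  rw [QuotientAddGroup.mk_sub, sub_eq_zero] at this
  exact this

end BObj

end

/-! ### Acyclic binary complexes and the calculus of cones in `K₀Ω[0 ⟶ C]` -/

section

variable {C : Type u} [Category.{v} C] [Preadditive C] [HasZeroObject C] [HasBinaryBiproducts C]
  [ExactCategory C]

lemma isQuasiIso_iff_of_isZero {K L : ChainComplex C ℤ} (f : K ⟶ L) (hK : ∀ i, IsZero (K.X i)) :
    IsQuasiIso f ↔ IsAcyclic L := by
  have h : ∀ n, IsIso ((coneInr f).f n) := fun n => ⟨coneSnd f n, by simp, by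
    apply cone_hom_ext
    · exact (hK _).eq_of_tgt _ _
    · simp⟩
  have := HomologicalComplex.Hom.isIso_of_components (coneInr f)
  rw [isQuasiIso_iff]
  exact ⟨fun h => h.of_iso (asIso (coneInr f)).symm, fun h => h.of_iso (asIso (coneInr f))⟩

/-- A bounded binary complex whose top and bottom complexes are acyclic. -/
structure BAcyclic (A : BinaryComplex C) : Prop where
  bounded : IsBounded A.X
  top : IsAcyclic A.top
  bot : IsAcyclic A.bot

/-- A chain complex of the zero category. -/
def zeroComplex : ChainComplex ZeroCat ℤ where
  X _ := ZeroCat.pt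
  d _ _ := 0

lemma isBounded_zeroCat (X : ℤ → ZeroCat) : IsBounded X :=
  isBounded_of_isZero fun _ => ZeroCat.isZero _

lemma isAcyclic_zeroCat (K : ChainComplex ZeroCat ℤ) : IsAcyclic K :=
  ⟨fun _ => ZeroCat.pt, fun _ => 0, fun _ => 0, fun _ => ⟨Subsingleton.elim _ _, trivial⟩,
    fun _ => Subsingleton.elim _ _⟩

lemma isQuasiIso_zeroCat {K L : ChainComplex ZeroCat ℤ} (f : K ⟶ L) : IsQuasiIso f :=
  isAcyclic_zeroCat _

lemma isZero_mapC_fromZero (K : ChainComplex ZeroCat ℤ) (i : ℤ) :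
    IsZero (((mapC (ZeroCat.fromZero C)).obj K).X i) :=
  ZeroCat.isZero_fromZero C (K.X i)

/-- The object of `B[0 ⟶ C]` given by an acyclic binary complex. -/
noncomputable def k1Obj (A : BinaryComplex C) (h : BAcyclic A) : BObj (ZeroCat.fromZero C) where
  srcTop := zeroComplex
  srcBot := zeroComplex
  tar := A
  srcTop_bounded := isBounded_zeroCat _
  srcBot_bounded := isBounded_zeroCat _
  tar_bounded := h.bounded
  compTop := 0
  compBot := 0
  compTop_quasiIso := (isQuasiIso_iff_of_isZero _ (isZero_mapC_fromZero _)).2 h.top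
  compBot_quasiIso := (isQuasiIso_iff_of_isZero _ (isZero_mapC_fromZero _)).2 h.bot

/-- The class of an acyclic binary complex. -/
noncomputable def k1 (A : BinaryComplex C) (h : BAcyclic A) : K0Omega (ZeroCat.fromZero C) :=
  (k1Obj A h).cls

lemma k1_exact {A B D : BinaryComplex C} (hA : BAcyclic A) (hB : BAcyclic B) (hD : BAcyclic D)
    (f : A ⟶ B) (g : B ⟶ D) (h : ∀ n, IsSES (f.f n) (g.f n)) : k1 B hB = k1 A hA + k1 D hD :=
  BObj.cls_exact (f := (BObj.Hom.mk 0 0 f (by simp [k1Obj]) (by simp [k1Obj]) :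
      k1Obj A hA ⟶ k1Obj B hB))
    (g := (BObj.Hom.mk 0 0 g (by simp [k1Obj]) (by simp [k1Obj]) : k1Obj B hB ⟶ k1Obj D hD))
    ⟨fun _ => ⟨Subsingleton.elim _ _, trivial⟩, fun _ => ⟨Subsingleton.elim _ _, trivial⟩, h⟩

lemma k1_diag {K : ChainComplex C ℤ} (h : BAcyclic (BinaryComplex.diag K)) :
    k1 _ h = 0 :=
  BObj.cls_diag (F := ZeroCat.fromZero C)
    { src := zeroComplex
      tar := K
      src_bounded := isBounded_zeroCat _
      tar_bounded := h.bounded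
      comp := 0
      comp_quasiIso := (isQuasiIso_iff_of_isZero _ (isZero_mapC_fromZero _)).2 h.top }

lemma k1_eq_zero {A : BinaryComplex C} (h : BAcyclic A) (hd : ∀ i j, A.dTop i j = A.dBot i j) :
    k1 A h = 0 := by
  have aux : ∀ B, A = B → (∀ hB, k1 B hB = 0) → k1 A h = 0 := by
    rintro B rfl hB
    exact hB _
  exact aux _ (eq_diag hd) fun _ => k1_diag _

lemma isAcyclic_of_isZero {K : ChainComplex C ℤ} (hK : ∀ i, IsZero (K.X i)) : IsAcyclic K :=
  ⟨fun _ => 0, fun _ => 0, fun _ => 0, fun i => by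
    have : IsIso (0 : K.X i ⟶ (0 : C)) := ⟨0, (hK i).eq_of_src _ _, (isZero_zero C).eq_of_src _ _⟩
    exact isSES_of_isIso_right _ _ (isZero_zero C), fun i => (hK i).eq_of_src _ _⟩

/-- An isomorphism is a short exact sequence with zero third term, and the zero complex is diagonal.
-/
lemma k1_eq_of_isIso {A B : BinaryComplex C} (hA : BAcyclic A) (hB : BAcyclic B) (f : A ⟶ B)
    (hf : ∀ n, IsIso (f.f n)) : k1 A hA = k1 B hB := by
  let Z : ChainComplex C ℤ := { X := fun _ => 0, d := fun _ _ => 0 }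
  have hZ : ∀ i, IsZero (Z.X i) := fun _ => isZero_zero C
  have hZ' : BAcyclic (BinaryComplex.diag Z) :=
    ⟨isBounded_of_isZero hZ, isAcyclic_of_isZero hZ, isAcyclic_of_isZero hZ⟩
  have := k1_exact hA hB hZ' f (BinaryComplex.Hom.mk (L := BinaryComplex.diag Z) (fun i => 0)
    (fun _ j => (hZ j).eq_of_tgt _ _) (fun _ j => (hZ j).eq_of_tgt _ _))
    (fun n => isSES_of_isIso_left (f.f n) (0 : B.X n ⟶ Z.X n) (hZ n))
  rw [this, k1_diag, add_zero]

lemma BAcyclic.bcone {P Q : BinaryComplex C} (hP : IsBounded P.X) (hQ : IsBounded Q.X)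
    {φ : P.top ⟶ Q.top} {ψ : P.bot ⟶ Q.bot} (hφ : IsQuasiIso φ) (hψ : IsQuasiIso ψ) :
    BAcyclic (BinaryComplex.bcone φ ψ) :=
  ⟨hP.cone hQ φ, (isQuasiIso_iff φ).1 hφ, (isQuasiIso_iff ψ).1 hψ⟩

lemma isQuasiIso_of_isIso (hC : SupportsLongExactSequences C) {K L : ChainComplex C ℤ}
    (hK : IsBounded K.X) (hL : IsBounded L.X) (f : K ⟶ L) (h : ∀ i, IsIso (f.f i)) :
    IsQuasiIso f :=
  (locQuasiIso_of_isIso f h).isQuasiIso hC hK hL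

lemma isQuasiIso_id (hC : SupportsLongExactSequences C) {K : ChainComplex C ℤ}
    (hK : IsBounded K.X) : IsQuasiIso (𝟙 K) :=
  isQuasiIso_of_isIso hC hK hK _ (fun i => by rw [HomologicalComplex.id_f]; infer_instance)

lemma isQuasiIso_of_isAcyclic (hC : SupportsLongExactSequences C) {K L : ChainComplex C ℤ}
    (hK : IsBounded K.X) (hL : IsBounded L.X) (f : K ⟶ L) (hK' : IsAcyclic K)
    (hL' : IsAcyclic L) : IsQuasiIso f :=
  (locQuasiIso_of_locExact f hK'.locExact hL'.locExact).isQuasiIso hC hK hL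

lemma IsQuasiIso.comp (hC : SupportsLongExactSequences C) {K L P : ChainComplex C ℤ}
    (hK : IsBounded K.X) (hP : IsBounded P.X) {f : K ⟶ L} {g : L ⟶ P} (hf : IsQuasiIso f)
    (hg : IsQuasiIso g) : IsQuasiIso (f ≫ g) :=
  (hf.locQuasiIso.comp hg.locQuasiIso).isQuasiIso hC hK hP

lemma IsAcyclic.shift (hC : SupportsLongExactSequences C) {K : ChainComplex C ℤ}
    (hK : IsBounded K.X) (h : IsAcyclic K) : IsAcyclic (shift K) :=
  h.locExact.shift.isAcyclic hC hK.shift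

lemma BAcyclic.bshift (hC : SupportsLongExactSequences C) {P : BinaryComplex C}
    (hP : BAcyclic P) : BAcyclic (BinaryComplex.bshift P) :=
  ⟨hP.bounded.shift, hP.top.shift hC hP.bounded, hP.bot.shift hC hP.bounded⟩

lemma BAcyclic.bsum (hC : SupportsLongExactSequences C) {P Q : BinaryComplex C}
    (hP : BAcyclic P) (hQ : BAcyclic Q) : BAcyclic (BinaryComplex.bsum P Q) :=
  have hb : IsBounded (BinaryComplex.bsum P Q).X := hP.bounded.biprod hQ.bounded
  ⟨hb, (hP.top.locExact.csum hQ.top.locExact).isAcyclic hC hb,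
    (hP.bot.locExact.csum hQ.bot.locExact).isAcyclic hC hb⟩

lemma k1_bsum {P Q : BinaryComplex C} (hP : BAcyclic P) (hQ : BAcyclic Q)
    (h : BAcyclic (BinaryComplex.bsum P Q)) : k1 _ h = k1 P hP + k1 Q hQ :=
  k1_exact hP h hQ (bsumInl P Q) (bsumSnd P Q) (isSES_csum P.top Q.top)

/-- Additivity of the class of the mapping cone. -/
lemma k1_bcone_exact {P P' P'' Q Q' Q'' : BinaryComplex C}
    {φ : P.top ⟶ Q.top} {ψ : P.bot ⟶ Q.bot} {φ' : P'.top ⟶ Q'.top} {ψ' : P'.bot ⟶ Q'.bot}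
    {φ'' : P''.top ⟶ Q''.top} {ψ'' : P''.bot ⟶ Q''.bot} (h : BAcyclic (BinaryComplex.bcone φ ψ))
    (h' : BAcyclic (BinaryComplex.bcone φ' ψ')) (h'' : BAcyclic (BinaryComplex.bcone φ'' ψ''))
    (a : P ⟶ P') (b : P' ⟶ P'') (c : Q ⟶ Q') (d : Q' ⟶ Q'')
    (h₁ : ∀ n, IsSES (a.f n) (b.f n)) (h₂ : ∀ n, IsSES (c.f n) (d.f n))
    (w₁ : mapTop a ≫ φ' = φ ≫ mapTop c) (w₂ : mapBot a ≫ ψ' = ψ ≫ mapBot c)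
    (w₃ : mapTop b ≫ φ'' = φ' ≫ mapTop d) (w₄ : mapBot b ≫ ψ'' = ψ' ≫ mapBot d) :
    k1 _ h' = k1 _ h + k1 _ h'' :=
  k1_exact h h' h'' (bconeMap a c w₁ w₂) (bconeMap b d w₃ w₄)
    (fun n => (h₁ (n - 1)).biprod_map (h₂ n))

/-- The complex `P` need not be acyclic, since its cone is. This is what makes `eq_zero_of_additive`
applicable: the cone is exact in `P` and diagonal when `P` is, for all bounded `P`. -/
lemma k1_bcone_id (hC : SupportsLongExactSequences C) (P : BinaryComplex C) (hP : IsBounded P.X)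
    (h : BAcyclic (BinaryComplex.bcone (𝟙 P.top) (𝟙 P.bot))) : k1 _ h = 0 := by
  have hb : ∀ (P : BinaryComplex C), IsBounded P.X → BAcyclic (BinaryComplex.bcone (𝟙 P.top) (𝟙 P.bot)) :=
    fun P hP => BAcyclic.bcone hP hP (isQuasiIso_id hC hP) (isQuasiIso_id hC hP)
  refine eq_zero_of_additive (fun P hP => k1 _ (hb P hP)) (fun K hK => ?_)
    (fun P Q R hP hQ hR i p hip => ?_) P hP
  · exact k1_eq_zero _ (fun _ _ => rfl)
  · exact k1_bcone_exact _ _ _ i p i p hip hip (by simp) (by simp) (by simp) (by simp)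

/-- The cone of the identity has class zero and is an extension of the shift by `P`. -/
lemma k1_bshift (hC : SupportsLongExactSequences C) {P : BinaryComplex C} (hP : BAcyclic P)
    (h : BAcyclic (BinaryComplex.bshift P)) : k1 _ h = - k1 P hP := by
  have h₁ : BAcyclic (BinaryComplex.bcone (𝟙 P.top) (𝟙 P.bot)) := BAcyclic.bcone hP.bounded hP.bounded
    (isQuasiIso_id hC hP.bounded) (isQuasiIso_id hC hP.bounded)
  have := k1_exact hP h₁ h (bconeInr _ _) (bconeProj _ _) (isSES_cone (𝟙 P.top))
  rw [k1_bcone_id hC P hP.bounded] at this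
  exact (neg_eq_of_add_eq_zero_right this.symm).symm

/-- The cone is an extension of the shift of `P` by `Q`. Here, unlike in `k1_bcone_comp`, both
complexes must be acyclic. -/
lemma k1_bcone (hC : SupportsLongExactSequences C) {P Q : BinaryComplex C} (hP : BAcyclic P)
    (hQ : BAcyclic Q) {φ : P.top ⟶ Q.top} {ψ : P.bot ⟶ Q.bot} (h : BAcyclic (BinaryComplex.bcone φ ψ)) :
    k1 _ h = k1 Q hQ - k1 P hP := by
  rw [k1_exact hQ h (hP.bshift hC) (bconeInr _ _) (bconeProj _ _) (isSES_cone φ),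
    k1_bshift hC hP, sub_eq_add_neg]

lemma coneInr_comp_coneMap {K L P : ChainComplex C ℤ} (f : K ⟶ L) (g : L ⟶ P) :
    coneInr f ≫ coneMap (f' := f ≫ g) (𝟙 K) g (Category.id_comp _) = g ≫ coneInr (f ≫ g) := by
  ext n
  apply cone_hom_ext <;> simp

lemma coneProj_comp_id {K L P : ChainComplex C ℤ} (f : K ⟶ L) (g : L ⟶ P) :
    coneProj f ≫ 𝟙 (shift K) =
      coneMap (f' := f ≫ g) (𝟙 K) g (Category.id_comp _) ≫ coneProj (f ≫ g) := by
  ext n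
  exact (coneMap_fst (f := f) (f' := f ≫ g) (𝟙 K) g (Category.id_comp _) n).symm

/-- The class of the mapping cone of a composite. -/
lemma k1_bcone_comp (hC : SupportsLongExactSequences C) {P Q R : BinaryComplex C}
    (hP : IsBounded P.X) {φ : P.top ⟶ Q.top} {ψ : P.bot ⟶ Q.bot}
    {φ' : Q.top ⟶ R.top} {ψ' : Q.bot ⟶ R.bot} (h : BAcyclic (BinaryComplex.bcone φ ψ))
    (h' : BAcyclic (BinaryComplex.bcone φ' ψ')) (h'' : BAcyclic (BinaryComplex.bcone (φ ≫ φ') (ψ ≫ ψ'))) :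
    k1 _ h'' = k1 _ h + k1 _ h' := by
  have hs : IsBounded (bshift P).X := hP.shift
  -- The pair `(α, β)` maps the cone of the first maps to the cone of the composites. Its own cone
  -- is computed twice: from a map of acyclic complexes (`e₁`), and as an extension of the cone of
  -- an identity by the cone of `(φ', ψ')` (`e₂`).
  let α : (bcone φ ψ).top ⟶ (bcone (φ ≫ φ') (ψ ≫ ψ')).top :=
    coneMap (f := φ) (f' := φ ≫ φ') (𝟙 _) φ' (by simp)
  let β : (bcone φ ψ).bot ⟶ (bcone (φ ≫ φ') (ψ ≫ ψ')).bot :=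
    coneMap (f := ψ) (f' := ψ ≫ ψ') (𝟙 _) ψ' (by simp)
  have h₁ : BAcyclic (BinaryComplex.bcone α β) := BAcyclic.bcone h.bounded h''.bounded
    (isQuasiIso_of_isAcyclic hC h.bounded h''.bounded α h.top h''.top)
    (isQuasiIso_of_isAcyclic hC (K := (bcone φ ψ).bot) (L := (bcone (φ ≫ φ') (ψ ≫ ψ')).bot)
      h.bounded h''.bounded β h.bot h''.bot)
  have h₂ : BAcyclic (BinaryComplex.bcone (𝟙 (bshift P).top) (𝟙 (bshift P).bot)) := BAcyclic.bcone hs hs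
    (isQuasiIso_id hC hs) (isQuasiIso_id hC hs)
  have e₁ := k1_bcone hC h h'' h₁
  have e₂ := k1_bcone_exact h' h₁ h₂ (bconeInr φ ψ) (bconeProj φ ψ) (bconeInr (φ ≫ φ') (ψ ≫ ψ'))
    (bconeProj (φ ≫ φ') (ψ ≫ ψ')) (isSES_cone φ) (isSES_cone (φ ≫ φ'))
    (coneInr_comp_coneMap φ φ') (coneInr_comp_coneMap ψ ψ')
    (coneProj_comp_id φ φ') (coneProj_comp_id ψ ψ')
  rw [k1_bcone_id hC _ hs, add_zero, e₁] at e₂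
  rw [← e₂]
  abel

end

/-! ### Elements of `K₀Ω[0 ⟶ C]` as single classes; maps into direct sums and cones -/

section

variable {C : Type u} [Category.{v} C] [Preadditive C] [HasZeroObject C] [HasBinaryBiproducts C]
  [ExactCategory C]

lemma bAcyclic_tar (X : BObj (ZeroCat.fromZero C)) : BAcyclic X.tar :=
  ⟨X.tar_bounded,
    (isQuasiIso_iff_of_isZero _ (isZero_mapC_fromZero _)).1 X.compTop_quasiIso,
    (isQuasiIso_iff_of_isZero _ (isZero_mapC_fromZero _)).1 X.compBot_quasiIso⟩

lemma hom_ext_of_isZero {K L : ChainComplex C ℤ} (hK : ∀ i, IsZero (K.X i)) (f g : K ⟶ L) :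
    f = g := by
  ext i
  exact (hK i).eq_of_src _ _

lemma cls_eq_k1 (X : BObj (ZeroCat.fromZero C)) (h : BAcyclic X.tar) : X.cls = k1 X.tar h :=
  BObj.cls_eq_of_isP (f := (BObj.Hom.mk 0 0 (𝟙 X.tar)
    (hom_ext_of_isZero (isZero_mapC_fromZero _) _ _)
    (hom_ext_of_isZero (isZero_mapC_fromZero _) _ _) : X ⟶ k1Obj X.tar h))
    ⟨isQuasiIso_zeroCat _, isQuasiIso_zeroCat _, inferInstanceAs (IsIso (𝟙 X.tar))⟩

/-- Direct sums realize addition and shifts realize negation. -/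
lemma exists_eq_k1 (hC : SupportsLongExactSequences C) (y : K0Omega (ZeroCat.fromZero C)) :
    ∃ (A : BinaryComplex C) (h : BAcyclic A), y = k1 A h := by
  obtain ⟨x, rfl⟩ := QuotientAddGroup.mk_surjective y
  induction x using FreeAbelianGroup.induction_on with
  | zero =>
    let Z : ChainComplex C ℤ := { X := fun _ => 0, d := fun _ _ => 0 }
    have hZ : ∀ i, IsZero (Z.X i) := fun _ => isZero_zero C
    have hZ' : BAcyclic (BinaryComplex.diag Z) :=
      ⟨isBounded_of_isZero hZ, isAcyclic_of_isZero hZ, isAcyclic_of_isZero hZ⟩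
    exact ⟨_, hZ', (k1_diag hZ').symm⟩
  | of X => exact ⟨X.tar, bAcyclic_tar X, cls_eq_k1 X _⟩
  | neg X _ =>
    refine ⟨bshift X.tar, (bAcyclic_tar X).bshift hC, ?_⟩
    rw [k1_bshift hC (bAcyclic_tar X), ← cls_eq_k1]
    rfl
  | add x y hx hy =>
    obtain ⟨A, hA, hA'⟩ := hx
    obtain ⟨B, hB, hB'⟩ := hy
    refine ⟨bsum A B, hA.bsum hC hB, ?_⟩
    rw [k1_bsum hA hB, ← hA', ← hB']
    rfl

lemma csum_hom_ext {K L P : ChainComplex C ℤ} {f g : P ⟶ csum K L}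
    (h₁ : f ≫ csumFst K L = g ≫ csumFst K L) (h₂ : f ≫ csumSnd K L = g ≫ csumSnd K L) : f = g := by
  ext n
  exact twist_hom_ext (HomologicalComplex.congr_hom h₁ n) (HomologicalComplex.congr_hom h₂ n)

lemma csumLift_fst {K L P : ChainComplex C ℤ} (f : P ⟶ K) (g : P ⟶ L) :
    csumLift f g ≫ csumFst K L = f := by
  ext n
  simp

lemma csumLift_snd {K L P : ChainComplex C ℤ} (f : P ⟶ K) (g : P ⟶ L) :
    csumLift f g ≫ csumSnd K L = g := by
  ext n
  simp

lemma comp_csumLift {K L P Q : ChainComplex C ℤ} (h : Q ⟶ P) (f : P ⟶ K) (g : P ⟶ L) :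
    h ≫ csumLift f g = csumLift (h ≫ f) (h ≫ g) := by
  apply csum_hom_ext <;> simp only [Category.assoc, csumLift_fst, csumLift_snd]

lemma csumInl_fst (K L : ChainComplex C ℤ) : csumInl K L ≫ csumFst K L = 𝟙 K := by
  ext n
  simp

lemma csumInl_snd (K L : ChainComplex C ℤ) : csumInl K L ≫ csumSnd K L = 0 := by
  ext n
  simp

lemma comp_csumInl {K L P : ChainComplex C ℤ} (h : P ⟶ K) :
    h ≫ csumInl K L = csumLift h 0 := by
  apply csum_hom_ext <;>
    simp only [Category.assoc, csumLift_fst, csumLift_snd, csumInl_fst, csumInl_snd,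
      Category.comp_id, comp_zero]

/-- The chain map to a mapping cone with the given components. -/
noncomputable def coneMk {K L P : ChainComplex C ℤ} (f : K ⟶ L) (a : ∀ n, P.X n ⟶ K.X (n - 1))
    (b : ∀ n, P.X n ⟶ L.X n)
    (ha : ∀ n, P.d n (n - 1) ≫ a (n - 1) = -(a n ≫ K.d (n - 1) (n - 1 - 1)))
    (hb : ∀ n, P.d n (n - 1) ≫ b (n - 1) = a n ≫ f.f (n - 1) + b n ≫ L.d n (n - 1)) :
    P ⟶ cone f :=
  homMk (fun n => coneLift f (a n) (b n)) (fun n => by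
    apply cone_hom_ext <;> simp [ha, hb])

lemma supportsLongExactSequences_zeroCat : SupportsLongExactSequences ZeroCat :=
  fun _ _ _ _ => ⟨ZeroCat.pt, 0, Subsingleton.elim _ _, trivial⟩

end

/-! ### The image of `K₀Ω[0 ⟶ N]` in `K₀Ω[F]` -/

section

variable {M : Type u₁} [Category.{v₁} M] [Preadditive M] [HasZeroObject M]
  [HasBinaryBiproducts M] [ExactCategory M]
  {N : Type u₂} [Category.{v₂} N] [Preadditive N] [HasZeroObject N]
  [HasBinaryBiproducts N] [ExactCategory N] {F : M ⥤ N} [IsExactFunctor F]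

lemma BAcyclic.map {A : BinaryComplex M} (h : BAcyclic A) (F : M ⥤ N) [IsExactFunctor F] :
    BAcyclic ((mapB F).obj A) :=
  ⟨h.bounded.map F, h.top.map F, h.bot.map F⟩

lemma mapK0Omega_cls {M' : Type u₁'} [Category.{v₁'} M'] [Preadditive M'] [HasZeroObject M']
    [HasBinaryBiproducts M'] [ExactCategory M'] {N' : Type u₂'} [Category.{v₂'} N']
    [Preadditive N'] [HasZeroObject N'] [HasBinaryBiproducts N'] [ExactCategory N']
    {F' : M' ⥤ N'} [F'.Additive] (P : PairMap F F') (X : BObj F) :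
    P.mapK0Omega X.cls = (P.mapBObj X).cls := rfl

lemma pairMap₁_k1 {A : BinaryComplex M} (h : BAcyclic A) :
    (pairMap₁ F).mapK0Omega (k1 A h) = k1 ((mapB F).obj A) (h.map F) :=
  cls_eq_k1 ((pairMap₁ F).mapBObj (k1Obj A h)) (h.map F)

/-- An object of `B[F]` whose sources are acyclic comes from an acyclic binary complex. -/
lemma cls_eq_pairMap₂_k1 (X : BObj F) (h : BAcyclic X.tar)
    (ht : IsAcyclic X.srcTop) (hb : IsAcyclic X.srcBot) :
    X.cls = (pairMap₂ F).mapK0Omega (k1 X.tar h) := by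
  have hz : ∀ i, IsZero (((mapC (ZeroCat.fromZero M)).obj zeroComplex).X i) :=
    isZero_mapC_fromZero _
  have hz' : ∀ i, IsZero (((mapC F).obj ((mapC (ZeroCat.fromZero M)).obj zeroComplex)).X i) :=
    fun i => F.map_isZero (hz i)
  -- Zero maps into the acyclic sources are quasi-isomorphisms, so together with the identity of the
  -- target they form a map in `p`.
  refine (BObj.cls_eq_of_isP (X := (pairMap₂ F).mapBObj (k1Obj X.tar h)) (Y := X)
    (f := BObj.Hom.mk (X := (pairMap₂ F).mapBObj (k1Obj X.tar h)) (Y := X)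
      (0 : (mapC (ZeroCat.fromZero M)).obj zeroComplex ⟶ X.srcTop)
      (0 : (mapC (ZeroCat.fromZero M)).obj zeroComplex ⟶ X.srcBot) (𝟙 X.tar)
    (hom_ext_of_isZero hz' _ _) (hom_ext_of_isZero hz' _ _)) ⟨?_, ?_, ?_⟩).symm
  · exact (isQuasiIso_iff_of_isZero _ hz).2 ht
  · exact (isQuasiIso_iff_of_isZero _ hz).2 hb
  · exact inferInstanceAs (IsIso (𝟙 X.tar))

/-! ### Direct sums in `B[F]` -/

section

variable {K K' : ChainComplex M ℤ} {L L' : ChainComplex N ℤ}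

/-- The direct sum of two comparison maps. -/
noncomputable def sumComp (u : (mapC F).obj K ⟶ L) (u' : (mapC F).obj K' ⟶ L') :
    (mapC F).obj (csum K K') ⟶ csum L L' :=
  csumLift ((mapC F).map (csumFst K K') ≫ u) ((mapC F).map (csumSnd K K') ≫ u')

lemma mapC_csumInl_sumComp (u : (mapC F).obj K ⟶ L) (u' : (mapC F).obj K' ⟶ L') :
    (mapC F).map (csumInl K K') ≫ sumComp u u' = u ≫ csumInl L L' := by
  rw [sumComp, comp_csumLift, comp_csumInl, ← Category.assoc, ← Category.assoc,
    ← Functor.map_comp, ← Functor.map_comp, csumInl_fst, csumInl_snd,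
    CategoryTheory.Functor.map_id, Functor.map_zero, Category.id_comp, zero_comp]

lemma mapC_csumSnd_comp (u : (mapC F).obj K ⟶ L) (u' : (mapC F).obj K' ⟶ L') :
    (mapC F).map (csumSnd K K') ≫ u' = sumComp u u' ≫ csumSnd L L' := by
  rw [sumComp, csumLift_snd]

lemma isSES_map_csum (K K' : ChainComplex M ℤ) (n : ℤ) :
    IsSES (((mapC F).map (csumInl K K')).f n) (((mapC F).map (csumSnd K K')).f n) :=
  IsExactFunctor.map_ses _ _ (isSES_csum K K' n)

lemma isQuasiIso_sumComp (hN : SupportsLongExactSequences N) {u : (mapC F).obj K ⟶ L}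
    {u' : (mapC F).obj K' ⟶ L'} (hK : IsBounded K.X) (hK' : IsBounded K'.X)
    (hL : IsBounded L.X) (hL' : IsBounded L'.X) (hu : IsQuasiIso u) (hu' : IsQuasiIso u') :
    IsQuasiIso (sumComp u u') :=
  (LocQuasiIso.of_extension _ _ _ _ (isSES_map_csum K K') (isSES_csum L L')
    (mapC_csumInl_sumComp u u') (mapC_csumSnd_comp u u') hu.locQuasiIso
    hu'.locQuasiIso).isQuasiIso hN ((hK.biprod hK').map F) (hL.biprod hL')

end

/-- The direct sum of two objects of `B[F]`. -/
@[simps]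
noncomputable def BObj.sum (hN : SupportsLongExactSequences N) (X Y : BObj F) : BObj F where
  srcTop := csum X.srcTop Y.srcTop
  srcBot := csum X.srcBot Y.srcBot
  tar := bsum X.tar Y.tar
  srcTop_bounded := X.srcTop_bounded.biprod Y.srcTop_bounded
  srcBot_bounded := X.srcBot_bounded.biprod Y.srcBot_bounded
  tar_bounded := X.tar_bounded.biprod Y.tar_bounded
  compTop := sumComp X.compTop Y.compTop
  compBot := sumComp X.compBot Y.compBot
  compTop_quasiIso := isQuasiIso_sumComp hN X.srcTop_bounded Y.srcTop_bounded X.tar_bounded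
    Y.tar_bounded X.compTop_quasiIso Y.compTop_quasiIso
  compBot_quasiIso := isQuasiIso_sumComp hN X.srcBot_bounded Y.srcBot_bounded X.tar_bounded
    Y.tar_bounded X.compBot_quasiIso Y.compBot_quasiIso

/-- The first inclusion in a direct sum. -/
noncomputable def BObj.sumInl (hN : SupportsLongExactSequences N) (X Y : BObj F) :
    X ⟶ X.sum hN Y :=
  BObj.Hom.mk (Y := X.sum hN Y) (csumInl _ _) (csumInl _ _) (bsumInl _ _)
    (mapC_csumInl_sumComp _ _) (mapC_csumInl_sumComp _ _)

/-- The second projection of a direct sum. -/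
noncomputable def BObj.sumSnd (hN : SupportsLongExactSequences N) (X Y : BObj F) :
    X.sum hN Y ⟶ Y :=
  BObj.Hom.mk (X := X.sum hN Y) (csumSnd _ _) (csumSnd _ _) (bsumSnd _ _)
    (mapC_csumSnd_comp _ _) (mapC_csumSnd_comp _ _)

lemma BObj.isExact_sum (hN : SupportsLongExactSequences N) (X Y : BObj F) :
    BObj.IsExact (X.sumInl hN Y) (X.sumSnd hN Y) :=
  ⟨isSES_csum _ _, isSES_csum _ _, isSES_csum _ _⟩

lemma BObj.cls_sum (hN : SupportsLongExactSequences N) (X Y : BObj F) :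
    (X.sum hN Y).cls = X.cls + Y.cls :=
  cls_exact (BObj.isExact_sum hN X Y)

/-! ### Objects with a binary source -/

/-- The object of `B[F]` given by a binary complex in the source. -/
noncomputable def idObj (hN : SupportsLongExactSequences N) (P : BinaryComplex M)
    (hP : IsBounded P.X) : BObj F where
  srcTop := P.top
  srcBot := P.bot
  tar := (mapB F).obj P
  srcTop_bounded := hP
  srcBot_bounded := hP
  tar_bounded := hP.map F
  compTop := 𝟙 ((mapC F).obj P.top)
  compBot := 𝟙 ((mapC F).obj P.bot)
  compTop_quasiIso := isQuasiIso_id hN (hP.map F)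
  compBot_quasiIso := isQuasiIso_id hN (hP.map F)

/-- The construction is exact in `P` and sends diagonal complexes to diagonal objects, so
`eq_zero_of_additive` applies. -/
lemma cls_idObj (hN : SupportsLongExactSequences N) (P : BinaryComplex M)
    (hP : IsBounded P.X) : (idObj (F := F) hN P hP).cls = 0 := by
  refine eq_zero_of_additive (fun P hP => (idObj (F := F) hN P hP).cls) (fun K hK => ?_)
    (fun P Q R hP hQ hR i p hip => ?_) P hP
  · exact BObj.cls_diag (F := F)
      { src := K
        tar := (mapC F).obj K
        src_bounded := hK
        tar_bounded := hK.map F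
        comp := 𝟙 _
        comp_quasiIso := isQuasiIso_id hN (hK.map F) }
  · exact BObj.cls_exact
      (f := (BObj.Hom.mk (mapTop i) (mapBot i) ((mapB F).map i)
        ((Category.comp_id _).trans (Category.id_comp ((mapC F).map (mapTop i))).symm)
        ((Category.comp_id _).trans (Category.id_comp ((mapC F).map (mapBot i))).symm) :
          idObj (F := F) hN P hP ⟶ idObj hN Q hQ))
      (g := (BObj.Hom.mk (mapTop p) (mapBot p) ((mapB F).map p)
        ((Category.comp_id _).trans (Category.id_comp ((mapC F).map (mapTop p))).symm)
        ((Category.comp_id _).trans (Category.id_comp ((mapC F).map (mapBot p))).symm) :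
          idObj (F := F) hN Q hQ ⟶ idObj hN R hR))
      ⟨hip, hip, fun n => IsExactFunctor.map_ses _ _ (hip n)⟩

section

variable {K : ChainComplex M ℤ} {L : ChainComplex N ℤ} (u : (mapC F).obj K ⟶ L)

/-- The comparison map from the image of the cone of the identity to the cone. -/
noncomputable def mapCone : (mapC F).obj (cone (𝟙 K)) ⟶ cone u :=
  coneMk (P := (mapC F).obj (cone (𝟙 K))) u (fun n => F.map (coneFst (𝟙 K) n))
    (fun n => F.map (coneSnd (𝟙 K) n) ≫ u.f n)
    (fun n => by
      change F.map _ ≫ F.map _ = -(F.map _ ≫ F.map _)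
      rw [← F.map_comp, ← F.map_comp, cone_d_fst, F.map_neg])
    (fun n => by
      have key (v : F.obj (K.X (n - 1)) ⟶ L.X (n - 1)) (v' : F.obj (K.X n) ⟶ L.X n)
          (h : F.map (K.d n (n - 1)) ≫ v = v' ≫ L.d n (n - 1)) :
          F.map ((cone (𝟙 K)).d n (n - 1)) ≫ F.map (coneSnd (𝟙 K) (n - 1)) ≫ v =
            F.map (coneFst (𝟙 K) n) ≫ v + (F.map (coneSnd (𝟙 K) n) ≫ v') ≫ L.d n (n - 1) := by
        rw [← Category.assoc, ← F.map_comp, cone_d_snd, F.map_add, Preadditive.add_comp,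
          F.map_comp, F.map_comp, Category.assoc, Category.assoc, h, HomologicalComplex.id_f,
          F.map_id, Category.id_comp, Category.assoc]
      exact key _ _ (u.comm _ _).symm)

lemma mapCone_fst (n : ℤ) : (mapCone u).f n ≫ coneFst u n = F.map (coneFst (𝟙 K) n) :=
  coneLift_fst u (F.map (coneFst (𝟙 K) n)) _

lemma mapCone_snd (n : ℤ) :
    (mapCone u).f n ≫ coneSnd u n = F.map (coneSnd (𝟙 K) n) ≫ u.f n :=
  coneLift_snd u (F.map (coneFst (𝟙 K) n)) _

lemma map_coneInr_mapCone : (mapC F).map (coneInr (𝟙 K)) ≫ mapCone u = u ≫ coneInr u := by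
  ext n
  have h₁ : F.map ((coneInr (𝟙 K)).f n) ≫ F.map (coneFst (𝟙 K) n) = 0 := by
    rw [← F.map_comp, coneInr_fst, F.map_zero]
  have h₂ : F.map ((coneInr (𝟙 K)).f n) ≫ F.map (coneSnd (𝟙 K) n) = 𝟙 _ := by
    rw [← F.map_comp, coneInr_snd, F.map_id]
  have key (v : F.obj (K.X n) ⟶ L.X n) :
      F.map ((coneInr (𝟙 K)).f n) ≫ F.map (coneSnd (𝟙 K) n) ≫ v = v := by
    rw [← Category.assoc, h₂, Category.id_comp]
  apply cone_hom_ext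
  · refine (Category.assoc _ _ _).trans (Eq.trans ?_ (Category.assoc _ _ _).symm)
    rw [coneInr_fst, comp_zero, mapCone_fst]
    exact h₁
  · refine (Category.assoc _ _ _).trans (Eq.trans ?_ (Category.assoc _ _ _).symm)
    rw [coneInr_snd, Category.comp_id, mapCone_snd]
    exact key _

/-- The projection of the cone of a comparison map. -/
noncomputable def coneProjMap : cone u ⟶ (mapC F).obj (shift K) :=
  homMk (L := (mapC F).obj (shift K)) (fun n => coneFst u n) (fun n => by
    change coneFst u n ≫ F.map (-K.d (n - 1) (n - 1 - 1)) = (cone u).d n (n - 1) ≫ coneFst u (n - 1)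
    rw [cone_d_fst, F.map_neg]
    exact Preadditive.comp_neg _ _)

lemma mapCone_coneProjMap : (mapC F).map (coneProj (𝟙 K)) ≫ 𝟙 ((mapC F).obj (shift K)) =
    mapCone u ≫ coneProjMap u := by
  rw [Category.comp_id]
  ext n
  exact (mapCone_fst u n).symm

end

/-- The object of `B[F]` whose source is a binary complex. -/
def binObj (P : BinaryComplex M) (Q : BinaryComplex N) (hP : IsBounded P.X) (hQ : IsBounded Q.X)
    (u : (mapC F).obj P.top ⟶ Q.top) (v : (mapC F).obj P.bot ⟶ Q.bot) (hu : IsQuasiIso u)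
    (hv : IsQuasiIso v) : BObj F where
  srcTop := P.top
  srcBot := P.bot
  tar := Q
  srcTop_bounded := hP
  srcBot_bounded := hP
  tar_bounded := hQ
  compTop := u
  compBot := v
  compTop_quasiIso := hu
  compBot_quasiIso := hv

/-- The class of an object of `B[F]` whose source is a binary complex is the class of a mapping
cone. -/
lemma cls_binObj (hM : SupportsLongExactSequences M) (hN : SupportsLongExactSequences N)
    (P : BinaryComplex M) (Q : BinaryComplex N) (hP : IsBounded P.X) (hQ : IsBounded Q.X)
    (u : (mapC F).obj P.top ⟶ Q.top) (v : (mapC F).obj P.bot ⟶ Q.bot) (hu : IsQuasiIso u)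
    (hv : IsQuasiIso v) (h : BAcyclic (bcone (P := (mapB F).obj P) (Q := Q) u v)) :
    (binObj P Q hP hQ u v hu hv).cls = (pairMap₂ F).mapK0Omega (k1 _ h) := by
  have hs : IsBounded (bshift P).X := hP.shift
  have hct : IsAcyclic (cone (𝟙 P.top)) := (isQuasiIso_iff _).1 (isQuasiIso_id hM hP)
  have hcb : IsAcyclic (cone (𝟙 P.bot)) :=
    (isQuasiIso_iff _).1 (isQuasiIso_id (K := P.bot) hM hP)
  have hcbd : IsBounded (cone (𝟙 P.top)).X := hP.cone hP (𝟙 P.top)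
  have hcbd' : IsBounded (cone (𝟙 P.bot)).X := hP.cone (K := P.bot) (L := P.bot) hP (𝟙 P.bot)
  have hu' : IsAcyclic (cone u) := (isQuasiIso_iff u).1 hu
  have hv' : IsAcyclic (cone v) := (isQuasiIso_iff v).1 hv
  have hbu : IsBounded (cone u).X := (hP.map F).cone hQ u
  have hbv : IsBounded (cone v).X := (hP.map F).cone (K := (mapC F).obj P.bot) (L := Q.bot) hQ v
  -- The object `Y` is an extension of `idObj` of the shift of `P`, which has class zero, by the
  -- given object. Its sources are cones of identities, hence acyclic, so its class comes from its
  -- target, the cone of `(u, v)`.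
  let Y : BObj F :=
    { srcTop := cone (𝟙 P.top)
      srcBot := cone (𝟙 P.bot)
      tar := bcone (P := (mapB F).obj P) (Q := Q) u v
      srcTop_bounded := hcbd
      srcBot_bounded := hcbd'
      tar_bounded := hbu
      compTop := mapCone u
      compBot := mapCone v
      compTop_quasiIso := isQuasiIso_of_isAcyclic hN (hcbd.map F) hbu _ (hct.map F) hu'
      compBot_quasiIso := isQuasiIso_of_isAcyclic hN (hcbd'.map F) hbv _ (hcb.map F) hv' }
  let f : binObj P Q hP hQ u v hu hv ⟶ Y :=
    BObj.Hom.mk (X := binObj P Q hP hQ u v hu hv) (Y := Y) (coneInr (𝟙 P.top)) (coneInr (𝟙 P.bot))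
      (bconeInr (P := (mapB F).obj P) (Q := Q) u v)
      (map_coneInr_mapCone u) (map_coneInr_mapCone v)
  let g : Y ⟶ idObj (F := F) hN (bshift P) hs :=
    BObj.Hom.mk (X := Y) (Y := idObj (F := F) hN (bshift P) hs)
      (coneProj (𝟙 P.top)) (coneProj (𝟙 P.bot))
      (homOf (P := Y.tar) (Q := (mapB F).obj (bshift P)) (coneProjMap u)
        (coneProjMap v) (fun _ => rfl))
      (mapCone_coneProjMap u) (mapCone_coneProjMap v)
  have hfg : BObj.IsExact f g := ⟨isSES_cone (𝟙 P.top), isSES_cone (𝟙 P.bot), isSES_cone u⟩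
  rw [← cls_eq_pairMap₂_k1 Y h hct hcb, BObj.cls_exact hfg, cls_idObj, add_zero]

end

/-! ### The monoid of isomorphism classes -/

/-- The type of isomorphism classes of objects. -/
def IsoCls (C : Type u) [Category.{v} C] : Type u := Quotient (isIsomorphicSetoid C)

section

variable {C : Type u} [Category.{v} C]

/-- The isomorphism class of an object. -/
def isoCls (X : C) : IsoCls C := Quotient.mk _ X

lemma isoCls_eq_iff {X Y : C} : isoCls X = isoCls Y ↔ Nonempty (X ≅ Y) := Quotient.eq

lemma isoCls_eq {X Y : C} (e : X ≅ Y) : isoCls X = isoCls Y := isoCls_eq_iff.2 ⟨e⟩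

lemma IsoCls.exists_eq (a : IsoCls C) : ∃ X, a = isoCls X := by
  obtain ⟨X, rfl⟩ := Quotient.exists_rep a
  exact ⟨X, rfl⟩

variable [HasBinaryProducts C] [HasTerminal C]

noncomputable instance : Zero (IsoCls C) := ⟨isoCls (⊤_ C)⟩

noncomputable instance : Add (IsoCls C) :=
  ⟨Quotient.map₂ (fun X Y => X ⨯ Y) (fun _ _ ⟨e⟩ _ _ ⟨e'⟩ => ⟨prod.mapIso e e'⟩)⟩

noncomputable instance : AddCommMonoid (IsoCls C) where
  add_assoc a b c := by
    obtain ⟨X, rfl⟩ := a.exists_eq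
    obtain ⟨Y, rfl⟩ := b.exists_eq
    obtain ⟨Z, rfl⟩ := c.exists_eq
    exact isoCls_eq (prod.associator X Y Z)
  zero_add a := by
    obtain ⟨X, rfl⟩ := a.exists_eq
    exact isoCls_eq (prod.leftUnitor X)
  add_zero a := by
    obtain ⟨X, rfl⟩ := a.exists_eq
    exact isoCls_eq (prod.rightUnitor X)
  add_comm a b := by
    obtain ⟨X, rfl⟩ := a.exists_eq
    obtain ⟨Y, rfl⟩ := b.exists_eq
    exact isoCls_eq (prod.braiding X Y)
  nsmul := nsmulRec

end

lemma isoCls_biprod {C : Type u} [Category.{v} C] [Preadditive C] [HasBinaryBiproducts C]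
    [HasTerminal C] (X Y : C) : isoCls (X ⊞ Y) = isoCls X + isoCls Y :=
  isoCls_eq (biprod.isoProd X Y)

/-- A commutative monoid in which every element has a complement in a submonoid has a quotient
group in which exactly the elements stably in the submonoid vanish. -/
lemma exists_quotient_group {A : Type u} [AddCommMonoid A] (S : AddSubmonoid A)
    (hS : ∀ a, ∃ b, a + b ∈ S) :
    ∃ (G : Type u) (_ : AddCommGroup G) (q : A →+ G),
      ∀ a, q a = 0 ↔ ∃ s ∈ S, a + s ∈ S := by
  let of := Algebra.GrothendieckAddGroup.of (M := A)
  let H : AddSubgroup (Algebra.GrothendieckAddGroup A) := AddSubgroup.closure (of '' S)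
  refine ⟨Algebra.GrothendieckAddGroup A ⧸ H, inferInstance,
    (QuotientAddGroup.mk' H).comp of, fun a => ?_⟩
  -- The subgroup `H` consists of differences of elements of `S`.
  have hmem : ∀ x ∈ H, ∃ s ∈ S, ∃ t ∈ S, x + of s = of t := by
    intro x hx
    induction hx using AddSubgroup.closure_induction with
    | mem x hx =>
      obtain ⟨s, hs, rfl⟩ := hx
      exact ⟨0, S.zero_mem, s, hs, by simp⟩
    | zero => exact ⟨0, S.zero_mem, 0, S.zero_mem, by simp⟩
    | add x y _ _ hx hy =>
      obtain ⟨s, hs, t, ht, h⟩ := hx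
      obtain ⟨s', hs', t', ht', h'⟩ := hy
      refine ⟨s + s', S.add_mem hs hs', t + t', S.add_mem ht ht', ?_⟩
      rw [map_add, map_add, ← h, ← h']
      abel
    | neg x _ hx =>
      obtain ⟨s, hs, t, ht, h⟩ := hx
      exact ⟨t, ht, s, hs, by rw [← h]; abel⟩
  rw [AddMonoidHom.comp_apply, QuotientAddGroup.mk'_apply, QuotientAddGroup.eq_zero_iff]
  constructor
  · intro h
    obtain ⟨s, hs, t, ht, h⟩ := hmem _ h
    rw [← map_add] at h
    obtain ⟨c, hc⟩ := ((AddLocalization.addMonoidOf (⊤ : AddSubmonoid A)).eq_iff_exists).1 h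
    -- Equality in the Grothendieck group holds in the monoid only after adding some `c`; a
    -- complement of `c` turns it into an element of `S`.
    obtain ⟨d, hd⟩ := hS c
    refine ⟨s + (c + d), S.add_mem hs hd, ?_⟩
    have : a + (s + (c + d)) = t + (c + d) := by
      rw [← add_assoc t, add_comm t, ← hc]
      abel
    rw [this]
    exact S.add_mem ht hd
  · rintro ⟨s, hs, h⟩
    have h₁ : of s ∈ H := AddSubgroup.subset_closure ⟨s, hs, rfl⟩
    have h₂ : of (a + s) ∈ H := AddSubgroup.subset_closure ⟨_, h, rfl⟩
    rw [map_add] at h₂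
    exact (AddSubgroup.add_mem_cancel_right H h₁).1 h₂

section

variable {C : Type u} [Category.{v} C] [Preadditive C] [HasZeroObject C] [HasBinaryBiproducts C]
  [ExactCategory C]

variable (C) in
/-- The zero complex. -/
noncomputable def zeroCx : ChainComplex C ℤ where
  X _ := 0
  d _ _ := 0

lemma isZero_zeroCx (i : ℤ) : IsZero ((zeroCx C).X i) := isZero_zero C

lemma hom_ext_zeroCx {K : ChainComplex C ℤ} (f g : K ⟶ zeroCx C) : f = g := by
  ext i
  exact (isZero_zeroCx i).eq_of_tgt _ _

lemma isBounded_zeroCx : IsBounded (zeroCx C).X := isBounded_of_isZero isZero_zeroCx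

end

/-! ### Finite products in `B[F]` -/

section

variable {M : Type u₁} [Category.{v₁} M] [Preadditive M] [HasZeroObject M]
  [HasBinaryBiproducts M] [ExactCategory M]
  {N : Type u₂} [Category.{v₂} N] [Preadditive N] [HasZeroObject N]
  [HasBinaryBiproducts N] [ExactCategory N] {F : M ⥤ N} [IsExactFunctor F]

variable {K K' : ChainComplex M ℤ} {L L' : ChainComplex N ℤ}

lemma map_csumFst_comp (u : (mapC F).obj K ⟶ L) (u' : (mapC F).obj K' ⟶ L') :
    (mapC F).map (csumFst K K') ≫ u = sumComp u u' ≫ csumFst L L' := by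
  rw [sumComp, csumLift_fst]

lemma map_csumLift_sumComp {P : ChainComplex M ℤ} {Q : ChainComplex N ℤ}
    {w : (mapC F).obj P ⟶ Q} {u : (mapC F).obj K ⟶ L} {u' : (mapC F).obj K' ⟶ L'}
    {a : P ⟶ K} {b : P ⟶ K'} {c : Q ⟶ L} {d : Q ⟶ L'} (h : (mapC F).map a ≫ u = w ≫ c)
    (h' : (mapC F).map b ≫ u' = w ≫ d) :
    (mapC F).map (csumLift a b) ≫ sumComp u u' = w ≫ csumLift c d := by
  rw [sumComp, comp_csumLift, comp_csumLift, ← Category.assoc, ← Category.assoc,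
    ← Functor.map_comp, ← Functor.map_comp, csumLift_fst, csumLift_snd, h, h']

/-- The map to a direct sum of binary complexes with the given components. -/
noncomputable def bsumLift {C : Type u} [Category.{v} C] [Preadditive C] [HasBinaryBiproducts C]
    {P Q R : BinaryComplex C} (f : P ⟶ Q) (g : P ⟶ R) : P ⟶ bsum Q R :=
  homOf (P := P) (Q := bsum Q R) (csumLift (mapTop f) (mapTop g)) (csumLift (mapBot f) (mapBot g))
    (fun _ => rfl)

namespace BObj

/-- The first projection of a direct sum. -/
noncomputable def sumFst (hN : SupportsLongExactSequences N) (X Y : BObj F) :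
    X.sum hN Y ⟶ X :=
  BObj.Hom.mk (X := X.sum hN Y) (csumFst _ _) (csumFst _ _) (bsumFst _ _)
    (map_csumFst_comp _ _) (map_csumFst_comp _ _)

/-- The map to a direct sum with the given components. -/
noncomputable def sumLift (hN : SupportsLongExactSequences N) {X Y Z : BObj F} (f : Z ⟶ X)
    (g : Z ⟶ Y) : Z ⟶ X.sum hN Y :=
  BObj.Hom.mk (Y := X.sum hN Y) (csumLift f.srcTop g.srcTop) (csumLift f.srcBot g.srcBot)
    (bsumLift f.tar g.tar) (map_csumLift_sumComp f.commTop g.commTop)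
    (map_csumLift_sumComp f.commBot g.commBot)

lemma hom_ext {X Y : BObj F} {f g : X ⟶ Y} (h₁ : f.srcTop = g.srcTop) (h₂ : f.srcBot = g.srcBot)
    (h₃ : ∀ i, f.tar.f i = g.tar.f i) : f = g :=
  Hom.ext h₁ h₂ (BinaryComplex.Hom.ext (funext h₃))

lemma sumLift_fst (hN : SupportsLongExactSequences N) {X Y Z : BObj F} (f : Z ⟶ X)
    (g : Z ⟶ Y) : sumLift hN f g ≫ X.sumFst hN Y = f := by
  apply hom_ext
  · exact csumLift_fst f.srcTop g.srcTop
  · exact csumLift_fst f.srcBot g.srcBot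
  · exact fun i => HomologicalComplex.congr_hom (csumLift_fst (mapTop f.tar) (mapTop g.tar)) i

lemma sumLift_snd (hN : SupportsLongExactSequences N) {X Y Z : BObj F} (f : Z ⟶ X)
    (g : Z ⟶ Y) : sumLift hN f g ≫ X.sumSnd hN Y = g := by
  apply hom_ext
  · exact csumLift_snd f.srcTop g.srcTop
  · exact csumLift_snd f.srcBot g.srcBot
  · exact fun i => HomologicalComplex.congr_hom (csumLift_snd (mapTop f.tar) (mapTop g.tar)) i

lemma sum_hom_ext (hN : SupportsLongExactSequences N) {X Y Z : BObj F} {f g : Z ⟶ X.sum hN Y}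
    (h₁ : f ≫ X.sumFst hN Y = g ≫ X.sumFst hN Y) (h₂ : f ≫ X.sumSnd hN Y = g ≫ X.sumSnd hN Y) :
    f = g := by
  have e : ∀ {A B : BObj F} {p q : A ⟶ B}, p = q → p.srcTop = q.srcTop ∧ p.srcBot = q.srcBot ∧
      p.tar = q.tar := fun h => by rw [h]; exact ⟨rfl, rfl, rfl⟩
  obtain ⟨a₁, a₂, a₃⟩ := e h₁
  obtain ⟨b₁, b₂, b₃⟩ := e h₂
  refine hom_ext (csum_hom_ext a₁ b₁) (csum_hom_ext a₂ b₂) (fun i => ?_)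
  have h := csum_hom_ext (K := X.tar.top) (L := Y.tar.top) (f := mapTop f.tar) (g := mapTop g.tar)
    (congrArg mapTop a₃) (congrArg mapTop b₃)
  exact HomologicalComplex.congr_hom h i

/-- The direct sum is a product. -/
noncomputable def isLimitSum (hN : SupportsLongExactSequences N) (X Y : BObj F) :
    IsLimit (BinaryFan.mk (X.sumFst hN Y) (X.sumSnd hN Y)) :=
  BinaryFan.isLimitMk (fun s => sumLift hN s.fst s.snd)
    (fun _ => sumLift_fst hN _ _) (fun _ => sumLift_snd hN _ _)
    (fun _ _ h₁ h₂ => sum_hom_ext hN (h₁.trans (sumLift_fst hN _ _).symm)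
      (h₂.trans (sumLift_snd hN _ _).symm))

instance hasBinaryProducts [hN : Fact (SupportsLongExactSequences N)] :
    HasBinaryProducts (BObj F) :=
  have (X Y : BObj F) : HasLimit (pair X Y) := ⟨⟨_, isLimitSum hN.out X Y⟩⟩
  hasBinaryProducts_of_hasLimit_pair _

/-- The zero object of `B[F]`. -/
noncomputable def zero (F : M ⥤ N) [IsExactFunctor F] : BObj F where
  srcTop := zeroCx M
  srcBot := zeroCx M
  tar := BinaryComplex.diag (zeroCx N)
  srcTop_bounded := isBounded_zeroCx
  srcBot_bounded := isBounded_zeroCx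
  tar_bounded := isBounded_zeroCx
  compTop := 0
  compBot := 0
  compTop_quasiIso := (isQuasiIso_iff_of_isZero _ fun i =>
    F.map_isZero (isZero_zeroCx i)).2 (isAcyclic_of_isZero isZero_zeroCx)
  compBot_quasiIso := (isQuasiIso_iff_of_isZero _ fun i =>
    F.map_isZero (isZero_zeroCx i)).2 (isAcyclic_of_isZero isZero_zeroCx)

/-- The zero object is terminal. -/
noncomputable def isTerminalZero (F : M ⥤ N) [IsExactFunctor F] : IsTerminal (zero F) :=
  IsTerminal.ofUniqueHom
    (fun X => BObj.Hom.mk (Y := zero F) (0 : X.srcTop ⟶ zeroCx M) (0 : X.srcBot ⟶ zeroCx M)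
      (BinaryComplex.Hom.mk (L := BinaryComplex.diag (zeroCx N)) (fun _ => 0)
        (fun _ j => (isZero_zeroCx j).eq_of_tgt _ _) (fun _ j => (isZero_zeroCx j).eq_of_tgt _ _))
      (hom_ext_zeroCx _ _)
      (hom_ext_zeroCx _ _))
    (fun _ m => hom_ext (hom_ext_zeroCx _ _)
      (hom_ext_zeroCx _ _)
      (fun i => (isZero_zeroCx (C := N) i).eq_of_tgt (m.tar.f i) 0))

instance : HasTerminal (BObj F) := (isTerminalZero F).hasTerminal

lemma isoCls_sum [hN : Fact (SupportsLongExactSequences N)] (X Y : BObj F) :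
    isoCls (X.sum hN.out Y) = isoCls X + isoCls Y :=
  isoCls_eq ((isLimitSum hN.out X Y).conePointUniqueUpToIso (limit.isLimit (pair X Y)))

lemma isoCls_zero [Fact (SupportsLongExactSequences N)] : isoCls (zero F) = 0 :=
  isoCls_eq ((isTerminalZero F).uniqueUpToIso terminalIsTerminal)

/-- The morphism of direct sums. -/
noncomputable def sumMap (hN : SupportsLongExactSequences N) {X Y X' Y' : BObj F} (f : X ⟶ X')
    (g : Y ⟶ Y') : X.sum hN Y ⟶ X'.sum hN Y' :=
  sumLift hN (X.sumFst hN Y ≫ f) (X.sumSnd hN Y ≫ g)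

end BObj

end

/-! ### Graded isomorphism classes modulo acyclic complexes -/

section

variable {C : Type u} [Category.{v} C] [Preadditive C] [HasZeroObject C] [HasBinaryBiproducts C]
  [ExactCategory C]

/-- The graded isomorphism class of a chain complex. -/
def gradedCls (K : ChainComplex C ℤ) (i : ℤ) : IsoCls C := isoCls (K.X i)

lemma gradedCls_csum (K L : ChainComplex C ℤ) : gradedCls (csum K L) = gradedCls K + gradedCls L :=
  funext fun i => isoCls_biprod (K.X i) (L.X i)

lemma gradedCls_cone {K L : ChainComplex C ℤ} (f : K ⟶ L) :
    gradedCls (cone f) = gradedCls (shift K) + gradedCls L :=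
  funext fun i => isoCls_biprod (K.X (i - 1)) (L.X i)

lemma gradedCls_shift_cone {K L : ChainComplex C ℤ} (f : K ⟶ L) :
    gradedCls (shift (cone f)) = gradedCls (shift (shift K)) + gradedCls (shift L) :=
  funext fun i => isoCls_biprod (K.X (i - 1 - 1)) (L.X (i - 1))

/-- The graded isomorphism classes of bounded acyclic complexes. -/
def acyclicCls [hC : Fact (SupportsLongExactSequences C)] : AddSubmonoid (ℤ → IsoCls C) where
  carrier := {a | ∃ E : ChainComplex C ℤ, IsBounded E.X ∧ IsAcyclic E ∧ gradedCls E = a}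
  zero_mem' := ⟨zeroCx C, isBounded_zeroCx, isAcyclic_of_isZero isZero_zeroCx,
    funext fun _ => isoCls_eq ((isZero_zero C).iso (terminalIsTerminal.isZero))⟩
  add_mem' := by
    rintro _ _ ⟨E, hE, hE', rfl⟩ ⟨D, hD, hD', rfl⟩
    have hb : IsBounded (csum E D).X := hE.biprod hD
    exact ⟨csum E D, hb, (hE'.locExact.csum hD'.locExact).isAcyclic hC.out hb, gradedCls_csum E D⟩

variable [hC : Fact (SupportsLongExactSequences C)]

/-- Modulo acyclic classes the shift acts as negation (`gradedCls_add_shift_mem`), so this expresses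
that quasi-isomorphic complexes agree there. -/
lemma gradedCls_cone_mem {K L : ChainComplex C ℤ} (hK : IsBounded K.X) (hL : IsBounded L.X)
    {f : K ⟶ L} (hf : IsQuasiIso f) : gradedCls (shift K) + gradedCls L ∈ acyclicCls (C := C) :=
  ⟨cone f, hK.cone hL f, (isQuasiIso_iff f).1 hf, gradedCls_cone f⟩

lemma gradedCls_add_shift_mem {K : ChainComplex C ℤ} (hK : IsBounded K.X) :
    gradedCls (shift K) + gradedCls K ∈ acyclicCls (C := C) :=
  gradedCls_cone_mem hK hK (isQuasiIso_id hC.out hK)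

/-- This is the class of the cone of the quasi-isomorphism `cone f ⟶ P`. With shifts read as signs
it says `K - L + P = 0`. -/
lemma gradedCls_exact_mem {K L P : ChainComplex C ℤ} (hK : IsBounded K.X) (hL : IsBounded L.X)
    (hP : IsBounded P.X) (f : K ⟶ L) (g : L ⟶ P) (h : ∀ n, IsSES (f.f n) (g.f n)) :
    gradedCls (shift (shift K)) + gradedCls (shift L) + gradedCls P ∈ acyclicCls (C := C) := by
  have w : f ≫ g = 0 := by
    ext n
    exact (h n).zero
  rw [← gradedCls_shift_cone f]
  exact gradedCls_cone_mem (hK.cone hL f) hP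
    ((locQuasiIso_coneDesc f g w h).isQuasiIso hC.out (hK.cone hL f) hP)

/-- Two chain complexes are graded isomorphic after adding bounded acyclic complexes. -/
def StablyGradedIso (K L : ChainComplex C ℤ) : Prop :=
  ∃ a ∈ acyclicCls (C := C), ∃ b ∈ acyclicCls (C := C), gradedCls K + a = gradedCls L + b

end

/-! ### Stably graded isomorphic sources as an invariant of `K₀Ω[F]` -/

section

variable {M : Type u₁} [Category.{v₁} M] [Preadditive M] [HasZeroObject M]
  [HasBinaryBiproducts M] [ExactCategory M]
  {N : Type u₂} [Category.{v₂} N] [Preadditive N] [HasZeroObject N]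
  [HasBinaryBiproducts N] [ExactCategory N] {F : M ⥤ N} [IsExactFunctor F]

/-- The binary complex with the two differentials interchanged. -/
def BinaryComplex.swap {C : Type u} [Category.{v} C] [Preadditive C] (P : BinaryComplex C) :
    BinaryComplex C where
  X := P.X
  dTop := P.dBot
  dBot := P.dTop
  shapeTop := P.shapeBot
  shapeBot := P.shapeTop
  dTop_comp_dTop := P.dBot_comp_dBot
  dBot_comp_dBot := P.dTop_comp_dTop

namespace BObj

/-- The object of `B[F]` with top and bottom interchanged. -/
@[simps]
def swap (X : BObj F) : BObj F where
  srcTop := X.srcBot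
  srcBot := X.srcTop
  tar := X.tar.swap
  srcTop_bounded := X.srcBot_bounded
  srcBot_bounded := X.srcTop_bounded
  tar_bounded := X.tar_bounded
  compTop := X.compBot
  compBot := X.compTop
  compTop_quasiIso := X.compBot_quasiIso
  compBot_quasiIso := X.compTop_quasiIso

lemma gradedCls_srcTop_congr {X Y : BObj F} (e : X ≅ Y) :
    gradedCls X.srcTop = gradedCls Y.srcTop ∧ gradedCls X.srcBot = gradedCls Y.srcBot := by
  have h₁ : e.hom.srcTop ≫ e.inv.srcTop = 𝟙 _ := congrArg BObj.Hom.srcTop e.hom_inv_id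
  have h₂ : e.inv.srcTop ≫ e.hom.srcTop = 𝟙 _ := congrArg BObj.Hom.srcTop e.inv_hom_id
  have h₃ : e.hom.srcBot ≫ e.inv.srcBot = 𝟙 _ := congrArg BObj.Hom.srcBot e.hom_inv_id
  have h₄ : e.inv.srcBot ≫ e.hom.srcBot = 𝟙 _ := congrArg BObj.Hom.srcBot e.inv_hom_id
  exact ⟨funext fun i => isoCls_eq
      ⟨e.hom.srcTop.f i, e.inv.srcTop.f i, HomologicalComplex.congr_hom h₁ i,
        HomologicalComplex.congr_hom h₂ i⟩,
    funext fun i => isoCls_eq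
      ⟨e.hom.srcBot.f i, e.inv.srcBot.f i, HomologicalComplex.congr_hom h₃ i,
        HomologicalComplex.congr_hom h₄ i⟩⟩

/-- The submonoid of isomorphism classes of objects of `B[F]` with stably isomorphic sources. -/
def stablyIsoCls (F : M ⥤ N) [IsExactFunctor F] [Fact (SupportsLongExactSequences M)]
    [hN : Fact (SupportsLongExactSequences N)] : AddSubmonoid (IsoCls (BObj F)) where
  carrier := {a | ∃ X : BObj F, isoCls X = a ∧ StablyGradedIso X.srcTop X.srcBot}
  zero_mem' := ⟨zero F, isoCls_zero, 0, zero_mem _, 0, zero_mem _, rfl⟩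
  add_mem' := by
    rintro _ _ ⟨X, rfl, a, ha, b, hb, h⟩ ⟨Y, rfl, a', ha', b', hb', h'⟩
    refine ⟨X.sum hN.out Y, isoCls_sum X Y, a + a', add_mem ha ha', b + b', add_mem hb hb', ?_⟩
    rw [sum_srcTop, sum_srcBot, gradedCls_csum, gradedCls_csum, add_add_add_comm, h, h',
      add_add_add_comm]

variable [hM : Fact (SupportsLongExactSequences M)] [hN : Fact (SupportsLongExactSequences N)]

lemma isoCls_mem_stablyIsoCls {X : BObj F} :
    isoCls X ∈ stablyIsoCls F ↔ StablyGradedIso X.srcTop X.srcBot := by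
  refine ⟨?_, fun h => ⟨X, rfl, h⟩⟩
  rintro ⟨Y, h, h'⟩
  obtain ⟨e⟩ := isoCls_eq_iff.1 h
  obtain ⟨e₁, e₂⟩ := gradedCls_srcTop_congr e
  unfold StablyGradedIso at h' ⊢
  rwa [← e₁, ← e₂]

lemma exists_add_mem_stablyIsoCls (a : IsoCls (BObj F)) : ∃ b, a + b ∈ stablyIsoCls F := by
  obtain ⟨X, rfl⟩ := a.exists_eq
  refine ⟨isoCls X.swap, X.sum hN.out X.swap, isoCls_sum X X.swap, 0, zero_mem _, 0, zero_mem _, ?_⟩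
  rw [sum_srcTop, sum_srcBot, gradedCls_csum, gradedCls_csum, swap_srcTop, swap_srcBot,
    add_comm (gradedCls X.srcTop)]

/-- The invariant of `K₀Ω` in the stable graded isomorphism classes of sources. -/
lemma stablyGradedIso_of_cls_eq_zero {X : BObj F} (h : X.cls = 0) :
    StablyGradedIso X.srcTop X.srcBot := by
  obtain ⟨G, _, q, hq⟩ := exists_quotient_group (stablyIsoCls F) exists_add_mem_stablyIsoCls
  have hq' (X : BObj F) (hX : StablyGradedIso X.srcTop X.srcBot) : q (isoCls X) = 0 :=
    (hq _).2 ⟨0, zero_mem _, by rw [add_zero]; exact isoCls_mem_stablyIsoCls.2 hX⟩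
  let ψ : FreeAbelianGroup (BObj F) →+ G := FreeAbelianGroup.lift fun X => q (isoCls X)
  -- Under `q` the swap of `Y` is the negative of `Y`. The relations for exact sequences and for
  -- maps in `p` thus become the claim that a direct sum has stably graded isomorphic sources.
  have hψ : omegaRelations F ≤ ψ.ker := by
    refine (AddSubgroup.closure_le _).2 ?_
    rintro _ (⟨f, g, h⟩ | W | ⟨f, h⟩)
    · rename_i X Y Z
      have h₁ : q (isoCls ((X.sum hN.out Z).sum hN.out Y.swap)) = 0 := by
        -- With these acyclic classes added, each side consists of `X`, `X[1]`, `X[2]`, `Y`, `Y[1]`,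
        -- `Z`, each once for the top and once for the bottom, and so is symmetric.
        refine hq' _ ⟨_, add_mem (add_mem (add_mem
            (gradedCls_exact_mem X.srcBot_bounded Y.srcBot_bounded Z.srcBot_bounded f.srcBot
              g.srcBot h.srcBot) (gradedCls_add_shift_mem Y.srcTop_bounded))
            (gradedCls_add_shift_mem X.srcBot_bounded))
            (gradedCls_add_shift_mem (K := shift X.srcTop) X.srcTop_bounded.shift),
          _, add_mem (add_mem (add_mem
            (gradedCls_exact_mem X.srcTop_bounded Y.srcTop_bounded Z.srcTop_bounded f.srcTop
              g.srcTop h.srcTop) (gradedCls_add_shift_mem Y.srcBot_bounded))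
            (gradedCls_add_shift_mem X.srcTop_bounded))
            (gradedCls_add_shift_mem (K := shift X.srcBot) X.srcBot_bounded.shift), ?_⟩
        simp only [sum_srcTop, sum_srcBot, gradedCls_csum, swap_srcTop, swap_srcBot]
        abel
      have h₂ : q (isoCls (Y.sum hN.out Y.swap)) = 0 := by
        refine hq' _ ⟨0, zero_mem _, 0, zero_mem _, ?_⟩
        simp only [sum_srcTop, sum_srcBot, gradedCls_csum, swap_srcTop, swap_srcBot]
        abel
      rw [isoCls_sum, map_add] at h₁ h₂
      rw [isoCls_sum, map_add] at h₁
      change ψ _ = 0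
      simp only [ψ, map_sub, FreeAbelianGroup.lift_apply_of]
      rw [sub_sub, eq_neg_of_add_eq_zero_left h₁, eq_neg_of_add_eq_zero_left h₂, sub_self]
    · change ψ _ = 0
      simp only [ψ, FreeAbelianGroup.lift_apply_of]
      exact hq' _ ⟨0, zero_mem _, 0, zero_mem _, rfl⟩
    · rename_i X Y
      have h₁ : q (isoCls (X.sum hN.out Y.swap)) = 0 := by
        -- The same symmetrization: both sides become `X`, `X[1]`, `Y`, for top and bottom.
        refine hq' _ ⟨_, add_mem
            (gradedCls_cone_mem X.srcTop_bounded Y.srcTop_bounded h.srcTop)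
            (gradedCls_add_shift_mem X.srcBot_bounded), _, add_mem
            (gradedCls_cone_mem X.srcBot_bounded Y.srcBot_bounded h.srcBot)
            (gradedCls_add_shift_mem X.srcTop_bounded), ?_⟩
        simp only [sum_srcTop, sum_srcBot, gradedCls_csum, swap_srcTop, swap_srcBot]
        abel
      have h₂ : q (isoCls (Y.sum hN.out Y.swap)) = 0 := by
        refine hq' _ ⟨0, zero_mem _, 0, zero_mem _, ?_⟩
        simp only [sum_srcTop, sum_srcBot, gradedCls_csum, swap_srcTop, swap_srcBot]
        abel
      rw [isoCls_sum, map_add] at h₁ h₂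
      change ψ _ = 0
      simp only [ψ, map_sub, FreeAbelianGroup.lift_apply_of]
      rw [eq_neg_of_add_eq_zero_left h₁, eq_neg_of_add_eq_zero_left h₂, sub_self]
  have h₀ : ψ (FreeAbelianGroup.of X) = 0 := hψ ((QuotientAddGroup.eq_zero_iff _).1 h)
  rw [FreeAbelianGroup.lift_apply_of] at h₀
  obtain ⟨s, ⟨Z, rfl, a, ha, b, hb, hab⟩, hs⟩ := (hq _).1 h₀
  rw [← isoCls_sum] at hs
  obtain ⟨a', ha', b', hb', h'⟩ := isoCls_mem_stablyIsoCls.1 hs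
  rw [sum_srcTop, sum_srcBot, gradedCls_csum, gradedCls_csum] at h'
  obtain ⟨D, hD, hD', rfl⟩ := id ha
  -- The sources of `Z` cannot be cancelled in the monoid. A shift is added as a negative instead;
  -- `D` is included so that the relation `hab` between the sources of `Z` can be used.
  have hZ : gradedCls (shift (csum Z.srcTop D)) + gradedCls (csum Z.srcTop D) ∈
      acyclicCls (C := M) := gradedCls_add_shift_mem (Z.srcTop_bounded.biprod hD)
  rw [gradedCls_csum] at hZ
  refine ⟨_, add_mem (add_mem ha' hb) hZ, _, add_mem (add_mem hb' ha) hZ, ?_⟩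
  calc _ = (gradedCls X.srcTop + gradedCls Z.srcTop + a') + (gradedCls D + b) +
        gradedCls (shift (csum Z.srcTop D)) := by abel
    _ = (gradedCls X.srcBot + gradedCls Z.srcBot + b') + (gradedCls D + b) +
        gradedCls (shift (csum Z.srcTop D)) := by rw [h']
    _ = (gradedCls X.srcBot + (gradedCls Z.srcBot + b) + b') + gradedCls D +
        gradedCls (shift (csum Z.srcTop D)) := by abel
    _ = _ := by rw [← hab]; abel

end BObj

end

/-! ### Adding acyclic summands -/

section

variable {C : Type u} [Category.{v} C] [Preadditive C] [HasZeroObject C] [HasBinaryBiproducts C]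
  [ExactCategory C] {K L : ChainComplex C ℤ}

/-- The inclusion is an extension of `0 ⟶ L` by the identity of `K`, both quasi-isomorphisms. -/
lemma isQuasiIso_csumInl (hC : SupportsLongExactSequences C) (hK : IsBounded K.X)
    (hL : IsBounded L.X) (hL' : IsAcyclic L) : IsQuasiIso (csumInl K L) :=
  (LocQuasiIso.of_extension (f := 𝟙 K) (f'' := (0 : zeroCx C ⟶ L)) (𝟙 K) (0 : K ⟶ zeroCx C)
    (csumInl K L) (csumSnd K L) (fun n => isSES_of_isIso_left _ _ (isZero_zeroCx n))
    (isSES_csum K L) rfl (by rw [csumInl_snd, comp_zero])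
    (locQuasiIso_of_isIso _ fun n => inferInstanceAs (IsIso (𝟙 (K.X n))))
    ((locQuasiIso_iff_of_isZero _ isZero_zeroCx).2 hL'.locExact)).isQuasiIso hC hK (hK.biprod hL)

lemma isQuasiIso_csumSnd (hC : SupportsLongExactSequences C) (hK : IsBounded K.X)
    (hL : IsBounded L.X) (hK' : IsAcyclic K) : IsQuasiIso (csumSnd K L) :=
  (LocQuasiIso.of_extension (f := (0 : K ⟶ zeroCx C)) (f'' := 𝟙 L) (csumInl K L) (csumSnd K L)
    (0 : zeroCx C ⟶ L) (𝟙 L) (isSES_csum K L)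
    (fun n => isSES_of_isIso_right _ _ (isZero_zeroCx n)) (by rw [csumInl_snd, zero_comp]) rfl
    (locQuasiIso_of_locExact _ hK'.locExact (isAcyclic_of_isZero isZero_zeroCx).locExact)
    (locQuasiIso_of_isIso _ fun n => inferInstanceAs (IsIso (𝟙 (L.X n))))).isQuasiIso hC
      (hK.biprod hL) hL

lemma StablyGradedIso.exists_iso [Fact (SupportsLongExactSequences C)] (h : StablyGradedIso K L) :
    ∃ E D : ChainComplex C ℤ, IsBounded E.X ∧ IsBounded D.X ∧ IsAcyclic E ∧ IsAcyclic D ∧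
      Nonempty (∀ i, (csum K E).X i ≅ (csum L D).X i) := by
  obtain ⟨_, ⟨E, hE, hE', rfl⟩, _, ⟨D, hD, hD', rfl⟩, h⟩ := h
  rw [← gradedCls_csum, ← gradedCls_csum] at h
  exact ⟨E, D, hE, hD, hE', hD', ⟨fun i => (isoCls_eq_iff.1 (congrFun h i)).some⟩⟩

instance : Fact (SupportsLongExactSequences ZeroCat) := ⟨supportsLongExactSequences_zeroCat⟩

lemma k1_zeroCat {A : BinaryComplex ZeroCat} (h : BAcyclic A) : k1 A h = 0 :=
  k1_eq_zero h fun _ _ => Subsingleton.elim _ _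

end

/-! ### Binary resolutions, and exactness at the third and fourth terms -/

section

variable {M : Type u₁} [Category.{v₁} M] [Preadditive M] [HasZeroObject M]
  [HasBinaryBiproducts M] [ExactCategory M]
  {N : Type u₂} [Category.{v₂} N] [Preadditive N] [HasZeroObject N]
  [HasBinaryBiproducts N] [ExactCategory N] {F : M ⥤ N} [IsExactFunctor F]

/-- A binary complex that is quasi-isomorphic to the sources of an object of `B[F]`. -/
structure Res (X : BObj F) where
  P : BinaryComplex M
  bounded : IsBounded P.X
  top : P.top ⟶ X.srcTop
  bot : P.bot ⟶ X.srcBot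
  top_quasiIso : IsQuasiIso top
  bot_quasiIso : IsQuasiIso bot

namespace Res

variable {X : BObj F} (r : Res X)

/-- The top comparison map of a binary resolution. -/
noncomputable def compTop : ((mapB F).obj r.P).top ⟶ X.tar.top := (mapC F).map r.top ≫ X.compTop

/-- The bottom comparison map of a binary resolution. -/
noncomputable def compBot : ((mapB F).obj r.P).bot ⟶ X.tar.bot := (mapC F).map r.bot ≫ X.compBot

variable [hM : Fact (SupportsLongExactSequences M)] [hN : Fact (SupportsLongExactSequences N)]

lemma compTop_quasiIso : IsQuasiIso r.compTop :=
  IsQuasiIso.comp hN.out (r.bounded.map F) X.tar_bounded (r.top_quasiIso.map F) X.compTop_quasiIso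

lemma compBot_quasiIso : IsQuasiIso r.compBot :=
  IsQuasiIso.comp hN.out (r.bounded.map F) X.tar_bounded (r.bot_quasiIso.map F) X.compBot_quasiIso

lemma bAcyclic : BAcyclic (bcone r.compTop r.compBot) :=
  BAcyclic.bcone (r.bounded.map F) X.tar_bounded r.compTop_quasiIso r.compBot_quasiIso

/-- The class in `K₁` of a binary resolution. -/
noncomputable def cls : K0Omega (ZeroCat.fromZero N) := k1 _ r.bAcyclic

/-- A resolution is a map in `p` to `X` from an object with binary source, whose class `cls_binObj`
computes. -/
lemma cls_eq : X.cls = (pairMap₂ F).mapK0Omega r.cls := by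
  rw [cls, ← cls_binObj hM.out hN.out r.P X.tar r.bounded X.tar_bounded r.compTop r.compBot
    r.compTop_quasiIso r.compBot_quasiIso r.bAcyclic]
  exact (BObj.cls_eq_of_isP
    (X := binObj r.P X.tar r.bounded X.tar_bounded r.compTop r.compBot r.compTop_quasiIso
      r.compBot_quasiIso)
    (f := BObj.Hom.mk
      (X := binObj r.P X.tar r.bounded X.tar_bounded r.compTop r.compBot r.compTop_quasiIso
        r.compBot_quasiIso) r.top r.bot (𝟙 X.tar) (Category.comp_id _).symm
      (Category.comp_id _).symm)
    ⟨r.top_quasiIso, r.bot_quasiIso, inferInstanceAs (IsIso (𝟙 X.tar))⟩).symm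

/-- The binary resolution given by a graded isomorphism between the sources. -/
def ofIso (X : BObj F) (θ : ∀ i, X.srcTop.X i ≅ X.srcBot.X i) : Res X where
  P := zip X.srcTop X.srcBot θ
  bounded := X.srcTop_bounded
  top := 𝟙 X.srcTop
  bot := zipBot θ
  top_quasiIso := isQuasiIso_id hM.out X.srcTop_bounded
  bot_quasiIso := isQuasiIso_of_isIso (K := (zip X.srcTop X.srcBot θ).bot) hM.out
    X.srcTop_bounded X.srcBot_bounded _ fun i => inferInstanceAs (IsIso (θ i).hom)

/-- The binary resolution given by a stable graded isomorphism between the sources. -/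
noncomputable def ofStableIso (X : BObj F) (E D : ChainComplex M ℤ) (hE : IsBounded E.X)
    (hD : IsBounded D.X) (hE' : IsAcyclic E) (hD' : IsAcyclic D)
    (θ : ∀ i, (csum E X.srcTop).X i ≅ (csum D X.srcBot).X i) : Res X where
  P := zip (csum E X.srcTop) (csum D X.srcBot) θ
  bounded := hE.biprod X.srcTop_bounded
  top := csumSnd E X.srcTop
  bot := zipBot θ ≫ csumSnd D X.srcBot
  top_quasiIso := isQuasiIso_csumSnd hM.out hE X.srcTop_bounded hE'
  bot_quasiIso :=
    have hb : IsBounded (csum E X.srcTop).X := hE.biprod X.srcTop_bounded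
    IsQuasiIso.comp (K := (zip (csum E X.srcTop) (csum D X.srcBot) θ).bot) hM.out hb
      X.srcBot_bounded
      (isQuasiIso_of_isIso (K := (zip (csum E X.srcTop) (csum D X.srcBot) θ).bot) hM.out hb
        (hD.biprod X.srcBot_bounded) _ fun i => inferInstanceAs (IsIso (θ i).hom))
      (isQuasiIso_csumSnd hM.out hD X.srcBot_bounded hD')

end Res

variable [hM : Fact (SupportsLongExactSequences M)] [hN : Fact (SupportsLongExactSequences N)]

/-- The canonical binary resolution of the sum of an object and its swap. -/
noncomputable def swapRes (X : BObj F) : Res (X.sum hN.out X.swap) :=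
  Res.ofIso _ fun i => biprod.braiding (X.srcTop.X i) (X.srcBot.X i)

/-- The symmetry of the direct sum identifies the two sources of `X ⊕ swap X` as graded objects, so
this object has a resolution. Swapping is therefore negation modulo `K₁ N`. -/
lemma BObj.cls_add_cls_swap_mem_range (X : BObj F) :
    X.cls + X.swap.cls ∈ (pairMap₂ F).mapK0Omega.range := by
  rw [← BObj.cls_sum hN.out, (swapRes X).cls_eq]
  exact ⟨_, rfl⟩

/-- Modulo `K₁ N`, negatives are swaps and sums are direct sums, so a formal combination of objects
collapses to one object. -/
lemma exists_sub_cls_mem_range (z : K0Omega F) :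
    ∃ X : BObj F, z - X.cls ∈ (pairMap₂ F).mapK0Omega.range := by
  obtain ⟨x, rfl⟩ := QuotientAddGroup.mk_surjective z
  induction x using FreeAbelianGroup.induction_on with
  | zero =>
    refine ⟨BObj.zero F, ?_⟩
    rw [(Res.ofIso (BObj.zero F) fun i => Iso.refl _).cls_eq, QuotientAddGroup.mk_zero, zero_sub]
    exact neg_mem ⟨_, rfl⟩
  | of X => exact ⟨X, by rw [BObj.cls, sub_self]; exact zero_mem _⟩
  | neg X _ =>
    refine ⟨X.swap, ?_⟩
    have := neg_mem X.cls_add_cls_swap_mem_range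
    rwa [neg_add, ← sub_eq_add_neg] at this
  | add x y hx hy =>
    obtain ⟨X, hX⟩ := hx
    obtain ⟨Y, hY⟩ := hy
    refine ⟨X.sum hN.out Y, ?_⟩
    rw [QuotientAddGroup.mk_add, BObj.cls_sum, add_sub_add_comm]
    exact add_mem hX hY

/-! ### The composites vanish -/

/-- The object with source `A`, target `FA` and identity comparison has class zero. As `A` is
acyclic, that class is also the image of the class of `FA`. -/
lemma pairMap₂_pairMap₁ (y : K0Omega (ZeroCat.fromZero M)) :
    (pairMap₂ F).mapK0Omega ((pairMap₁ F).mapK0Omega y) = 0 := by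
  obtain ⟨A, hA, rfl⟩ := exists_eq_k1 hM.out y
  rw [pairMap₁_k1 hA, ← cls_idObj (F := F) hN.out A hA.bounded]
  exact (cls_eq_pairMap₂_k1 (idObj (F := F) hN.out A hA.bounded) (hA.map F) hA.top hA.bot).symm

/-- The resulting object has zero sources, so its class comes from `K₁` of the zero category, which
vanishes. -/
lemma pairMap₃_pairMap₂ (y : K0Omega (ZeroCat.fromZero N)) :
    (pairMap₃ F).mapK0Omega ((pairMap₂ F).mapK0Omega y) = 0 := by
  obtain ⟨A, hA, rfl⟩ := exists_eq_k1 hN.out y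
  rw [k1, mapK0Omega_cls, mapK0Omega_cls, cls_eq_pairMap₂_k1 _
    ⟨isBounded_zeroCat _, isAcyclic_zeroCat _, isAcyclic_zeroCat _⟩, k1_zeroCat, map_zero]
  · exact isAcyclic_of_isZero (fun i => isZero_mapC_fromZero zeroComplex i)
  · exact isAcyclic_of_isZero (fun i => isZero_mapC_fromZero zeroComplex i)

lemma isIso_zeroCat {P Q : BinaryComplex ZeroCat} (f : P ⟶ Q) : IsIso f :=
  isIso_of_components f fun _ => ⟨PUnit.unit, Subsingleton.elim _ _, Subsingleton.elim _ _⟩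

lemma hom_ext_zeroCat {K L : ChainComplex ZeroCat ℤ} (f g : K ⟶ L) : f = g := by
  ext
  exact Subsingleton.elim _ _

/-- The map between binary complexes of the zero category. -/
def zeroCatHom (P Q : BinaryComplex ZeroCat) : P ⟶ Q :=
  BinaryComplex.Hom.mk (fun _ => PUnit.unit) (fun _ _ => Subsingleton.elim _ _)
    (fun _ _ => Subsingleton.elim _ _)

/-- In `K₀Ω[C ⟶ 0]` quasi-isomorphic sources have the same class. -/
lemma cls_eq_of_quasiIso_toZero {X Y : BObj (ZeroCat.toZero M)} (f : X.srcTop ⟶ Y.srcTop)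
    (g : X.srcBot ⟶ Y.srcBot) (hf : IsQuasiIso f) (hg : IsQuasiIso g) : X.cls = Y.cls :=
  BObj.cls_eq_of_isP (f := BObj.Hom.mk f g (zeroCatHom X.tar Y.tar) (hom_ext_zeroCat _ _)
    (hom_ext_zeroCat _ _)) ⟨hf, hg, isIso_zeroCat _⟩

/-- The comparison maps are quasi-isomorphisms from the images of the sources to `(N, d)` and `(N,
d')`. These are the top and bottom of one binary complex, so `cls_idObj` applies over `[N ⟶ 0]`. -/
lemma pairMap₄_pairMap₃ (z : K0Omega F) :
    (pairMap₄ F).mapK0Omega ((pairMap₃ F).mapK0Omega z) = 0 := by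
  have key (X : BObj F) : (pairMap₄ F).mapK0Omega ((pairMap₃ F).mapK0Omega X.cls) = 0 := by
    rw [mapK0Omega_cls, mapK0Omega_cls, ← cls_idObj (F := ZeroCat.toZero N)
      supportsLongExactSequences_zeroCat X.tar X.tar_bounded]
    exact cls_eq_of_quasiIso_toZero
      (Y := idObj (F := ZeroCat.toZero N) supportsLongExactSequences_zeroCat X.tar X.tar_bounded)
      X.compTop X.compBot X.compTop_quasiIso X.compBot_quasiIso
  obtain ⟨X, y, hy⟩ := exists_sub_cls_mem_range z
  rw [← sub_add_cancel z X.cls, ← hy, map_add, map_add, key, pairMap₃_pairMap₂, map_zero, add_zero]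

/-! ### Exactness in the middle and at the source term -/

/-- If the class of an object dies in `K₀Ω[M ⟶ 0]`, its sources are stably graded isomorphic. It
then has a binary resolution, which provides the preimage in `K₁ N`. -/
lemma exact_pairMap₂_pairMap₃ :
    Function.Exact (pairMap₂ F).mapK0Omega (pairMap₃ F).mapK0Omega := by
  refine fun z => ⟨fun hz => ?_, ?_⟩
  · obtain ⟨X, y, hy⟩ := exists_sub_cls_mem_range z
    have hX : (pairMap₃ F).mapK0Omega X.cls = 0 := by
      rw [← sub_sub_cancel z X.cls, ← hy, map_sub, hz, pairMap₃_pairMap₂, sub_zero]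
    have hX' : StablyGradedIso X.srcTop X.srcBot :=
      BObj.stablyGradedIso_of_cls_eq_zero (X := (pairMap₃ F).mapBObj X) hX
    obtain ⟨E, D, hE, hD, hE', hD', ⟨θ⟩⟩ := hX'.exists_iso
    -- The symmetries are needed because the acyclic summand comes second in `θ` but first in
    -- `Res.ofStableIso`.
    let r := (Res.ofStableIso X E D hE hD hE' hD' fun i =>
      (biprod.braiding (E.X i) (X.srcTop.X i)).trans ((θ i).trans
        (biprod.braiding (X.srcBot.X i) (D.X i))))
    exact ⟨y + r.cls, by rw [map_add, hy, ← r.cls_eq, sub_add_cancel]⟩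
  · rintro ⟨y, rfl⟩
    exact pairMap₃_pairMap₂ y

/-- The object of `B[F]` given by a stable graded isomorphism between the images of a pair of chain
complexes. -/
noncomputable def stableObj (hN : SupportsLongExactSequences N) {K L : ChainComplex M ℤ}
    {E D : ChainComplex N ℤ} (hK : IsBounded K.X) (hL : IsBounded L.X) (hE : IsBounded E.X)
    (hD : IsBounded D.X) (hE' : IsAcyclic E) (hD' : IsAcyclic D)
    (θ : ∀ i, (csum ((mapC F).obj K) E).X i ≅ (csum ((mapC F).obj L) D).X i) : BObj F where
  srcTop := K
  srcBot := L
  tar := zip (csum ((mapC F).obj K) E) (csum ((mapC F).obj L) D) θ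
  srcTop_bounded := hK
  srcBot_bounded := hL
  tar_bounded := (hK.map F).biprod hE
  compTop := csumInl ((mapC F).obj K) E
  compBot := csumInl ((mapC F).obj L) D ≫ zipBotInv θ
  compTop_quasiIso := isQuasiIso_csumInl hN (hK.map F) hE hE'
  compBot_quasiIso :=
    have hb : IsBounded (zip (csum ((mapC F).obj K) E) (csum ((mapC F).obj L) D) θ).bot.X :=
      (hK.map F).biprod hE
    IsQuasiIso.comp hN (hL.map F) hb (isQuasiIso_csumInl hN (hL.map F) hD hD')
      (isQuasiIso_of_isIso hN ((hL.map F).biprod hD) hb _ fun i =>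
        inferInstanceAs (IsIso (θ i).inv))

/-- If the images of the sources are stably graded isomorphic, transport of one differential
produces a binary target and hence an object of `B[F]` with these sources. -/
lemma exact_pairMap₃_pairMap₄ :
    Function.Exact (pairMap₃ F).mapK0Omega (pairMap₄ F).mapK0Omega := by
  refine fun z => ⟨fun hz => ?_, ?_⟩
  · obtain ⟨Y, y, hy⟩ := exists_sub_cls_mem_range z
    obtain ⟨A, hA, rfl⟩ := exists_eq_k1 supportsLongExactSequences_zeroCat y
    -- As `K₁` of the zero category vanishes, `z` is exactly the class of `Y`.
    rw [k1_zeroCat hA, map_zero, eq_comm, sub_eq_zero] at hy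
    obtain rfl := hy
    have hY : StablyGradedIso ((mapC F).obj Y.srcTop) ((mapC F).obj Y.srcBot) :=
      BObj.stablyGradedIso_of_cls_eq_zero (X := (pairMap₄ F).mapBObj Y) hz
    obtain ⟨E, D, hE, hD, hE', hD', ⟨θ⟩⟩ := hY.exists_iso
    let X : BObj F := stableObj hN.out Y.srcTop_bounded Y.srcBot_bounded hE hD hE' hD' θ
    exact ⟨X.cls, cls_eq_of_quasiIso_toZero (X := (pairMap₃ F).mapBObj X) (𝟙 Y.srcTop)
      (𝟙 Y.srcBot) (isQuasiIso_id hM.out Y.srcTop_bounded)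
      (isQuasiIso_id hM.out Y.srcBot_bounded)⟩
  · rintro ⟨y, rfl⟩
    exact pairMap₄_pairMap₃ y

end

/-! ### Direct sums of chain maps, and the cylinder of a short exact sequence -/

section

variable {C : Type u} [Category.{v} C] [Preadditive C] [HasZeroObject C] [HasBinaryBiproducts C]
  [ExactCategory C] {K L K' L' : ChainComplex C ℤ}

/-- The direct sum of two chain maps. -/
noncomputable def csumMap (f : K ⟶ K') (g : L ⟶ L') : csum K L ⟶ csum K' L' :=
  csumLift (csumFst K L ≫ f) (csumSnd K L ≫ g)

lemma csumMap_f (f : K ⟶ K') (g : L ⟶ L') (n : ℤ) : (csumMap f g).f n =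
    (biprod.map (f.f n) (g.f n) : (K.X n ⊞ L.X n : C) ⟶ (K'.X n ⊞ L'.X n : C)) := by
  apply twist_hom_ext
  · exact (HomologicalComplex.congr_hom (csumLift_fst (csumFst K L ≫ f) (csumSnd K L ≫ g)) n).trans
      (biprod.map_fst (f.f n) (g.f n)).symm
  · exact (HomologicalComplex.congr_hom (csumLift_snd (csumFst K L ≫ f) (csumSnd K L ≫ g)) n).trans
      (biprod.map_snd (f.f n) (g.f n)).symm

lemma csumInl_csumMap (f : K ⟶ K') (g : L ⟶ L') :
    csumInl K L ≫ csumMap f g = f ≫ csumInl K' L' := by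
  rw [csumMap, comp_csumLift, comp_csumInl, ← Category.assoc, ← Category.assoc, csumInl_fst,
    csumInl_snd, Category.id_comp, zero_comp]

lemma csumMap_csumSnd (f : K ⟶ K') (g : L ⟶ L') :
    csumMap f g ≫ csumSnd K' L' = csumSnd K L ≫ g :=
  csumLift_snd _ _

lemma isQuasiIso_csumMap (hC : SupportsLongExactSequences C) (hK : IsBounded K.X)
    (hL : IsBounded L.X) (hK' : IsBounded K'.X) (hL' : IsBounded L'.X) {f : K ⟶ K'} {g : L ⟶ L'}
    (hf : IsQuasiIso f) (hg : IsQuasiIso g) : IsQuasiIso (csumMap f g) :=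
  (LocQuasiIso.of_extension _ _ _ _ (isSES_csum K L) (isSES_csum K' L') (csumInl_csumMap f g)
    (csumMap_csumSnd f g).symm hf.locQuasiIso hg.locQuasiIso).isQuasiIso hC (hK.biprod hL)
      (hK'.biprod hL')

lemma isSES_csumMap {K'' L'' : ChainComplex C ℤ} (f : K ⟶ K') (g : L ⟶ L') (f' : K' ⟶ K'')
    (g' : L' ⟶ L'') (n : ℤ) (h : IsSES (f.f n) (f'.f n)) (h' : IsSES (g.f n) (g'.f n)) :
    IsSES ((csumMap f g).f n) ((csumMap f' g').f n) := by
  rw [csumMap_f, csumMap_f]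
  exact h.biprod_map h'

lemma twistInl_cylDesc (f : K ⟶ L) : twistInl _ ≫ cylDesc f = f := by
  ext n
  simp

lemma twistProj_coneDesc {P : ChainComplex C ℤ} (f : K ⟶ L) (g : L ⟶ P) (w : f ≫ g = 0) :
    twistProj _ ≫ coneDesc f g w = cylDesc f ≫ g := by
  ext n
  have := HomologicalComplex.congr_hom w n
  simp only [HomologicalComplex.comp_f, HomologicalComplex.zero_f] at this
  simp [this]

end

/-! ### Uniqueness of the class of a binary resolution modulo `K₁` of the source category -/

section

variable {M : Type u₁} [Category.{v₁} M] [Preadditive M] [HasZeroObject M]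
  [HasBinaryBiproducts M] [ExactCategory M]
  {N : Type u₂} [Category.{v₂} N] [Preadditive N] [HasZeroObject N]
  [HasBinaryBiproducts N] [ExactCategory N] {F : M ⥤ N} [IsExactFunctor F]

/-- The comparison map from the image of a mapping cone to the mapping cone of the image. -/
noncomputable def mapConeHom (F : M ⥤ N) [IsExactFunctor F] {K L : ChainComplex M ℤ} (f : K ⟶ L) :
    (mapC F).obj (cone f) ⟶ cone ((mapC F).map f) :=
  coneMk (P := (mapC F).obj (cone f)) ((mapC F).map f) (fun n => F.map (coneFst f n))
    (fun n => F.map (coneSnd f n))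
    (fun n => by
      change F.map _ ≫ F.map _ = -(F.map _ ≫ F.map _)
      rw [← F.map_comp, ← F.map_comp, cone_d_fst, F.map_neg])
    (fun n => by
      change F.map _ ≫ F.map _ = F.map _ ≫ F.map _ + F.map _ ≫ F.map _
      rw [← F.map_comp, ← F.map_comp, ← F.map_comp, cone_d_snd, F.map_add]
      rfl)

lemma isIso_mapConeHom_f {K L : ChainComplex M ℤ} (f : K ⟶ L) (n : ℤ) :
    IsIso ((mapConeHom F f).f n) := by
  refine ⟨(biprod.desc (F.map biprod.inl) (F.map biprod.inr) :
    (F.obj (K.X (n - 1)) ⊞ F.obj (L.X n) : N) ⟶ F.obj (K.X (n - 1) ⊞ L.X n)), ?_, ?_⟩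
  · change biprod.lift (F.map biprod.fst) (F.map biprod.snd) ≫
      biprod.desc (F.map biprod.inl) (F.map biprod.inr) = 𝟙 (F.obj (K.X (n - 1) ⊞ L.X n))
    rw [biprod.lift_desc, ← F.map_comp, ← F.map_comp, ← F.map_add, biprod.total, F.map_id]
  · change biprod.desc (F.map biprod.inl) (F.map biprod.inr) ≫
      biprod.lift (F.map biprod.fst) (F.map biprod.snd) =
        𝟙 (F.obj (K.X (n - 1)) ⊞ F.obj (L.X n) : N)
    ext <;> simp [← F.map_comp]

/-- An exact functor commutes with cones up to isomorphism, and the cone of `(φ, ψ)` is already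
acyclic in `M`. -/
lemma k1_bcone_map_mem_range [Fact (SupportsLongExactSequences M)]
    {P Q : BinaryComplex M} (hP : IsBounded P.X) (hQ : IsBounded Q.X)
    {φ : P.top ⟶ Q.top} {ψ : P.bot ⟶ Q.bot} (hφ : IsQuasiIso φ) (hψ : IsQuasiIso ψ)
    (h : BAcyclic (bcone (P := (mapB F).obj P) (Q := (mapB F).obj Q) ((mapC F).map φ)
      ((mapC F).map ψ))) :
    k1 _ h ∈ (pairMap₁ F).mapK0Omega.range := by
  have h' : BAcyclic (bcone φ ψ) := BAcyclic.bcone hP hQ hφ hψ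
  refine ⟨k1 _ h', (pairMap₁_k1 h').trans ?_⟩
  exact k1_eq_of_isIso (h'.map F) h
    (homOf (P := (mapB F).obj (bcone φ ψ))
      (Q := bcone (P := (mapB F).obj P) (Q := (mapB F).obj Q) ((mapC F).map φ) ((mapC F).map ψ))
      (mapConeHom F φ) (mapConeHom F ψ) fun _ => rfl) (isIso_mapConeHom_f φ)

lemma k1_bcone_of_comp (hN : SupportsLongExactSequences N) {P Q R : BinaryComplex N}
    (hP : IsBounded P.X) {φ : P.top ⟶ Q.top} {ψ : P.bot ⟶ Q.bot}
    {φ' : Q.top ⟶ R.top} {ψ' : Q.bot ⟶ R.bot} {φ'' : P.top ⟶ R.top} {ψ'' : P.bot ⟶ R.bot}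
    (h : BAcyclic (bcone φ ψ)) (h' : BAcyclic (bcone φ' ψ')) (h'' : BAcyclic (bcone φ'' ψ''))
    (e : φ ≫ φ' = φ'') (e' : ψ ≫ ψ' = ψ'') : k1 _ h'' = k1 _ h + k1 _ h' := by
  subst e e'
  exact k1_bcone_comp hN hP h h' h''

namespace BObj

/-- A morphism is an isomorphism on the sources and the target. -/
lemma isP_of_iso [hM : Fact (SupportsLongExactSequences M)] {X Y : BObj F} (e : X ≅ Y) :
    IsP e.hom := by
  have h₁ : e.hom.srcTop ≫ e.inv.srcTop = 𝟙 _ := congrArg BObj.Hom.srcTop e.hom_inv_id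
  have h₂ : e.inv.srcTop ≫ e.hom.srcTop = 𝟙 _ := congrArg BObj.Hom.srcTop e.inv_hom_id
  have h₃ : e.hom.srcBot ≫ e.inv.srcBot = 𝟙 _ := congrArg BObj.Hom.srcBot e.hom_inv_id
  have h₄ : e.inv.srcBot ≫ e.hom.srcBot = 𝟙 _ := congrArg BObj.Hom.srcBot e.inv_hom_id
  exact ⟨isQuasiIso_of_isIso hM.out X.srcTop_bounded Y.srcTop_bounded _ fun i =>
      ⟨e.inv.srcTop.f i, HomologicalComplex.congr_hom h₁ i, HomologicalComplex.congr_hom h₂ i⟩,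
    isQuasiIso_of_isIso hM.out X.srcBot_bounded Y.srcBot_bounded _ fun i =>
      ⟨e.inv.srcBot.f i, HomologicalComplex.congr_hom h₃ i, HomologicalComplex.congr_hom h₄ i⟩,
    ⟨e.inv.tar, congrArg BObj.Hom.tar e.hom_inv_id, congrArg BObj.Hom.tar e.inv_hom_id⟩⟩

lemma isP_sumMap [hM : Fact (SupportsLongExactSequences M)] (hN : SupportsLongExactSequences N)
    {X Y X' Y' : BObj F} {f : X ⟶ X'} {g : Y ⟶ Y'} (hf : IsP f) (hg : IsP g) :
    IsP (sumMap hN f g) where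
  srcTop := isQuasiIso_csumMap hM.out X.srcTop_bounded Y.srcTop_bounded X'.srcTop_bounded
    Y'.srcTop_bounded hf.srcTop hg.srcTop
  srcBot := isQuasiIso_csumMap hM.out X.srcBot_bounded Y.srcBot_bounded X'.srcBot_bounded
    Y'.srcBot_bounded hf.srcBot hg.srcBot
  tar := isIso_of_components _ fun i => by
    have h := hf.tar
    have h' := hg.tar
    have e : (sumMap hN f g).tar.f i = biprod.map (f.tar.f i) (g.tar.f i) :=
      csumMap_f (mapTop f.tar) (mapTop g.tar) i
    have : IsIso (biprod.map (f.tar.f i) (g.tar.f i)) :=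
      inferInstanceAs (IsIso (biprod.mapIso (asIso (f.tar.f i)) (asIso (g.tar.f i))).hom)
    rw [e]
    exact this

lemma isExact_sumMap (hN : SupportsLongExactSequences N) {X Y Z X' Y' Z' : BObj F} {f : X ⟶ Y}
    {g : Y ⟶ Z} {f' : X' ⟶ Y'} {g' : Y' ⟶ Z'} (h : IsExact f g) (h' : IsExact f' g') :
    IsExact (sumMap hN f f') (sumMap hN g g') where
  srcTop i := isSES_csumMap _ _ _ _ i (h.srcTop i) (h'.srcTop i)
  srcBot i := isSES_csumMap _ _ _ _ i (h.srcBot i) (h'.srcBot i)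
  tar i := isSES_csumMap (mapTop f.tar) (mapTop f'.tar) (mapTop g.tar) (mapTop g'.tar) i
    (h.tar i) (h'.tar i)

end BObj

namespace Res

variable [hM : Fact (SupportsLongExactSequences M)] [hN : Fact (SupportsLongExactSequences N)]

/-- Additivity of the class of binary resolutions. -/
lemma cls_exact {X Y Z : BObj F} {f : X ⟶ Y} {g : Y ⟶ Z} (h : BObj.IsExact f g) (r : Res X)
    (s : Res Y) (t : Res Z) (a : r.P ⟶ s.P) (b : s.P ⟶ t.P) (hab : ∀ i, IsSES (a.f i) (b.f i))
    (h₁ : mapTop a ≫ s.top = r.top ≫ f.srcTop) (h₂ : mapBot a ≫ s.bot = r.bot ≫ f.srcBot)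
    (h₃ : mapTop b ≫ t.top = s.top ≫ g.srcTop) (h₄ : mapBot b ≫ t.bot = s.bot ≫ g.srcBot) :
    s.cls = r.cls + t.cls := by
  have key {K K' : ChainComplex M ℤ} {L L' : ChainComplex N ℤ} {P P' : ChainComplex M ℤ}
      {u : (mapC F).obj K ⟶ L} {u' : (mapC F).obj K' ⟶ L'} {k : K ⟶ K'} {l : L ⟶ L'}
      (e : (mapC F).map k ≫ u' = u ≫ l) {p : P ⟶ P'} {v : P ⟶ K} {v' : P' ⟶ K'}
      (e' : p ≫ v' = v ≫ k) :
      (mapC F).map p ≫ (mapC F).map v' ≫ u' = ((mapC F).map v ≫ u) ≫ l := by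
    rw [← Category.assoc, ← Functor.map_comp, e', Functor.map_comp, Category.assoc, e,
      Category.assoc]
  exact k1_bcone_exact r.bAcyclic s.bAcyclic t.bAcyclic ((mapB F).map a) ((mapB F).map b)
    f.tar g.tar (fun n => IsExactFunctor.map_ses _ _ (hab n)) h.tar
    (key f.commTop h₁) (key f.commBot h₂) (key g.commTop h₃) (key g.commBot h₄)

/-- The direct sum of binary resolutions. -/
noncomputable def sum {X Y : BObj F} (r : Res X) (s : Res Y) : Res (X.sum hN.out Y) where
  P := bsum r.P s.P
  bounded := r.bounded.biprod s.bounded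
  top := csumMap r.top s.top
  bot := csumMap r.bot s.bot
  top_quasiIso := isQuasiIso_csumMap hM.out r.bounded s.bounded X.srcTop_bounded Y.srcTop_bounded
    r.top_quasiIso s.top_quasiIso
  bot_quasiIso := isQuasiIso_csumMap hM.out r.bounded s.bounded X.srcBot_bounded Y.srcBot_bounded
    r.bot_quasiIso s.bot_quasiIso

lemma cls_sum {X Y : BObj F} (r : Res X) (s : Res Y) : (r.sum s).cls = r.cls + s.cls :=
  cls_exact (BObj.isExact_sum hN.out X Y) r (r.sum s) s (bsumInl r.P s.P) (bsumSnd r.P s.P)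
    (isSES_csum r.P.top s.P.top) (csumInl_csumMap r.top s.top) (csumInl_csumMap r.bot s.bot)
    (csumMap_csumSnd r.top s.top).symm (csumMap_csumSnd r.bot s.bot).symm

/-- The interchange of top and bottom in a binary resolution. -/
def swap {X : BObj F} (r : Res X) : Res X.swap where
  P := r.P.swap
  bounded := r.bounded
  top := r.bot
  bot := r.top
  top_quasiIso := r.bot_quasiIso
  bot_quasiIso := r.top_quasiIso

/-- The image of a binary resolution under a map in `p`. -/
def push {X Y : BObj F} (r : Res X) {f : X ⟶ Y} (hf : BObj.IsP f) : Res Y where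
  P := r.P
  bounded := r.bounded
  top := r.top ≫ f.srcTop
  bot := r.bot ≫ f.srcBot
  top_quasiIso := IsQuasiIso.comp hM.out r.bounded Y.srcTop_bounded r.top_quasiIso hf.srcTop
  bot_quasiIso := IsQuasiIso.comp hM.out r.bounded Y.srcBot_bounded r.bot_quasiIso hf.srcBot

/-- Only the target of the comparison maps changes, by an isomorphism. -/
lemma cls_push {X Y : BObj F} (r : Res X) {f : X ⟶ Y} (hf : BObj.IsP f) :
    (r.push hf).cls = r.cls := by
  have h := hf.tar
  have key {K K' : ChainComplex M ℤ} {L L' : ChainComplex N ℤ} {P : ChainComplex M ℤ}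
      {u : (mapC F).obj K ⟶ L} {u' : (mapC F).obj K' ⟶ L'} {k : K ⟶ K'} {l : L ⟶ L'}
      (e : (mapC F).map k ≫ u' = u ≫ l) (v : P ⟶ K) :
      𝟙 ((mapC F).obj P) ≫ (mapC F).map (v ≫ k) ≫ u' = ((mapC F).map v ≫ u) ≫ l := by
    rw [Category.id_comp, Functor.map_comp, Category.assoc, e, Category.assoc]
  refine (k1_eq_of_isIso r.bAcyclic (r.push hf).bAcyclic
    (bconeMap (𝟙 ((mapB F).obj r.P)) f.tar (key f.commTop r.top) (key f.commBot r.bot))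
    fun n => ?_).symm
  exact inferInstanceAs (IsIso (biprod.mapIso (Iso.refl (F.obj (r.P.X (n - 1))))
    (asIso (f.tar.f n))).hom)

/-- All binary resolutions of an object with graded isomorphic sources have the same class modulo
`K₁` of the source category. -/
lemma cls_sub_cls_ofIso_mem {X : BObj F} (r : Res X) (θ : ∀ i, X.srcTop.X i ≅ X.srcBot.X i) :
    r.cls - (ofIso X θ).cls ∈ (pairMap₁ F).mapK0Omega.range := by
  -- The top and bottom of `Q` are isomorphic to the sources of `X`, so every resolution maps to it
  -- by quasi-isomorphisms `(φ, ψ)`. By the formula for cones of composites, the two classes differ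
  -- by the cone of `F(φ, ψ)`, which comes from `M`.
  let Q := zip X.srcTop X.srcBot θ
  have hQ : IsBounded Q.bot.X := X.srcTop_bounded
  let φ : r.P.top ⟶ Q.top := r.top
  let ψ : r.P.bot ⟶ Q.bot := r.bot ≫ zipBotInv θ
  have hψ : IsQuasiIso ψ := IsQuasiIso.comp hM.out r.bounded hQ r.bot_quasiIso
    (isQuasiIso_of_isIso hM.out X.srcBot_bounded hQ _ fun i =>
      inferInstanceAs (IsIso (θ i).inv))
  have e₁ : (mapC F).map φ ≫ (ofIso X θ).compTop = r.compTop := by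
    change (mapC F).map r.top ≫ (mapC F).map (𝟙 X.srcTop) ≫ X.compTop =
      (mapC F).map r.top ≫ X.compTop
    rw [CategoryTheory.Functor.map_id, Category.id_comp]
  have e₂ : (mapC F).map ψ ≫ (ofIso X θ).compBot = r.compBot := by
    have : ψ ≫ zipBot θ = r.bot := by
      ext i
      change (r.bot.f i ≫ (θ i).inv) ≫ (θ i).hom = r.bot.f i
      rw [Category.assoc, Iso.inv_hom_id]
      exact Category.comp_id _
    change (mapC F).map ψ ≫ (mapC F).map (zipBot θ) ≫ X.compBot = (mapC F).map r.bot ≫ X.compBot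
    rw [← Category.assoc, ← Functor.map_comp, this]
  have h : BAcyclic (bcone (P := (mapB F).obj r.P) (Q := (mapB F).obj Q) ((mapC F).map φ)
      ((mapC F).map ψ)) :=
    BAcyclic.bcone (r.bounded.map F) (X.srcTop_bounded.map F) (r.top_quasiIso.map F) (hψ.map F)
  have hc : r.cls = k1 _ h + (ofIso X θ).cls :=
    k1_bcone_of_comp hN.out (r.bounded.map F) h (ofIso X θ).bAcyclic r.bAcyclic e₁ e₂
  have hd : r.cls - (ofIso X θ).cls = k1 _ h := sub_eq_iff_eq_add.2 hc
  exact hd ▸ k1_bcone_map_mem_range r.bounded X.srcTop_bounded r.top_quasiIso hψ h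

/-- All binary resolutions of an object have the same class modulo `K₁` of the source category. -/
lemma cls_sub_cls_mem {X : BObj F} (r s : Res X) :
    r.cls - s.cls ∈ (pairMap₁ F).mapK0Omega.range := by
  -- The sources of `X` need not be graded isomorphic, but those of `X ⊕ swap X` are. Adding the
  -- resolution `s.swap` to both `r` and `s` makes them comparable with the same canonical
  -- resolution, and its class cancels in the difference.
  have := sub_mem
    (cls_sub_cls_ofIso_mem (r.sum s.swap) fun i =>
      biprod.braiding (X.srcTop.X i) (X.srcBot.X i))
    (cls_sub_cls_ofIso_mem (s.sum s.swap) fun i =>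
      biprod.braiding (X.srcTop.X i) (X.srcBot.X i))
  rwa [sub_sub_sub_cancel_right, cls_sum, cls_sum, add_sub_add_right_eq_sub] at this

end Res

end

/-! ### Exactness at `K₀Ω[0 ⟶ N]` -/

section

variable {M : Type u₁} [Category.{v₁} M] [Preadditive M] [HasZeroObject M]
  [HasBinaryBiproducts M] [ExactCategory M]
  {N : Type u₂} [Category.{v₂} N] [Preadditive N] [HasZeroObject N]
  [HasBinaryBiproducts N] [ExactCategory N] {F : M ⥤ N} [IsExactFunctor F]

variable [hM : Fact (SupportsLongExactSequences M)] [hN : Fact (SupportsLongExactSequences N)]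

/-- The object of `B[F]` with zero sources given by an acyclic binary complex. -/
noncomputable def tarObj (F : M ⥤ N) [IsExactFunctor F] (A : BinaryComplex N) (h : BAcyclic A) :
    BObj F where
  srcTop := zeroCx M
  srcBot := zeroCx M
  tar := A
  srcTop_bounded := isBounded_zeroCx
  srcBot_bounded := isBounded_zeroCx
  tar_bounded := h.bounded
  compTop := 0
  compBot := 0
  compTop_quasiIso := (isQuasiIso_iff_of_isZero _ fun i => F.map_isZero (isZero_zeroCx i)).2 h.top
  compBot_quasiIso := (isQuasiIso_iff_of_isZero _ fun i => F.map_isZero (isZero_zeroCx i)).2 h.bot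

lemma cls_tarObj (A : BinaryComplex N) (h : BAcyclic A) :
    (tarObj F A h).cls = (pairMap₂ F).mapK0Omega (k1 A h) :=
  cls_eq_pairMap₂_k1 (tarObj F A h) h (isAcyclic_of_isZero isZero_zeroCx)
    (isAcyclic_of_isZero isZero_zeroCx)

/-- The zero binary resolution. -/
noncomputable def tarRes (F : M ⥤ N) [IsExactFunctor F] (A : BinaryComplex N) (h : BAcyclic A) :
    Res (tarObj F A h) :=
  Res.ofIso _ fun _ => Iso.refl _

/-- The sources are zero, so the cone is its target `A`. -/
lemma cls_tarRes (A : BinaryComplex N) (h : BAcyclic A) : (tarRes F A h).cls = k1 A h := by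
  have hz (i : ℤ) : IsZero (F.obj ((zeroCx M).X i)) := F.map_isZero (isZero_zeroCx i)
  refine (k1_eq_of_isIso h (tarRes F A h).bAcyclic
    (bconeInr (P := (mapB F).obj (tarRes F A h).P) (Q := A) (tarRes F A h).compTop
      (tarRes F A h).compBot) fun n => ?_).symm
  refine ⟨coneSnd (tarRes F A h).compTop n, coneInr_snd (tarRes F A h).compTop n, ?_⟩
  apply cone_hom_ext (f := (tarRes F A h).compTop)
  · exact (hz (n - 1)).eq_of_tgt _ _
  · refine (Category.assoc _ _ _).trans ?_
    refine (congrArg (coneSnd (tarRes F A h).compTop n ≫ ·)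
      (coneInr_snd (tarRes F A h).compTop n)).trans ?_
    exact (Category.comp_id _).trans (Category.id_comp _).symm

/-- An acyclic binary complex whose class is opposite to the class of a binary resolution. -/
noncomputable def Res.negObj {X : BObj F} (r : Res X) : BObj F :=
  tarObj F (bshift (bcone r.compTop r.compBot)) (r.bAcyclic.bshift hN.out)

/-- The resolution of `Res.negObj`. -/
noncomputable def Res.neg {X : BObj F} (r : Res X) : Res r.negObj :=
  tarRes F _ (r.bAcyclic.bshift hN.out)

lemma Res.cls_neg {X : BObj F} (r : Res X) : r.neg.cls = -r.cls :=
  (cls_tarRes _ _).trans (k1_bshift hN.out r.bAcyclic _)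

/-- The isomorphism classes of objects that have a binary resolution with class from `K₁` of the
source category. -/
noncomputable def resolvedCls (F : M ⥤ N) [IsExactFunctor F] :
    AddSubmonoid (IsoCls (BObj F)) where
  carrier := {a | ∃ (X : BObj F) (r : Res X), isoCls X = a ∧
    r.cls ∈ (pairMap₁ F).mapK0Omega.range}
  zero_mem' := by
    refine ⟨BObj.zero F, Res.ofIso _ fun _ => Iso.refl _, BObj.isoCls_zero, ?_⟩
    have h : (Res.ofIso (BObj.zero F) fun _ => Iso.refl _).cls = 0 :=
      k1_eq_zero _ fun i j => (isZero_biprod (F.map_isZero (isZero_zeroCx (i - 1)))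
        (isZero_zeroCx i)).eq_of_src _ _
    rw [h]
    exact zero_mem _
  add_mem' := by
    rintro _ _ ⟨X, r, rfl, hr⟩ ⟨Y, s, rfl, hs⟩
    exact ⟨X.sum hN.out Y, r.sum s, BObj.isoCls_sum X Y, by rw [r.cls_sum]; exact add_mem hr hs⟩

lemma isoCls_mem_resolvedCls {X : BObj F} : isoCls X ∈ resolvedCls F ↔
    ∃ r : Res X, r.cls ∈ (pairMap₁ F).mapK0Omega.range := by
  refine ⟨?_, fun ⟨r, hr⟩ => ⟨X, r, rfl, hr⟩⟩
  rintro ⟨Y, r, h, hr⟩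
  obtain ⟨e⟩ := isoCls_eq_iff.1 h
  exact ⟨r.push (BObj.isP_of_iso e), by rwa [r.cls_push]⟩

lemma mem_resolvedCls_of_cls_eq_zero {X : BObj F} (r : Res X) (h : r.cls = 0) :
    isoCls X ∈ resolvedCls F :=
  isoCls_mem_resolvedCls.2 ⟨r, by rw [h]; exact zero_mem _⟩

lemma add_negObj_mem_resolvedCls {X : BObj F} (r : Res X) :
    isoCls X + isoCls r.negObj ∈ resolvedCls F := by
  rw [← BObj.isoCls_sum]
  exact mem_resolvedCls_of_cls_eq_zero (r.sum r.neg) (by rw [r.cls_sum, r.cls_neg, add_neg_cancel])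

/-- Adding the swap creates a resolution, and adding `negObj` brings its class to zero. -/
lemma exists_add_mem_resolvedCls (a : IsoCls (BObj F)) : ∃ b, a + b ∈ resolvedCls F := by
  obtain ⟨X, rfl⟩ := a.exists_eq
  refine ⟨isoCls X.swap + isoCls (swapRes X).negObj, ?_⟩
  rw [← add_assoc, ← BObj.isoCls_sum]
  exact add_negObj_mem_resolvedCls _

namespace BObj

/-- The object obtained by replacing the sources by quasi-isomorphic complexes. -/
noncomputable def precomp (X : BObj F) {K L : ChainComplex M ℤ} (hK : IsBounded K.X)
    (hL : IsBounded L.X) (f : K ⟶ X.srcTop) (g : L ⟶ X.srcBot) (hf : IsQuasiIso f)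
    (hg : IsQuasiIso g) : BObj F where
  srcTop := K
  srcBot := L
  tar := X.tar
  srcTop_bounded := hK
  srcBot_bounded := hL
  tar_bounded := X.tar_bounded
  compTop := (mapC F).map f ≫ X.compTop
  compBot := (mapC F).map g ≫ X.compBot
  compTop_quasiIso := IsQuasiIso.comp hN.out (hK.map F) X.tar_bounded (hf.map F) X.compTop_quasiIso
  compBot_quasiIso := IsQuasiIso.comp hN.out (hL.map F) X.tar_bounded (hg.map F) X.compBot_quasiIso

/-- The map in `p` from the object with replaced sources. -/
noncomputable def precompHom (X : BObj F) {K L : ChainComplex M ℤ} (hK : IsBounded K.X)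
    (hL : IsBounded L.X) (f : K ⟶ X.srcTop) (g : L ⟶ X.srcBot) (hf : IsQuasiIso f)
    (hg : IsQuasiIso g) : X.precomp hK hL f g hf hg ⟶ X :=
  BObj.Hom.mk (X := X.precomp hK hL f g hf hg) f g (𝟙 X.tar) (Category.comp_id _).symm
    (Category.comp_id _).symm

lemma isP_precompHom (X : BObj F) {K L : ChainComplex M ℤ} (hK : IsBounded K.X)
    (hL : IsBounded L.X) (f : K ⟶ X.srcTop) (g : L ⟶ X.srcBot) (hf : IsQuasiIso f)
    (hg : IsQuasiIso g) : IsP (X.precompHom hK hL f g hf hg) :=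
  ⟨hf, hg, inferInstanceAs (IsIso (𝟙 X.tar))⟩

end BObj

section

lemma mapBot_zipMap_comp {K L K' L' : ChainComplex M ℤ} {θ : ∀ i, K.X i ≅ L.X i}
    {θ' : ∀ i, K'.X i ≅ L'.X i} (a : K ⟶ K') (b : L ⟶ L')
    (h : ∀ i, a.f i ≫ (θ' i).hom = (θ i).hom ≫ b.f i) :
    mapBot (zipMap a b h) ≫ zipBot θ' = zipBot θ ≫ b := by
  ext i
  exact h i

/-- This and the next lemma make the exchange isomorphism of `map_isoCls_of_split` compatible with
the inclusions and the projections of the split sequences. -/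
lemma biprod_map_inl_comp_swap {X Y Z X' Y' Z' : M} {f : X ⟶ Y} {f' : X' ⟶ Y'} (s : Y ≅ X ⊞ Z)
    (t : Y' ≅ X' ⊞ Z') (hs : f ≫ s.hom = biprod.inl) (ht : f' ≫ t.hom = biprod.inl) :
    biprod.map f (biprod.inl : X' ⟶ X' ⊞ Z') ≫
        ((biprod.mapIso s t.symm).trans (biprod.braiding _ _)).hom =
      (biprod.braiding X X').hom ≫ biprod.map f' (biprod.inl : X ⟶ X ⊞ Z) := by
  have ht' : biprod.inl ≫ t.inv = f' := by rw [Iso.comp_inv_eq, ht]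
  ext <;> simp [reassoc_of% hs, ht']

lemma biprod_map_snd_comp_swap {X Y Z X' Y' Z' : M} {g : Y ⟶ Z} {g' : Y' ⟶ Z'} (s : Y ≅ X ⊞ Z)
    (t : Y' ≅ X' ⊞ Z') (hs : s.hom ≫ biprod.snd = g) (ht : t.hom ≫ biprod.snd = g') :
    biprod.map g (biprod.snd : X' ⊞ Z' ⟶ Z') ≫ (biprod.braiding Z Z').hom =
      ((biprod.mapIso s t.symm).trans (biprod.braiding _ _)).hom ≫
        biprod.map g' (biprod.snd : X ⊞ Z ⟶ Z) := by
  have ht' : t.inv ≫ g' = biprod.snd := by rw [Iso.inv_comp_eq, ht]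
  ext <;> simp [hs, ht']

variable {G : Type*} [AddCommGroup G] {q : IsoCls (BObj F) →+ G}

lemma map_eq_zero_of_mem_resolvedCls
    (hq : ∀ a, q a = 0 ↔ ∃ s ∈ resolvedCls F, a + s ∈ resolvedCls F)
    {a : IsoCls (BObj F)} (ha : a ∈ resolvedCls F) : q a = 0 :=
  (hq a).2 ⟨0, zero_mem _, by rwa [add_zero]⟩

/-- Resolutions push forward along maps in `p` without change of class, so a complement of `X` is
also a complement of `Y`. -/
lemma map_isoCls_eq_of_isP
    (hq : ∀ a, q a = 0 ↔ ∃ s ∈ resolvedCls F, a + s ∈ resolvedCls F)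
    {X Y : BObj F} {f : X ⟶ Y} (hf : BObj.IsP f) :
    q (isoCls X) = q (isoCls Y) := by
  obtain ⟨b, hb⟩ := exists_add_mem_resolvedCls (isoCls X)
  obtain ⟨Z, rfl⟩ := b.exists_eq
  have hb' : isoCls Y + isoCls Z ∈ resolvedCls F := by
    rw [← BObj.isoCls_sum] at hb ⊢
    obtain ⟨r, hr⟩ := isoCls_mem_resolvedCls.1 hb
    exact isoCls_mem_resolvedCls.2 ⟨r.push (BObj.isP_sumMap hN.out hf
      (BObj.isP_of_iso (Iso.refl Z))), by rwa [r.cls_push]⟩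
  have h₁ := map_eq_zero_of_mem_resolvedCls hq hb
  have h₂ := map_eq_zero_of_mem_resolvedCls hq hb'
  rw [map_add] at h₁ h₂
  rw [eq_neg_of_add_eq_zero_left h₁, eq_neg_of_add_eq_zero_left h₂]

/-- The splittings make the sources of `Y ⊕ (swap X ⊕ swap Z)` graded isomorphic. The resulting
resolution is an extension of the canonical ones for `Z ⊕ swap Z` and `X ⊕ swap X`, so its class is
their sum. -/
lemma map_isoCls_of_split
    (hq : ∀ a, q a = 0 ↔ ∃ s ∈ resolvedCls F, a + s ∈ resolvedCls F)
    {X Y Z : BObj F} {f : X ⟶ Y} {g : Y ⟶ Z} (h : BObj.IsExact f g)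
    (s : ∀ i, Y.srcTop.X i ≅ (X.srcTop.X i ⊞ Z.srcTop.X i : M))
    (t : ∀ i, Y.srcBot.X i ≅ (X.srcBot.X i ⊞ Z.srcBot.X i : M))
    (hs : ∀ i, f.srcTop.f i ≫ (s i).hom = biprod.inl)
    (hs' : ∀ i, (s i).hom ≫ biprod.snd = g.srcTop.f i)
    (ht : ∀ i, f.srcBot.f i ≫ (t i).hom = biprod.inl)
    (ht' : ∀ i, (t i).hom ≫ biprod.snd = g.srcBot.f i) :
    q (isoCls Y) = q (isoCls X) + q (isoCls Z) := by
  let W := Y.sum hN.out (X.swap.sum hN.out Z.swap)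
  let θ (i : ℤ) : W.srcTop.X i ≅ W.srcBot.X i :=
    (biprod.mapIso (s i) (t i).symm).trans (biprod.braiding _ _)
  let r : Res W := Res.ofIso W θ
  let f' : X.sum hN.out X.swap ⟶ W := BObj.sumMap hN.out f (BObj.sumInl hN.out X.swap Z.swap)
  let g' : W ⟶ Z.sum hN.out Z.swap := BObj.sumMap hN.out g (BObj.sumSnd hN.out X.swap Z.swap)
  have hfg : BObj.IsExact f' g' :=
    BObj.isExact_sumMap hN.out h (BObj.isExact_sum hN.out X.swap Z.swap)
  have hf (i : ℤ) : f'.srcTop.f i ≫ (θ i).hom =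
      (biprod.braiding (X.srcTop.X i) (X.srcBot.X i)).hom ≫ f'.srcBot.f i := by
    have e₁ : f'.srcTop.f i = biprod.map (f.srcTop.f i) biprod.inl :=
      (csumMap_f f.srcTop (csumInl X.srcBot Z.srcBot) i).trans (by rw [twistInl_f]; rfl)
    have e₂ : f'.srcBot.f i = biprod.map (f.srcBot.f i) biprod.inl :=
      (csumMap_f f.srcBot (csumInl X.srcTop Z.srcTop) i).trans (by rw [twistInl_f]; rfl)
    rw [e₁, e₂]
    exact biprod_map_inl_comp_swap (s i) (t i) (hs i) (ht i)
  have hg (i : ℤ) : g'.srcTop.f i ≫ (biprod.braiding (Z.srcTop.X i) (Z.srcBot.X i)).hom =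
      (θ i).hom ≫ g'.srcBot.f i := by
    have e₁ : g'.srcTop.f i = biprod.map (g.srcTop.f i) biprod.snd :=
      csumMap_f g.srcTop (csumSnd X.srcBot Z.srcBot) i
    have e₂ : g'.srcBot.f i = biprod.map (g.srcBot.f i) biprod.snd :=
      csumMap_f g.srcBot (csumSnd X.srcTop Z.srcTop) i
    rw [e₁, e₂]
    exact biprod_map_snd_comp_swap (s i) (t i) (hs' i) (ht' i)
  have hc : r.cls = (swapRes X).cls + (swapRes Z).cls :=
    Res.cls_exact hfg (swapRes X) r (swapRes Z) (zipMap f'.srcTop f'.srcBot hf)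
      (zipMap g'.srcTop g'.srcBot hg) hfg.srcTop
      ((Category.comp_id _).trans (Category.id_comp _).symm) (mapBot_zipMap_comp _ _ hf)
      ((Category.comp_id _).trans (Category.id_comp _).symm) (mapBot_zipMap_comp _ _ hg)
  -- The object `r.negObj` complements both `W` and `(X ⊕ swap X) ⊕ (Z ⊕ swap Z)`, so `q` takes the
  -- same value on these; the swaps then cancel.
  have h₁ := map_eq_zero_of_mem_resolvedCls hq (add_negObj_mem_resolvedCls r)
  have h₂ := map_eq_zero_of_mem_resolvedCls hq (mem_resolvedCls_of_cls_eq_zero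
    (((swapRes X).sum (swapRes Z)).sum r.neg)
    (by rw [Res.cls_sum, Res.cls_sum, r.cls_neg, hc, add_neg_cancel]))
  rw [← h₁] at h₂
  simp only [W, BObj.isoCls_sum, map_add] at h₂
  have h₃ : q (isoCls Y) - (q (isoCls X) + q (isoCls Z)) = 0 := by
    rw [← sub_eq_zero] at h₂
    rw [← neg_eq_zero, ← h₂]
    abel
  exact sub_eq_zero.1 h₃

/-- By invariance under `p`, the sources of `Y` and `Z` may be replaced by the cylinders and cones
of the source maps of `f`. The sequence then splits degreewise on sources, while the targets are
unchanged. -/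
lemma map_isoCls_exact
    (hq : ∀ a, q a = 0 ↔ ∃ s ∈ resolvedCls F, a + s ∈ resolvedCls F)
    {X Y Z : BObj F} {f : X ⟶ Y} {g : Y ⟶ Z} (h : BObj.IsExact f g) :
    q (isoCls Y) = q (isoCls X) + q (isoCls Z) := by
  have wt : f.srcTop ≫ g.srcTop = 0 := by
    ext i
    exact (h.srcTop i).zero
  have wb : f.srcBot ≫ g.srcBot = 0 := by
    ext i
    exact (h.srcBot i).zero
  have ht : IsBounded (cone f.srcTop).X := X.srcTop_bounded.cone Y.srcTop_bounded _
  have hb : IsBounded (cone f.srcBot).X := X.srcBot_bounded.cone Y.srcBot_bounded _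
  have ht' : IsBounded (cyl f.srcTop).X := X.srcTop_bounded.biprod ht
  have hb' : IsBounded (cyl f.srcBot).X := X.srcBot_bounded.biprod hb
  have ct := (locQuasiIso_cylDesc f.srcTop).isQuasiIso hM.out ht' Y.srcTop_bounded
  have cb := (locQuasiIso_cylDesc f.srcBot).isQuasiIso hM.out hb' Y.srcBot_bounded
  have dt := (locQuasiIso_coneDesc _ _ wt h.srcTop).isQuasiIso hM.out ht Z.srcTop_bounded
  have db := (locQuasiIso_coneDesc _ _ wb h.srcBot).isQuasiIso hM.out hb Z.srcBot_bounded
  rw [← map_isoCls_eq_of_isP hq (Y.isP_precompHom ht' hb' _ _ ct cb),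
    ← map_isoCls_eq_of_isP hq (Z.isP_precompHom ht hb _ _ dt db)]
  have key₁ {K K' P : ChainComplex M ℤ} {L L' : ChainComplex N ℤ} {u : (mapC F).obj K ⟶ L}
      {u' : (mapC F).obj K' ⟶ L'} {k : K ⟶ K'} {l : L ⟶ L'} (e : (mapC F).map k ≫ u' = u ≫ l)
      {p : K ⟶ P} {v : P ⟶ K'} (e' : p ≫ v = k) :
      (mapC F).map p ≫ (mapC F).map v ≫ u' = u ≫ l := by
    rw [← Category.assoc, ← Functor.map_comp, e', e]
  have key₂ {K K' P P' : ChainComplex M ℤ} {L L' : ChainComplex N ℤ} {u : (mapC F).obj K ⟶ L}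
      {u' : (mapC F).obj K' ⟶ L'} {k : K ⟶ K'} {l : L ⟶ L'} (e : (mapC F).map k ≫ u' = u ≫ l)
      {p : P ⟶ P'} {v : P ⟶ K} {v' : P' ⟶ K'} (e' : p ≫ v' = v ≫ k) :
      (mapC F).map p ≫ (mapC F).map v' ≫ u' = ((mapC F).map v ≫ u) ≫ l := by
    rw [← Category.assoc, ← Functor.map_comp, e', Functor.map_comp, Category.assoc, e,
      Category.assoc]
  let Y' := Y.precomp ht' hb' _ _ ct cb
  let Z' := Z.precomp ht hb _ _ dt db
  let f' : X ⟶ Y' := BObj.Hom.mk (Y := Y') (twistInl _) (twistInl _) f.tar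
    (key₁ f.commTop (twistInl_cylDesc f.srcTop)) (key₁ f.commBot (twistInl_cylDesc f.srcBot))
  let g' : Y' ⟶ Z' := BObj.Hom.mk (X := Y') (Y := Z') (twistProj _) (twistProj _) g.tar
    (key₂ g.commTop (twistProj_coneDesc f.srcTop g.srcTop wt))
    (key₂ g.commBot (twistProj_coneDesc f.srcBot g.srcBot wb))
  have h' : BObj.IsExact f' g' := ⟨isSES_twist _, isSES_twist _, h.tar⟩
  exact map_isoCls_of_split hq h' (fun i => Iso.refl _) (fun i => Iso.refl _)
    (fun i => (Category.comp_id _).trans (twistInl_f i)) (fun i => Category.id_comp _)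
    (fun i => (Category.comp_id _).trans (twistInl_f i)) (fun i => Category.id_comp _)

end

lemma exact_pairMap₁_pairMap₂ :
    Function.Exact (pairMap₁ F).mapK0Omega (pairMap₂ F).mapK0Omega := by
  refine fun y => ⟨fun hy => ?_, ?_⟩
  · obtain ⟨A, hA, rfl⟩ := exists_eq_k1 hN.out y
    rw [← cls_tarObj] at hy
    obtain ⟨G, _, q, hq⟩ := exists_quotient_group (resolvedCls F) exists_add_mem_resolvedCls
    let ψ : FreeAbelianGroup (BObj F) →+ G := FreeAbelianGroup.lift fun X => q (isoCls X)
    have hψ : omegaRelations F ≤ ψ.ker := by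
      refine (AddSubgroup.closure_le _).2 ?_
      rintro _ (⟨f, g, h⟩ | W | ⟨f, h⟩)
      · change ψ _ = 0
        simp only [ψ, map_sub, FreeAbelianGroup.lift_apply_of]
        rw [map_isoCls_exact hq h]
        abel
      · change ψ _ = 0
        simp only [ψ, FreeAbelianGroup.lift_apply_of]
        -- A diagonal object is resolved by the diagonal complex on its source, and the cone is
        -- again diagonal.
        refine map_eq_zero_of_mem_resolvedCls hq (mem_resolvedCls_of_cls_eq_zero
          (X := BObj.diag W)
          { P := BinaryComplex.diag W.src
            bounded := W.src_bounded
            top := 𝟙 W.src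
            bot := 𝟙 W.src
            top_quasiIso := isQuasiIso_id hM.out W.src_bounded
            bot_quasiIso := isQuasiIso_id hM.out W.src_bounded } ?_)
        exact k1_eq_zero _ fun _ _ => rfl
      · change ψ _ = 0
        simp only [ψ, map_sub, FreeAbelianGroup.lift_apply_of]
        rw [map_isoCls_eq_of_isP hq h, sub_self]
    have h₀ : ψ (FreeAbelianGroup.of (tarObj F A hA)) = 0 :=
      hψ ((QuotientAddGroup.eq_zero_iff _).1 hy)
    rw [FreeAbelianGroup.lift_apply_of] at h₀
    obtain ⟨s, ⟨Z, r, rfl, hr⟩, hs⟩ := (hq _).1 h₀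
    rw [← BObj.isoCls_sum] at hs
    obtain ⟨r', hr'⟩ := isoCls_mem_resolvedCls.1 hs
    -- There are two resolutions of the same sum: `r'`, with class from `K₁ M`, and the sum of
    -- `tarRes` and `r`, with class `k1 A hA + r.cls`. These classes agree modulo `K₁ M`, and
    -- `r.cls` comes from `K₁ M`, so `k1 A hA` does too.
    have := add_mem (((tarRes F A hA).sum r).cls_sub_cls_mem r') hr'
    rw [sub_add_cancel, Res.cls_sum, cls_tarRes] at this
    exact (AddSubgroup.add_mem_cancel_right _ hr).1 this
  · rintro ⟨y, rfl⟩
    exact pairMap₂_pairMap₁ y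

end

end RelK

theorem mainTheorem1
    {M : Type u₁} [CategoryTheory.Category.{v₁} M] [CategoryTheory.Preadditive M]
    [CategoryTheory.Limits.HasZeroObject M] [CategoryTheory.Limits.HasBinaryBiproducts M]
    [RelK.ExactCategory M]
    {N : Type u₂} [CategoryTheory.Category.{v₂} N] [CategoryTheory.Preadditive N]
    [CategoryTheory.Limits.HasZeroObject N] [CategoryTheory.Limits.HasBinaryBiproducts N]
    [RelK.ExactCategory N]
    (hM : RelK.SupportsLongExactSequences M) (hN : RelK.SupportsLongExactSequences N)
    (F : M ⥤ N) [RelK.IsExactFunctor F] :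
    Function.Exact (RelK.pairMap₁ F).mapK0Omega (RelK.pairMap₂ F).mapK0Omega ∧
    Function.Exact (RelK.pairMap₂ F).mapK0Omega (RelK.pairMap₃ F).mapK0Omega ∧
    Function.Exact (RelK.pairMap₃ F).mapK0Omega (RelK.pairMap₄ F).mapK0Omega := by
  have : Fact (RelK.SupportsLongExactSequences M) := ⟨hM⟩
  have : Fact (RelK.SupportsLongExactSequences N) := ⟨hN⟩
  exact ⟨RelK.exact_pairMap₁_pairMap₂, RelK.exact_pairMap₂_pairMap₃,
    RelK.exact_pairMap₃_pairMap₄⟩
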